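/- A convex disk is a convex compact subset of $\mathbb{R}^2$ with non-empty interior. It is smooth if every point $p$ of its boundary lies on exactly one tangent, where a tangent to a convex disk is a line that meets the disk but not its interior. A similarity of a set $A\subseteq\mathbb{R}^2$ is a rotated, positively scaled and translated copy of $A$, that is, a set $\{r\,\mathrm{Rot}_\theta\,a+z : a\in A\}$ with $r>0$, $\theta\in\mathbb{R}$ and $z\in\mathbb{R}^2$, where $\mathrm{Rot}_\theta=\begin{pmatrix}\cos\theta&-\sin\theta\\ \sin\theta&\cos\theta\end{pmatrix}$ (reflections are not allowed). Let $G^{\mathrm{sim}}(A)$ denote the class of finite simple graphs $G=(V,E)$ for which there is a map $R$ from $V$ to the set of similarities of $A$ such that, for all distinct $u,v\in V$, $R(u)\cap R(v)\neq\emptyset$ if and only if $uv\in E$. Let $A^*=\{(-x,y) : (x,y)\in A\}$. Theorem 2. Let $A$ and $B$ be smooth convex disks. Then $G^{\mathrm{sim}}(A)=G^{\mathrm{sim}}(B)$ if and only if $B$ is a similarity of $A$ or a similarity of $A^*$. -/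

import Mathlib

/-- The Euclidean plane. -/
abbrev Plane : Type := EuclideanSpace ℝ (Fin 2)

/-- A convex disk: a convex compact subset of the plane with non-empty interior. -/
def IsConvexDisk (A : Set Plane) : Prop :=
  Convex ℝ A ∧ IsCompact A ∧ (interior A).Nonempty

/-- A tangent to `A`: a line that meets `A` but does not meet the interior of `A`. -/
def IsTangentLine (l : AffineSubspace ℝ Plane) (A : Set Plane) : Prop :=
  Module.finrank ℝ l.direction = 1 ∧ ((l : Set Plane) ∩ A).Nonempty ∧
    Disjoint (l : Set Plane) (interior A)

/-- A smooth convex disk: every boundary point lies on exactly one tangent. -/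
def IsSmoothConvexDisk (A : Set Plane) : Prop :=
  IsConvexDisk A ∧
    ∀ p ∈ frontier A, ∃! l : AffineSubspace ℝ Plane, IsTangentLine l A ∧ p ∈ l

/-- The counterclockwise rotation of the plane by the angle `θ` about the origin. -/
noncomputable def planeRotation (θ : ℝ) : Plane →ₗ[ℝ] Plane :=
  Matrix.toEuclideanLin !![Real.cos θ, -Real.sin θ; Real.sin θ, Real.cos θ]

/-- The similarities of `A`: its rotated, positively scaled and translated copies
(no reflection). -/
def similarities (A : Set Plane) : Set (Set Plane) :=
  {A' | ∃ (r θ : ℝ) (z : Plane), 0 < r ∧ A' = (fun a => r • planeRotation θ a + z) '' A}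

/-- The horizontal reflection `A* = {(-x, y) : (x, y) ∈ A}`. -/
def reflection (A : Set Plane) : Set Plane :=
  (fun p : Plane => (!₂[-(p 0), p 1] : Plane)) '' A

/-- `R` is a realization of the graph `G` in the family `F` of subsets of the plane. -/
def IsRealization {V : Type*} (G : SimpleGraph V) (F : Set (Set Plane))
    (R : V → Set Plane) : Prop :=
  (∀ v, R v ∈ F) ∧ ∀ u v, u ≠ v → ((R u ∩ R v).Nonempty ↔ G.Adj u v)

/-- The class of finite graphs (each with vertices labelled by some `Fin n`, which covers all
finite graphs up to isomorphism) that have a realization by similarities of `A`. -/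
def simGraphs (A : Set Plane) : Set (Σ n : ℕ, SimpleGraph (Fin n)) :=
  {G | ∃ R : Fin G.1 → Set Plane, IsRealization G.2 (similarities A) R}

/-! After identifying the plane with ℂ, copies of `K` are the sets `wK + b`. Similarities and the
reflection clearly preserve the class of graphs, so the content is the converse.

Suppose every intersection graph of copies of `A` is one of copies of `B`. Realizing all finite
families of copies of `A` and choosing an ultrafilter gives a correspondence from all copies of `A`
to copies of `B` that respects any given incidence for almost all indices
(`exists_genericRealization`). Packing keeps it from degenerating: many disjoint chains of bounded
length cannot all be stretched across a long range of scales, so images stay at bounded relative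
distance, some image is smallest up to constants, and over some disk every image is comparable to
it. After normalization limits exist there, and incidences survive weakly
(`exists_limitRealization`).

All but countably many points of a given copy inside the disk lie in small copies with arbitrarily
small images. A translate of the Gaussian rationals avoids the exceptions, which yields a point map
`ψ` (`exists_pointMap`). Smoothness enters through `FillsHalfPlanes`: magnified copies exhaust
half-planes, so two disjoint copies on either side of a line can both reach small neighbourhoods of
any three points of that line. A line separating their images is a common transversal, so `ψ`
preserves collinearity (`PointMap.col`). Packing also prevents `ψ` from collapsing an open set into
a line (`PointMap.not_subset_line`). A local fundamental theorem of projective geometry then makes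
`ψ` projective near some point (`ColMap.exists_projective`), and blowing up there gives an
invertible real-linear map that takes every rotated copy of `A` to a copy of `B`
(`PointMap.exists_rlin`).

Exchanging `A` and `B` gives a linear map back. A linear map preserving the copies of one body has
powers of bounded distortion, hence is conformal or anticonformal (`MapsCopies.mul_eq_zero`).
Applying this to the composites with an arbitrary rotation inserted between the two maps shows that
the first map is itself `z ↦ αz` or `z ↦ βz̄` (`MapsCopies.mul_eq_zero_of_inverse`). -/

open Set Filter Topology Metric

/-! ### Copies of a convex body in the complex plane. -/

/-- The copy `w K + b` of `K`, for `u = (w, b)`. -/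
def copy (K : Set ℂ) (u : ℂ × ℂ) : Set ℂ := (fun z => u.1 * z + u.2) '' K

/-- Parameters `(w, b)` of an orientation preserving similarity `z ↦ w z + b`. -/
abbrev Par : Type := {u : ℂ × ℂ // u.1 ≠ 0}

/-- A convex body in the complex plane. -/
structure IsBody (K : Set ℂ) : Prop where
  convex : Convex ℝ K
  compact : IsCompact K
  nonempty : (interior K).Nonempty

theorem mem_copy_iff {K : Set ℂ} {u : ℂ × ℂ} (hu : u.1 ≠ 0) {z : ℂ} :
    z ∈ copy K u ↔ (z - u.2) / u.1 ∈ K := by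
  constructor
  · rintro ⟨a, ha, rfl⟩
    simpa [hu] using ha
  · intro h
    exact ⟨_, h, by field_simp; ring⟩

theorem mem_interior_copy_iff {K : Set ℂ} {u : ℂ × ℂ} (hu : u.1 ≠ 0) {z : ℂ} :
    z ∈ interior (copy K u) ↔ (z - u.2) / u.1 ∈ interior K := by
  have e : copy K u = ((Homeomorph.mulLeft₀ u.1 hu).trans (Homeomorph.addRight u.2)) '' K := rfl
  rw [e, ← Homeomorph.image_interior]
  exact mem_copy_iff (K := interior K) hu

theorem copy_convex {K : Set ℂ} (hK : Convex ℝ K) (u : ℂ × ℂ) : Convex ℝ (copy K u) := by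
  have e : copy K u = (fun z => u.2 + z) '' ((LinearMap.mulLeft ℝ u.1) '' K) := by
    rw [image_image]; simp only [copy, LinearMap.mulLeft_apply, add_comm]
  rw [e]
  exact (hK.linear_image _).translate u.2

theorem copy_compact {K : Set ℂ} (hK : IsCompact K) (u : ℂ × ℂ) : IsCompact (copy K u) :=
  hK.image (by fun_prop)

theorem copy_copy (K : Set ℂ) (u v : ℂ × ℂ) :
    copy (copy K u) v = copy K (v.1 * u.1, v.1 * u.2 + v.2) := by
  simp only [copy, image_image]
  congr 1
  ext z
  ring

theorem copy_one (K : Set ℂ) : copy K (1, 0) = K := by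
  simp [copy]

theorem copy_inj {u : ℂ × ℂ} (hu : u.1 ≠ 0) :
    Function.Injective (fun z : ℂ => u.1 * z + u.2) := by
  intro a b h
  simpa [hu] using h

theorem isBody_copy {K : Set ℂ} (hK : IsBody K) {u : ℂ × ℂ} (hu : u.1 ≠ 0) :
    IsBody (copy K u) where
  convex := copy_convex hK.convex u
  compact := copy_compact hK.compact u
  nonempty := by
    obtain ⟨a, ha⟩ := hK.nonempty
    exact ⟨u.1 * a + u.2, (mem_interior_copy_iff hu).2 (by simpa [hu] using ha)⟩

theorem IsBody.ne {K : Set ℂ} (hK : IsBody K) : K.Nonempty :=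
  hK.nonempty.mono interior_subset

theorem IsBody.bounds {K : Set ℂ} (hK : IsBody K) :
    ∃ (a : ℂ) (ρ R : ℝ), 0 < ρ ∧ 0 < R ∧ closedBall a ρ ⊆ K ∧ K ⊆ closedBall a R := by
  obtain ⟨a, ha⟩ := hK.nonempty
  obtain ⟨ρ, hρ, h⟩ := nhds_basis_closedBall.mem_iff.1 (mem_interior_iff_mem_nhds.1 ha)
  obtain ⟨R, hR, h'⟩ := hK.compact.isBounded.subset_closedBall_lt 0 a
  exact ⟨a, ρ, R, hρ, hR, h, h'⟩

theorem copy_nonempty {K : Set ℂ} (hK : IsBody K) (u : ℂ × ℂ) : (copy K u).Nonempty :=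
  hK.ne.image _

theorem dist_copy_le {K : Set ℂ} {a : ℂ} {R : ℝ} (hR : K ⊆ closedBall a R) {u : ℂ × ℂ}
    {x y : ℂ} (hx : x ∈ copy K u) (hy : y ∈ copy K u) : dist x y ≤ ‖u.1‖ * (2 * R) := by
  obtain ⟨x, hx, rfl⟩ := hx
  obtain ⟨y, hy, rfl⟩ := hy
  have h1 := hR hx
  have h2 := hR hy
  simp only [mem_closedBall, dist_eq_norm] at *
  have : u.1 * x + u.2 - (u.1 * y + u.2) = u.1 * ((x - a) - (y - a)) := by ring
  rw [this, norm_mul]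
  gcongr
  exact (norm_sub_le _ _).trans (by linarith)

/-! ### Packing bounds. -/

/-- Finitely many points of a fixed ball that are far from each other are boundedly many. -/
theorem exists_card_le_of_separated (R ε : ℝ) (hε : 0 < ε) :
    ∃ C : ℕ, ∀ {α : Type} (s : Finset α) (c : α → ℂ), (∀ j ∈ s, ‖c j‖ ≤ R) →
      (∀ j ∈ s, ∀ k ∈ s, j ≠ k → ε ≤ dist (c j) (c k)) → s.card ≤ C := by
  classical
  have htb := (isCompact_closedBall (0 : ℂ) R).totallyBounded
  obtain ⟨t, ht, hcov⟩ := Metric.totallyBounded_iff.1 htb (ε / 2) (by positivity)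
  refine ⟨ht.toFinset.card, ?_⟩
  intro α s c hc hsep
  have : ∀ j ∈ s, ∃ y ∈ t, dist (c j) y < ε / 2 := by
    intro j hj
    have := hcov (show c j ∈ closedBall (0 : ℂ) R by simpa using hc j hj)
    simpa using this
  choose! f hft hf using this
  apply Finset.card_le_card_of_injOn f (fun j hj => by simpa using hft j hj)
  intro j hj k hk hjk
  by_contra hne
  have h1 := hsep j hj k hk hne
  have h2 := hf j hj
  have h3 := hf k hk
  rw [← hjk] at h3
  have := dist_triangle_right (c j) (c k) (f j)
  linarith

/-- Large copies of a convex body with disjoint interiors that come close to a given point are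
boundedly many. -/
theorem IsBody.packing {B : Set ℂ} (hB : IsBody B) (κ : ℝ) (hκ : 0 < κ) :
    ∃ C : ℕ, ∀ {α : Type} (s : Finset α) (u : α → ℂ × ℂ) (x : ℂ) (ρ : ℝ), 0 < ρ →
      (∀ j ∈ s, κ * ρ ≤ ‖(u j).1‖) →
      (∀ j ∈ s, (copy B (u j) ∩ closedBall x ρ).Nonempty) →
      (∀ j ∈ s, ∀ k ∈ s, j ≠ k → Disjoint (interior (copy B (u j))) (interior (copy B (u k)))) →
      s.card ≤ C := by
  obtain ⟨a, r, R, hr, hR, hin, hout⟩ := hB.bounds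
  obtain ⟨C, hC⟩ := exists_card_le_of_separated (1 + κ * R) (κ * r) (by positivity)
  refine ⟨C, ?_⟩
  intro α s u x ρ hρ hbig hmeet hdisj
  have key : ∀ j ∈ s, ∃ c : ℂ, dist c x ≤ ρ * (1 + κ * R) ∧
      ball c (ρ * (κ * r)) ⊆ interior (copy B (u j)) := by
    intro j hj
    obtain ⟨y, ⟨b, hb, hy⟩, hyx⟩ := hmeet j hj
    have hw : 0 < ‖(u j).1‖ := lt_of_lt_of_le (by positivity) (hbig j hj)
    have hw0 : (u j).1 ≠ 0 := norm_pos_iff.1 hw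
    -- Shrinking the copy towards its point `y` near `x` until its scale is exactly `κρ` keeps it
    -- inside the original by convexity. It still contains a disk of radius `κρr`, whose centre is
    -- now within a bounded multiple of `ρ` of `x`.
    set l : ℝ := κ * ρ / ‖(u j).1‖ with hl
    have hl0 : 0 < l := by positivity
    have hl1 : l ≤ 1 := (div_le_one hw).2 (hbig j hj)
    have hlw : l * ‖(u j).1‖ = κ * ρ := by rw [hl]; field_simp
    simp only at hy
    refine ⟨y + l * ((u j).1 * (a - b)), ?_, ?_⟩
    · have hba : ‖a - b‖ ≤ R := by
        have := hout hb
        rwa [mem_closedBall, dist_comm, dist_eq_norm] at this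
      have h2 : ‖(l : ℂ) * ((u j).1 * (a - b))‖ ≤ κ * ρ * R := by
        rw [norm_mul, norm_mul, Complex.norm_of_nonneg hl0.le, ← mul_assoc, hlw]
        gcongr
      have h3 : dist y x ≤ ρ := hyx
      rw [dist_eq_norm] at h3 ⊢
      calc ‖y + l * ((u j).1 * (a - b)) - x‖ = ‖(y - x) + l * ((u j).1 * (a - b))‖ := by ring_nf
        _ ≤ _ := norm_add_le _ _
        _ ≤ ρ + κ * ρ * R := add_le_add h3 h2
        _ = _ := by ring
    · apply interior_maximal _ isOpen_ball
      intro z hz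
      rw [mem_ball, dist_eq_norm] at hz
      set e := z - (y + l * ((u j).1 * (a - b))) with he
      have hlc : (l : ℂ) ≠ 0 := by exact_mod_cast hl0.ne'
      have hmem : a + e / (l * (u j).1) ∈ B := by
        apply hin
        rw [mem_closedBall, dist_eq_norm, add_sub_cancel_left, norm_div, norm_mul,
          Complex.norm_of_nonneg hl0.le, hlw, div_le_iff₀ (by positivity)]
        nlinarith
      refine ⟨(1 - l) • b + l • (a + e / (l * (u j).1)), ?_, ?_⟩
      · exact hB.convex hb hmem (by linarith) hl0.le (by ring)
      · simp only [Complex.real_smul]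
        push_cast
        have : z = e + (y + l * ((u j).1 * (a - b))) := by rw [he]; ring
        rw [this, ← hy]
        field_simp
        ring
  choose! c hc1 hc2 using key
  apply hC s (fun j => (c j - x) / ρ)
  · intro j hj
    rw [norm_div, Complex.norm_of_nonneg hρ.le, div_le_iff₀ hρ, ← dist_eq_norm]
    linarith [hc1 j hj]
  · intro j hj k hk hne
    have hd : Disjoint (ball (c j) (ρ * (κ * r))) (ball (c k) (ρ * (κ * r))) :=
      (hdisj j hj k hk hne).mono (hc2 j hj) (hc2 k hk)
    rw [dist_eq_norm, ← sub_div, norm_div, Complex.norm_of_nonneg hρ.le, le_div_iff₀ hρ]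
    by_contra hlt
    push Not at hlt
    have hm : dist (c j) (c k) < ρ * (κ * r) := by
      rw [dist_eq_norm, ← sub_sub_sub_cancel_right _ _ x]; linarith
    exact Set.disjoint_left.1 hd (mem_ball_self (by positivity)) hm

/-! ### Disjoint chains of copies and the range of scales they can span. -/

/-- The union of a finite chain of connected sets is connected. -/
theorem isPreconnected_chain {X : Type*} [TopologicalSpace X] (E : ℕ → Set X) (M : ℕ)
    (hE : ∀ k ≤ M, IsPreconnected (E k))
    (hc : ∀ k < M, (E k ∩ E (k + 1)).Nonempty) :
    IsPreconnected (⋃ k ∈ Iic M, E k) := by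
  apply IsPreconnected.biUnion_of_chain ordConnected_Iic (fun n hn => hE n hn)
  intro n hn hn'
  exact hc n (by simpa using hn')

/-- Radii between which no row of a family of chains has an endpoint. -/
theorem IsBody.exists_near_of_chains {B : Set ℂ} (hB : IsBody B) :
    ∃ C : ℕ, ∀ M : ℕ, ∃ Λ : ℝ, 1 ≤ Λ ∧ ∀ (E : ℕ → ℕ → ℂ × ℂ) (x : ℂ) (r : ℝ) (V : Set ℂ), 0 < r →
      (∀ i ≤ C, ∀ k ≤ M, (E i k).1 ≠ 0) →
      (∀ i ≤ C, ∀ k < M, (copy B (E i k) ∩ copy B (E i (k + 1))).Nonempty) →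
      (∀ i ≤ C, ∀ j ≤ C, i ≠ j → ∀ k ≤ M, ∀ l ≤ M, Disjoint (copy B (E i k)) (copy B (E j l))) →
      (∀ i ≤ C, (copy B (E i 0) ∩ closedBall x r).Nonempty) →
      (∀ i ≤ C, (copy B (E i M) ∩ V).Nonempty) →
      (V ∩ closedBall x (Λ * r)).Nonempty := by
  classical
  obtain ⟨a, r₀, R, hr₀, hR, hin, hout⟩ := hB.bounds
  obtain ⟨C, hC⟩ := hB.packing (1 / R) (by positivity)
  refine ⟨C, fun M => ?_⟩
  -- Each of the `(C + 1)(M + 1)` bodies has a least and a greatest distance from `x`. With one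
  -- scale more than there are such numbers, some annulus `[3^k r, 3^(k+1) r)` contains none of
  -- them.
  set K := 2 * ((C + 1) * (M + 1)) + 1 with hK
  refine ⟨3 ^ K, one_le_pow₀ (by norm_num), ?_⟩
  intro E x r V hr hw hchain hdisj hstart hend
  by_contra hV
  have hVfar : ∀ v ∈ V, 3 ^ K * r < dist v x := by
    intro v hv
    by_contra h
    push Not at h
    exact hV ⟨v, hv, h⟩
  have hmin : ∀ i k, ∃ p ∈ copy B (E i k), ∀ q ∈ copy B (E i k), dist p x ≤ dist q x := fun i k =>
    (copy_compact hB.compact _).exists_isMinOn (copy_nonempty hB _)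
      (f := fun z => dist z x) (by fun_prop)
  have hmax : ∀ i k, ∃ p ∈ copy B (E i k), ∀ q ∈ copy B (E i k), dist q x ≤ dist p x := fun i k =>
    (copy_compact hB.compact _).exists_isMaxOn (copy_nonempty hB _)
      (f := fun z => dist z x) (by fun_prop)
  choose p hp hp' using hmin
  choose q hq hq' using hmax
  set I := Finset.range (C + 1) ×ˢ Finset.range (M + 1) with hI
  set ends : Finset ℝ := I.image (fun t => dist (p t.1 t.2) x) ∪ I.image (fun t => dist (q t.1 t.2) x)
  have hcard : ends.card < K := by
    have h1 : I.card = (C + 1) * (M + 1) := by simp [hI]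
    have h2 := Finset.card_image_le (s := I) (f := fun t => dist (p t.1 t.2) x)
    have h3 := Finset.card_image_le (s := I) (f := fun t => dist (q t.1 t.2) x)
    have h4 := Finset.card_union_le (I.image (fun t => dist (p t.1 t.2) x))
      (I.image (fun t => dist (q t.1 t.2) x))
    have : ends.card ≤ _ := h4
    omega
  have hpig : ∃ k ∈ Finset.range K, ∀ e ∈ ends, ¬ (3 ^ k * r ≤ e ∧ e < 3 ^ (k + 1) * r) := by
    by_contra hcon
    push Not at hcon
    choose! f hf hf' using hcon
    have := Finset.card_le_card_of_injOn f (s := Finset.range K) (t := ends)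
      (fun k hk => hf k hk) (by
        intro k hk l hl hkl
        have h1 := hf' k hk
        have h2 := hf' l hl
        rw [← hkl] at h2
        have h3 : (3 : ℝ) ^ k < 3 ^ (l + 1) := by
          have := h1.1.trans_lt h2.2
          exact lt_of_mul_lt_mul_right this hr.le
        have h4 : (3 : ℝ) ^ l < 3 ^ (k + 1) := by
          have := h2.1.trans_lt h1.2
          exact lt_of_mul_lt_mul_right this hr.le
        have h5 := (pow_lt_pow_iff_right₀ (by norm_num : (1 : ℝ) < 3)).1 h3
        have h6 := (pow_lt_pow_iff_right₀ (by norm_num : (1 : ℝ) < 3)).1 h4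
        omega)
    rw [Finset.card_range] at this
    omega
  obtain ⟨k, hk, hgood⟩ := hpig
  rw [Finset.mem_range] at hk
  set ρ := 3 ^ k * r with hρ
  have hρ0 : 0 < ρ := by positivity
  -- Each chain is connected and runs from inside radius `ρ` to outside, so one of its bodies meets
  -- the circle of radius `ρ`. As no extreme distance lies in the annulus, that body reaches
  -- distance `3ρ`. The `C + 1` large disjoint bodies so obtained violate the packing bound.
  have hcross : ∀ i ≤ C, ∃ j ≤ M, dist (p i j) x ≤ ρ ∧ ρ ≤ dist (q i j) x := by
    intro i hi
    have hpre := isPreconnected_chain (fun j => copy B (E i j)) M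
      (fun j _ => (copy_convex hB.convex _).isPreconnected) (fun j hj => hchain i hi j hj)
    obtain ⟨s, hs, hs'⟩ := hstart i hi
    obtain ⟨t, ht, ht'⟩ := hend i hi
    have hsU : s ∈ ⋃ j ∈ Iic M, copy B (E i j) := by
      simp only [mem_iUnion]; exact ⟨0, by simp, hs⟩
    have htU : t ∈ ⋃ j ∈ Iic M, copy B (E i j) := by
      simp only [mem_iUnion]; exact ⟨M, by simp, ht⟩
    have hival := hpre.intermediate_value hsU htU (f := fun z => dist z x) (by fun_prop)
    have h1 : dist s x ≤ ρ := by
      have : (1 : ℝ) ≤ 3 ^ k := one_le_pow₀ (by norm_num)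
      have h : dist s x ≤ r := hs'
      nlinarith
    have h2 : ρ ≤ dist t x := by
      refine le_trans ?_ (hVfar t ht').le
      have : (3 : ℝ) ^ k ≤ 3 ^ K := pow_le_pow_right₀ (by norm_num) hk.le
      rw [hρ]; gcongr
    obtain ⟨z, hz, hzρ⟩ := hival ⟨h1, h2⟩
    simp only [mem_iUnion] at hz
    obtain ⟨j, hj, hz⟩ := hz
    simp only at hzρ
    exact ⟨j, hj, hzρ ▸ hp' i j z hz, hzρ ▸ hq' i j z hz⟩
  choose! j hj hjp hjq using hcross
  have hfin := hC (Finset.range (C + 1)) (fun i => E i (j i)) x ρ hρ0 ?_ ?_ ?_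
  · simp at hfin
  · intro i hi
    have hi' : i ≤ C := by simpa [Nat.lt_succ_iff] using hi
    have hmem : dist (q i (j i)) x ∈ ends := by
      apply Finset.mem_union_right
      exact Finset.mem_image_of_mem (fun t : ℕ × ℕ => dist (q t.1 t.2) x)
        (show (i, j i) ∈ I by simp [hI, hi', hj i hi'])
    have hbig : 3 ^ (k + 1) * r ≤ dist (q i (j i)) x := by
      by_contra hlt
      exact hgood _ hmem ⟨hjq i hi', not_le.1 hlt⟩
    have h1 := dist_copy_le hout (hq i (j i)) (hp i (j i))
    have h2 := dist_triangle (q i (j i)) (p i (j i)) x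
    have h3 := hjp i hi'
    have h4 : (3 : ℝ) ^ (k + 1) * r = 3 * ρ := by rw [hρ]; ring
    rw [one_div, inv_mul_le_iff₀ hR]
    nlinarith
  · intro i hi
    have hi' : i ≤ C := by simpa [Nat.lt_succ_iff] using hi
    exact ⟨p i (j i), hp i (j i), hjp i hi'⟩
  · intro i hi i' hi2 hne
    have hi' : i ≤ C := by simpa [Nat.lt_succ_iff] using hi
    have hi2' : i' ≤ C := by simpa [Nat.lt_succ_iff] using hi2
    exact (hdisj i hi' i' hi2' hne _ (hj i hi') _ (hj i' hi2')).mono interior_subset interior_subset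

/-- Every convex body has arbitrarily small copies pinched between concentric disks. -/
theorem IsBody.exists_round {A : Set ℂ} (hA : IsBody A) :
    ∃ R : ℝ, 1 ≤ R ∧ ∃ el : ℂ → ℝ → ℂ × ℂ, (∀ q η, 0 < η → (el q η).1 ≠ 0) ∧
      (∀ q η, 0 < η → closedBall q η ⊆ copy A (el q η)) ∧
      (∀ q η, 0 < η → copy A (el q η) ⊆ closedBall q (R * η)) := by
  obtain ⟨a, r₀, R, hr₀, hR, hin, hout⟩ := hA.bounds
  refine ⟨max 1 (R / r₀), le_max_left _ _, fun q η => (((η / r₀ : ℝ) : ℂ), q - (η / r₀ : ℝ) * a), ?_, ?_, ?_⟩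
  · intro q η hη
    have h : η / r₀ ≠ 0 := by positivity
    exact Complex.ofReal_ne_zero.2 h
  · intro q η hη z hz
    have h0 : 0 < η / r₀ := by positivity
    have h0' : ((η / r₀ : ℝ) : ℂ) ≠ 0 := by exact_mod_cast h0.ne'
    rw [mem_copy_iff h0']
    apply hin
    have e : (z - (q - (η / r₀ : ℝ) * a)) / (η / r₀ : ℝ) - a = (z - q) / (η / r₀ : ℝ) := by
      field_simp; ring
    rw [mem_closedBall, dist_eq_norm] at hz ⊢
    simp only
    rw [e, norm_div, Complex.norm_of_nonneg h0.le, div_le_iff₀ h0]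
    rwa [mul_div_cancel₀ _ hr₀.ne']
  · intro q η hη z hz
    have h0 : 0 < η / r₀ := by positivity
    obtain ⟨b, hb, rfl⟩ := hz
    have := hout hb
    rw [mem_closedBall, dist_eq_norm] at this ⊢
    simp only
    have e : ((η / r₀ : ℝ) : ℂ) * b + (q - (η / r₀ : ℝ) * a) - q = (η / r₀ : ℝ) * (b - a) := by ring
    rw [e, norm_mul, Complex.norm_of_nonneg h0.le]
    calc η / r₀ * ‖b - a‖ ≤ η / r₀ * R := by gcongr
      _ = R / r₀ * η := by ring
      _ ≤ _ := by gcongr; exact le_max_right _ _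

/-- Any two sets with interior points are joined by arbitrarily many disjoint chains of copies. -/
theorem IsBody.exists_chains {A : Set ℂ} (hA : IsBody A) (C : ℕ) {U V : Set ℂ}
    (hU : (interior U).Nonempty) (hV : (interior V).Nonempty) :
    ∃ (M : ℕ) (E : ℕ → ℕ → Par),
      (∀ i ≤ C, ∀ k < M, (copy A (E i k) ∩ copy A (E i (k + 1))).Nonempty) ∧
      (∀ i ≤ C, ∀ j ≤ C, i ≠ j → ∀ k ≤ M, ∀ l ≤ M, Disjoint (copy A (E i k)) (copy A (E j l))) ∧
      (∀ i ≤ C, (copy A (E i 0) ∩ U).Nonempty) ∧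
      (∀ i ≤ C, (copy A (E i M) ∩ V).Nonempty) := by
  obtain ⟨R, hR, el, el0, elin, elout⟩ := hA.exists_round
  obtain ⟨c, hc⟩ := hU
  obtain ⟨c', hc', hne⟩ : ∃ c' ∈ interior V, c' ≠ c := by
    obtain ⟨c', hc'⟩ := hV
    by_cases h : c' = c
    · have hopen : IsOpen (interior V) := isOpen_interior
      obtain ⟨ε, hε, hb⟩ := Metric.isOpen_iff.1 hopen c' hc'
      refine ⟨c' + (ε / 2 : ℝ), hb ?_, ?_⟩
      · rw [mem_ball, dist_eq_norm, add_sub_cancel_left, Complex.norm_of_nonneg (by positivity)]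
        linarith
      · rw [h]
        intro h'
        have : ((ε / 2 : ℝ) : ℂ) = 0 := by simpa using h'
        have : ε / 2 = 0 := by exact_mod_cast this
        linarith
    · exact ⟨c', hc', h⟩
  set d := c' - c with hd
  have hd0 : 0 < ‖d‖ := norm_pos_iff.2 (sub_ne_zero.2 hne)
  obtain ⟨ε₁, hε₁, hb₁⟩ := Metric.isOpen_iff.1 isOpen_interior c hc
  obtain ⟨ε₂, hε₂, hb₂⟩ := Metric.isOpen_iff.1 isOpen_interior c' hc'
  set τ := min ε₁ ε₂ / ((C + 1) * ‖d‖) / 2 with hτ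
  have hτ0 : 0 < τ := by positivity
  have hτ1 : ∀ i ≤ C, i * τ * ‖d‖ < min ε₁ ε₂ := by
    intro i hi
    have : (i : ℝ) ≤ C := by exact_mod_cast hi
    have hm : 0 < min ε₁ ε₂ := by positivity
    have e : i * τ * ‖d‖ = i / (C + 1) * (min ε₁ ε₂ / 2) := by rw [hτ]; field_simp
    rw [e]
    have : (i : ℝ) / (C + 1) ≤ 1 := by rw [div_le_one (by positivity)]; linarith
    nlinarith
  set η := τ * ‖d‖ / (3 * R) with hη
  have hη0 : 0 < η := by positivity
  obtain ⟨M, hM⟩ := exists_nat_gt (‖d‖ / η)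
  have hM0 : 0 < (M : ℝ) := lt_of_le_of_lt (by positivity) hM
  have hMη : ‖d‖ / M ≤ η := by
    rw [div_lt_iff₀ hη0] at hM
    rw [div_le_iff₀ hM0]; linarith
  -- Row `i` is the segment from `c` to `c'` shifted perpendicularly by `iτ‖d‖`. Consecutive rows
  -- are `3Rη` apart and each body has outer radius `Rη`, so rows are disjoint; along a row the
  -- steps are at most the inner radius `η`.
  set pt : ℕ → ℕ → ℂ := fun i k => c + ((k / M : ℝ) + (i * τ : ℝ) * Complex.I) * d with hpt
  have hself : ∀ i k, pt i k ∈ copy A (el (pt i k) η) := fun i k =>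
    elin _ _ hη0 (mem_closedBall_self hη0.le)
  refine ⟨M, fun i k => ⟨el (pt i k) η, el0 _ _ hη0⟩, ?_, ?_, ?_, ?_⟩
  · intro i _ k _
    refine ⟨pt i (k + 1), elin _ _ hη0 ?_, hself _ _⟩
    rw [mem_closedBall, dist_eq_norm]
    have e : pt i (k + 1) - pt i k = ((1 / M : ℝ) : ℂ) * d := by
      simp only [hpt]; push_cast; ring
    rw [e, norm_mul, Complex.norm_of_nonneg (by positivity)]
    calc 1 / M * ‖d‖ = ‖d‖ / M := by ring
      _ ≤ η := hMη
  · intro i _ j _ hij k _ l _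
    rw [Set.disjoint_left]
    intro z hz hz'
    have h1 := elout _ _ hη0 hz
    have h2 := elout _ _ hη0 hz'
    have h3 : dist (pt i k) (pt j l) ≤ 2 * (R * η) := by
      have := dist_triangle_left (pt i k) (pt j l) z
      rw [mem_closedBall] at h1 h2
      linarith
    have e : pt i k - pt j l
        = ((k / M - l / M : ℝ) + ((i - j : ℝ) * τ : ℝ) * Complex.I) * d := by
      simp only [hpt]; push_cast; ring
    rw [dist_eq_norm, e, norm_mul] at h3
    have h4 := Complex.abs_im_le_norm ((k / M - l / M : ℝ) + ((i - j : ℝ) * τ : ℝ) * Complex.I : ℂ)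
    have him : ((k / M - l / M : ℝ) + ((i - j : ℝ) * τ : ℝ) * Complex.I : ℂ).im = (i - j : ℝ) * τ := by
      simp [-Complex.ofReal_sub, -Complex.ofReal_mul, -Complex.ofReal_div]
    rw [him, abs_mul, abs_of_pos hτ0] at h4
    have h5 : (1 : ℝ) ≤ |(i - j : ℝ)| := by
      have : (1 : ℤ) ≤ |(i - j : ℤ)| := Int.one_le_abs (by omega)
      exact_mod_cast this
    have h6 : 2 * (R * η) = 2 / 3 * (τ * ‖d‖) := by rw [hη]; field_simp
    rw [h6] at h3
    have h7 : τ ≤ |(i - j : ℝ)| * τ := by nlinarith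
    have h8 : τ * ‖d‖ ≤ 2 / 3 * (τ * ‖d‖) := le_trans (by gcongr; linarith) h3
    have : 0 < τ * ‖d‖ := by positivity
    linarith
  · intro i hi
    refine ⟨pt i 0, hself _ _, interior_subset (hb₁ ?_)⟩
    have e : pt i 0 - c = ((i * τ : ℝ) : ℂ) * (Complex.I * d) := by
      simp only [hpt]; push_cast; ring
    rw [mem_ball, dist_eq_norm, e, norm_mul, norm_mul, Complex.norm_I, one_mul,
      Complex.norm_of_nonneg (by positivity)]
    exact (hτ1 i hi).trans_le (min_le_left _ _)
  · intro i hi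
    refine ⟨pt i M, hself _ _, interior_subset (hb₂ ?_)⟩
    have e : pt i M - c' = ((i * τ : ℝ) : ℂ) * (Complex.I * d) := by
      simp only [hpt]
      rw [div_self hM0.ne']
      push_cast
      rw [show c' = c + d by rw [hd]; ring]
      ring
    rw [mem_ball, dist_eq_norm, e, norm_mul, norm_mul, Complex.norm_I, one_mul,
      Complex.norm_of_nonneg (by positivity)]
    exact (hτ1 i hi).trans_le (min_le_right _ _)

/-! ### Collinearity and transversals. -/

/-- Collinearity of three points of the complex plane. -/
def Col (a b c : ℂ) : Prop :=
  (b.re - a.re) * (c.im - a.im) = (b.im - a.im) * (c.re - a.re)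

theorem isClosed_col : IsClosed {t : ℂ × ℂ × ℂ | Col t.1 t.2.1 t.2.2} :=
  isClosed_eq (by fun_prop) (by fun_prop)

theorem col_of_functional {f : ℂ →L[ℝ] ℝ} (hf : f ≠ 0) {a b c : ℂ} (hab : f a = f b)
    (hac : f a = f c) : Col a b c := by
  have key : ∀ z : ℂ, f z = z.re * f 1 + z.im * f Complex.I := by
    intro z
    conv_lhs => rw [← Complex.re_add_im z]
    rw [map_add, show (z.re : ℂ) = z.re • (1 : ℂ) by simp,
      show (z.im : ℂ) * Complex.I = z.im • Complex.I by simp, map_smul, map_smul, smul_eq_mul,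
      smul_eq_mul]
  rw [key a, key b] at hab
  rw [key a, key c] at hac
  unfold Col
  by_cases h1 : f 1 = 0
  · have hI : f Complex.I ≠ 0 := by
      intro h
      apply hf
      exact ContinuousLinearMap.ext fun z => by rw [key z, h1, h]; simp
    have e1 : b.im = a.im := by
      apply mul_right_cancel₀ hI
      rw [h1] at hab; linarith
    have e2 : c.im = a.im := by
      apply mul_right_cancel₀ hI
      rw [h1] at hac; linarith
    rw [e1, e2]; ring
  · apply mul_left_cancel₀ h1
    linear_combination (a.im - c.im) * hab + (b.im - a.im) * hac

/-- Three convex sets that all meet two disjoint convex bodies have a common transversal. -/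
theorem exists_col_of_separated {H H' : Set ℂ} (hH : Convex ℝ H) (hHc : IsCompact H)
    (hH' : Convex ℝ H') (hHc' : IsCompact H') (hd : Disjoint H H') {U V W : Set ℂ}
    (hU : Convex ℝ U) (hV : Convex ℝ V) (hW : Convex ℝ W)
    (h1 : (H ∩ U).Nonempty) (h2 : (H ∩ V).Nonempty) (h3 : (H ∩ W).Nonempty)
    (h1' : (H' ∩ U).Nonempty) (h2' : (H' ∩ V).Nonempty) (h3' : (H' ∩ W).Nonempty) :
    ∃ a ∈ U, ∃ b ∈ V, ∃ c ∈ W, Col a b c := by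
  obtain ⟨f, s, t, hs, hst, ht⟩ :=
    geometric_hahn_banach_compact_closed hH hHc hH' hHc'.isClosed hd
  have hcut : ∀ X : Set ℂ, Convex ℝ X → (H ∩ X).Nonempty → (H' ∩ X).Nonempty →
      ∃ x ∈ X, f x = s := by
    rintro X hX ⟨y, hyH, hyX⟩ ⟨z, hzH, hzX⟩
    exact hX.isPreconnected.intermediate_value hyX hzX f.continuous.continuousOn
      ⟨(hs y hyH).le, (hst.trans (ht z hzH)).le⟩
  obtain ⟨a, ha, ha'⟩ := hcut U hU h1 h1'
  obtain ⟨b, hb, hb'⟩ := hcut V hV h2 h2'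
  obtain ⟨c, hc, hc'⟩ := hcut W hW h3 h3'
  refine ⟨a, ha, b, hb, c, hc, col_of_functional (f := f) ?_ (ha'.trans hb'.symm)
    (ha'.trans hc'.symm)⟩
  rintro rfl
  obtain ⟨y, hyH, -⟩ := h1
  obtain ⟨z, hzH, -⟩ := h1'
  have := hs y hyH
  have := ht z hzH
  simp at *
  linarith

/-! ### Generic realizations and comparison of sizes. -/

/-- A family of maps `Φ · i` from copies of `A` to copies of `B` that, for `𝒰`-many `i`, preserves
and reflects any given incidence. -/
structure GenericRealization {ι : Type} (𝒰 : Ultrafilter ι) (A B : Set ℂ)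
    (Φ : Par → ι → ℂ × ℂ) : Prop where
  ne : ∀ u i, (Φ u i).1 ≠ 0
  meet_iff : ∀ u v : Par, ∀ᶠ i in 𝒰,
    ((copy B (Φ u i) ∩ copy B (Φ v i)).Nonempty ↔ (copy A u ∩ copy A v).Nonempty)

namespace GenericRealization

variable {ι : Type} {𝒰 : Ultrafilter ι} {A B : Set ℂ} {Φ : Par → ι → ℂ × ℂ}

theorem meet (h : GenericRealization 𝒰 A B Φ) {u v : Par} (huv : (copy A u ∩ copy A v).Nonempty) :
    ∀ᶠ i in 𝒰, (copy B (Φ u i) ∩ copy B (Φ v i)).Nonempty :=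
  (h.meet_iff u v).mono fun _ hi => hi.2 huv

theorem disj (h : GenericRealization 𝒰 A B Φ) {u v : Par} (huv : Disjoint (copy A u) (copy A v)) :
    ∀ᶠ i in 𝒰, Disjoint (copy B (Φ u i)) (copy B (Φ v i)) :=
  (h.meet_iff u v).mono fun i hi => by
    rw [← not_not (a := Disjoint (copy B (Φ u i)) _), not_disjoint_iff_nonempty_inter, hi,
      ← not_disjoint_iff_nonempty_inter, not_not]
    exact huv

/-- Sufficiently many disjoint chains join the two copies of `A`. Their images are disjoint chains
of the same length, which cannot bridge an arbitrarily large gap relative to the size of the image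
of `u`. -/
theorem near (h : GenericRealization 𝒰 A B Φ) (hA : IsBody A) (hB : IsBody B) (u v : Par) :
    ∃ Λ : ℝ, 0 < Λ ∧ ∀ᶠ i in 𝒰,
      (copy B (Φ v i) ∩ closedBall (Φ u i).2 (Λ * ‖(Φ u i).1‖)).Nonempty := by
  obtain ⟨C, hC⟩ := hB.exists_near_of_chains
  obtain ⟨M, E, h1, h2, h3, h4⟩ := hA.exists_chains C (isBody_copy hA u.2).nonempty
    (isBody_copy hA v.2).nonempty
  obtain ⟨Λ, hΛ, hnear⟩ := hC M
  obtain ⟨R, hR, hBR⟩ := hB.compact.isBounded.subset_closedBall_lt 0 0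
  refine ⟨Λ * R, by positivity, ?_⟩
  have e1 : ∀ᶠ i in 𝒰, ∀ j ∈ Iic C, ∀ k ∈ Iio M,
      (copy B (Φ (E j k) i) ∩ copy B (Φ (E j (k + 1)) i)).Nonempty := by
    rw [(finite_Iic C).eventually_all]; intro j hj
    rw [(finite_Iio M).eventually_all]; intro k hk
    exact h.meet (h1 j hj k hk)
  have e2 : ∀ᶠ i in 𝒰, ∀ j ∈ Iic C, ∀ j' ∈ Iic C, j ≠ j' → ∀ k ∈ Iic M, ∀ l ∈ Iic M,
      Disjoint (copy B (Φ (E j k) i)) (copy B (Φ (E j' l) i)) := by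
    rw [(finite_Iic C).eventually_all]; intro j hj
    rw [(finite_Iic C).eventually_all]; intro j' hj'
    rw [eventually_imp_distrib_left]; intro hjj
    rw [(finite_Iic M).eventually_all]; intro k hk
    rw [(finite_Iic M).eventually_all]; intro l hl
    exact h.disj (h2 j hj j' hj' hjj k hk l hl)
  have e3 : ∀ᶠ i in 𝒰, ∀ j ∈ Iic C, (copy B (Φ (E j 0) i) ∩ copy B (Φ u i)).Nonempty := by
    rw [(finite_Iic C).eventually_all]; intro j hj
    exact h.meet (h3 j hj)
  have e4 : ∀ᶠ i in 𝒰, ∀ j ∈ Iic C, (copy B (Φ (E j M) i) ∩ copy B (Φ v i)).Nonempty := by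
    rw [(finite_Iic C).eventually_all]; intro j hj
    exact h.meet (h4 j hj)
  filter_upwards [e1, e2, e3, e4] with i e1 e2 e3 e4
  have hu : 0 < ‖(Φ u i).1‖ := norm_pos_iff.2 (h.ne u i)
  have := hnear (fun j k => Φ (E j k) i) (Φ u i).2 (R * ‖(Φ u i).1‖) (copy B (Φ v i))
    (by positivity) (fun _ _ _ _ => h.ne _ _) e1 e2 ?_ e4
  · rwa [← mul_assoc] at this
  · intro j hj
    refine (e3 j hj).mono (inter_subset_inter_right _ ?_)
    rintro _ ⟨b, hb, rfl⟩
    have := hBR hb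
    rw [mem_closedBall, dist_zero_right] at this
    rw [mem_closedBall, dist_eq_norm, add_sub_cancel_right, norm_mul, mul_comm]
    gcongr

/-- Otherwise `C + 1` disjoint images would all be larger than any given multiple of the image of
`c` while staying, by `near`, within a bounded multiple of its size from it. Packing forbids this,
with `C` depending on `B` only. -/
theorem exists_le (h : GenericRealization 𝒰 A B Φ) (hA : IsBody A) (hB : IsBody B) :
    ∃ C : ℕ, ∀ (c : Par) (D : ℕ → Par),
      (∀ i ≤ C, ∀ j ≤ C, i ≠ j → Disjoint (copy A (D i)) (copy A (D j))) →
      ∃ j ≤ C, ∃ K : ℝ, ∀ᶠ i in 𝒰, ‖(Φ (D j) i).1‖ ≤ K * ‖(Φ c i).1‖ := by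
  obtain ⟨C, hC⟩ := hB.packing 1 one_pos
  refine ⟨C, fun c D hD => ?_⟩
  by_contra hcon
  push Not at hcon
  choose Λ hΛ hnear using fun j => h.near hA hB c (D j)
  set L := ∑ j ∈ Finset.range (C + 1), Λ j with hL
  have hle : ∀ j ≤ C, Λ j ≤ L := fun j hj =>
    Finset.single_le_sum (f := Λ) (fun k _ => (hΛ k).le) (by simp; omega)
  have hL0 : 0 < L := lt_of_lt_of_le (hΛ 0) (hle 0 (by omega))
  have e1 : ∀ᶠ i in 𝒰, ∀ j ∈ Iic C, L * ‖(Φ c i).1‖ < ‖(Φ (D j) i).1‖ := by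
    rw [(finite_Iic C).eventually_all]; intro j hj
    exact hcon j hj L
  have e2 : ∀ᶠ i in 𝒰, ∀ j ∈ Iic C,
      (copy B (Φ (D j) i) ∩ closedBall (Φ c i).2 (Λ j * ‖(Φ c i).1‖)).Nonempty := by
    rw [(finite_Iic C).eventually_all]; intro j hj
    exact hnear j
  have e3 : ∀ᶠ i in 𝒰, ∀ j ∈ Iic C, ∀ k ∈ Iic C, j ≠ k →
      Disjoint (copy B (Φ (D j) i)) (copy B (Φ (D k) i)) := by
    rw [(finite_Iic C).eventually_all]; intro j hj
    rw [(finite_Iic C).eventually_all]; intro k hk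
    rw [eventually_imp_distrib_left]; intro hjk
    exact h.disj (hD j hj k hk hjk)
  obtain ⟨i, e1, e2, e3⟩ := (e1.and (e2.and e3)).exists
  have hc : 0 < ‖(Φ c i).1‖ := norm_pos_iff.2 (h.ne c i)
  have := hC (Finset.range (C + 1)) (fun j => Φ (D j) i) (Φ c i).2 (L * ‖(Φ c i).1‖)
    (by positivity) ?_ ?_ ?_
  · simp at this
  · intro j hj
    have hj' : j ≤ C := by simpa [Nat.lt_succ_iff] using hj
    rw [one_mul]; exact (e1 j hj').le
  · intro j hj
    have hj' : j ≤ C := by simpa [Nat.lt_succ_iff] using hj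
    refine (e2 j hj').mono (inter_subset_inter_right _ (closedBall_subset_closedBall ?_))
    gcongr
    exact hle j hj'
  · intro j hj k hk hjk
    have hj' : j ≤ C := by simpa [Nat.lt_succ_iff] using hj
    have hk' : k ≤ C := by simpa [Nat.lt_succ_iff] using hk
    exact (e3 j hj' k hk' hjk).mono interior_subset interior_subset

/-- Some copy is, up to constants, at most as large as any other one. -/
theorem exists_smallest (h : GenericRealization 𝒰 A B Φ) (hA : IsBody A) (hB : IsBody B) :
    ∃ D : Par, ∀ c : Par, ∃ K : ℝ, ∀ᶠ i in 𝒰, ‖(Φ D i).1‖ ≤ K * ‖(Φ c i).1‖ := by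
  classical
  obtain ⟨C, hC⟩ := h.exists_le hA hB
  obtain ⟨R, hR, el, el0, elin, elout⟩ := hA.exists_round
  by_contra hcon
  push Not at hcon
  choose c hc using hcon
  set D : ℕ → Par := fun j => ⟨el ((3 * R * j : ℝ) : ℂ) 1, el0 _ _ one_pos⟩ with hD
  have hdisj : ∀ i ≤ C, ∀ j ≤ C, i ≠ j → Disjoint (copy A (D i)) (copy A (D j)) := by
    intro i _ j _ hij
    refine (closedBall_disjoint_closedBall ?_).mono (elout _ _ one_pos) (elout _ _ one_pos)
    rw [dist_eq_norm, ← Complex.ofReal_sub, Complex.norm_real, ← mul_sub, norm_mul,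
      Real.norm_of_nonneg (by positivity), Real.norm_eq_abs]
    have : (1 : ℝ) ≤ |(i - j : ℝ)| := by
      have : (1 : ℤ) ≤ |(i - j : ℤ)| := Int.one_le_abs (by omega)
      exact_mod_cast this
    nlinarith
  -- The ultrafilter makes the index of the smallest image among the `c (D j)` independent of `i`.
  -- Then `exists_le`, applied to that copy, bounds some `D j` by a multiple of `c (D j)`, against
  -- the choice of `c`.
  have hmin : ∃ k ∈ Iic C, ∀ᶠ i in 𝒰, ∀ j ∈ Iic C,
      ‖(Φ (c (D k)) i).1‖ ≤ ‖(Φ (c (D j)) i).1‖ := by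
    rw [← Ultrafilter.eventually_exists_mem_iff (finite_Iic C)]
    refine Eventually.of_forall fun i => ?_
    exact Set.exists_min_image (Iic C) (fun j => ‖(Φ (c (D j)) i).1‖) (finite_Iic C) ⟨0, by simp⟩
  obtain ⟨k, hk, hmin⟩ := hmin
  obtain ⟨j, hj, K, hK⟩ := hC (c (D k)) D hdisj
  obtain ⟨i, h0, h1, h2⟩ := ((hc (D j) (max K 0)).and (hmin.and hK)).exists
  refine absurd h0 (not_lt.2 ?_)
  calc ‖(Φ (D j) i).1‖ ≤ K * ‖(Φ (c (D k)) i).1‖ := h2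
    _ ≤ max K 0 * ‖(Φ (c (D k)) i).1‖ := by gcongr; exact le_max_left _ _
    _ ≤ _ := by gcongr; exact h1 j hj

/-- If every unit disk contained a copy whose image is unboundedly large relative to that of `D`,
then choosing such copies in disjoint disks would contradict `exists_le`. -/
theorem exists_bounded_region (h : GenericRealization 𝒰 A B Φ) (hA : IsBody A) (hB : IsBody B)
    (D : Par) :
    ∃ o : ℂ, ∀ c : Par, copy A c ⊆ ball o 1 → ∃ K : ℝ, ∀ᶠ i in 𝒰,
      ‖(Φ c i).1‖ ≤ K * ‖(Φ D i).1‖ := by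
  obtain ⟨C, hC⟩ := h.exists_le hA hB
  by_contra hcon
  push Not at hcon
  choose c hc hc' using fun j : ℕ => hcon ((3 * j : ℝ) : ℂ)
  obtain ⟨j, -, K, hK⟩ := hC D c (by
    intro i _ j _ hij
    refine (ball_disjoint_ball ?_).mono (hc i) (hc j)
    rw [dist_eq_norm, ← Complex.ofReal_sub, Complex.norm_real, ← mul_sub, norm_mul,
      Real.norm_of_nonneg (by positivity), Real.norm_eq_abs]
    have : (1 : ℝ) ≤ |(i - j : ℝ)| := by
      have : (1 : ℤ) ≤ |(i - j : ℤ)| := Int.one_le_abs (by omega)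
      exact_mod_cast this
    linarith)
  obtain ⟨i, h1, h2⟩ := ((hc' j K).and hK).exists
  exact absurd h1 (not_lt.2 h2)

end GenericRealization

/-- `G` is the intersection graph of a family of copies of `A`. -/
def Realizable (A : Set ℂ) {n : ℕ} (G : SimpleGraph (Fin n)) : Prop :=
  ∃ u : Fin n → Par, ∀ i j, i ≠ j → ((copy A (u i) ∩ copy A (u j)).Nonempty ↔ G.Adj i j)

theorem exists_genericRealization {A B : Set ℂ} (hA : IsBody A) (hB : IsBody B)
    (h : ∀ (n : ℕ) (G : SimpleGraph (Fin n)), Realizable A G → Realizable B G) :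
    ∃ (𝒰 : Ultrafilter (Finset Par)) (Φ : Par → Finset Par → ℂ × ℂ),
      GenericRealization 𝒰 A B Φ := by
  classical
  let G : ∀ S : Finset Par, SimpleGraph (Fin S.card) := fun S =>
    { Adj := fun i j => i ≠ j ∧
        (copy A (S.equivFin.symm i).1 ∩ copy A (S.equivFin.symm j).1).Nonempty
      symm := ⟨fun i j hij => ⟨hij.1.symm, by rw [inter_comm]; exact hij.2⟩⟩
      loopless := ⟨fun i hi => hi.1 rfl⟩ }
  have hG : ∀ S, Realizable B (G S) := fun S =>
    h _ _ ⟨fun i => (S.equivFin.symm i).1, fun i j hij => by simp [G, hij]⟩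
  choose v hv using hG
  refine ⟨Ultrafilter.of atTop, fun u S => if hu : u ∈ S then v S (S.equivFin ⟨u, hu⟩) else (1, 0),
    ?_, ?_⟩
  · intro u S
    split_ifs with hu
    · exact (v S _).2
    · exact one_ne_zero
  · intro u w
    apply Filter.Eventually.filter_mono (Ultrafilter.of_le _)
    filter_upwards [eventually_ge_atTop {u, w}] with S hS
    have hu : u ∈ S := hS (by simp)
    have hw : w ∈ S := hS (by simp)
    simp only [hu, hw, dif_pos]
    by_cases huw : u = w
    · subst huw
      simp [copy_nonempty hA, copy_nonempty hB]
    · rw [hv S _ _ (by simpa using huw)]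
      simp [G, huw]

theorem GenericRealization.normalize {ι : Type} {𝒰 : Ultrafilter ι} {A B : Set ℂ}
    {Φ : Par → ι → ℂ × ℂ} (h : GenericRealization 𝒰 A B Φ) (D : Par) :
    GenericRealization 𝒰 A B
      (fun u i => ((Φ u i).1 / (Φ D i).1, ((Φ u i).2 - (Φ D i).2) / (Φ D i).1)) where
  ne u i := div_ne_zero (h.ne u i) (h.ne D i)
  meet_iff u v := by
    filter_upwards [h.meet_iff u v] with i hi
    rw [← hi]
    have hD := h.ne D i
    have e : ∀ w : Par, copy B ((Φ w i).1 / (Φ D i).1, ((Φ w i).2 - (Φ D i).2) / (Φ D i).1) =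
        copy (copy B (Φ w i)) (1 / (Φ D i).1, -(Φ D i).2 / (Φ D i).1) := by
      intro w
      rw [copy_copy]
      congr 2 <;> ring
    rw [e u, e v]
    unfold copy
    rw [← image_inter (copy_inj (u := (1 / (Φ D i).1, -(Φ D i).2 / (Φ D i).1))
      (one_div_ne_zero hD)), image_nonempty]

/-! ### Passage to the limit. -/

theorem exists_tendsto_of_bounded {ι E : Type*} [NormedAddCommGroup E] [ProperSpace E]
    (𝒰 : Ultrafilter ι) (f : ι → E) (K : ℝ) (hf : ∀ᶠ i in 𝒰, ‖f i‖ ≤ K) :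
    ∃ l, Tendsto f 𝒰 (𝓝 l) := by
  obtain ⟨l, -, hl⟩ := (isCompact_closedBall (0 : E) K).ultrafilter_le_nhds' (𝒰.map f)
    (hf.mono fun i hi => mem_closedBall_zero_iff.2 hi : ∀ᶠ i in 𝒰, f i ∈ closedBall 0 K)
  exact ⟨l, hl⟩

/-- Compactness of `B` makes the preimages in `B` converge along the ultrafilter. The limit
parameter may be degenerate, which is what later allows excluding `l.1 = 0`. -/
theorem exists_tendsto_of_mem_copy {ι : Type*} {𝒰 : Ultrafilter ι} {B : Set ℂ} (hB : IsCompact B)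
    {φ : ι → ℂ × ℂ} {l : ℂ × ℂ} (hφ : Tendsto φ 𝒰 (𝓝 l)) {y : ι → ℂ}
    (hy : ∀ᶠ i in 𝒰, y i ∈ copy B (φ i)) : ∃ z ∈ copy B l, Tendsto y 𝒰 (𝓝 z) := by
  have : ∀ i, ∃ a, y i ∈ copy B (φ i) → a ∈ B ∧ (φ i).1 * a + (φ i).2 = y i := by
    intro i
    by_cases h : y i ∈ copy B (φ i)
    · obtain ⟨a, ha, e⟩ := h
      exact ⟨a, fun _ => ⟨ha, e⟩⟩
    · exact ⟨0, fun h' => absurd h' h⟩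
  choose a ha using this
  obtain ⟨b, hb, hab⟩ := hB.ultrafilter_le_nhds' (𝒰.map a)
    (hy.mono fun i hi => (ha i hi).1 : ∀ᶠ i in 𝒰, a i ∈ B)
  refine ⟨_, ⟨b, hb, rfl⟩, ?_⟩
  have h1 : Tendsto (fun i => (φ i).1 * a i + (φ i).2) 𝒰 (𝓝 (l.1 * b + l.2)) :=
    (((continuous_fst.tendsto l).comp hφ).mul hab).add ((continuous_snd.tendsto l).comp hφ)
  refine h1.congr' ?_
  filter_upwards [hy] with i hi using (ha i hi).2

theorem eventually_mem_interior_copy {ι : Type*} {F : Filter ι} {B : Set ℂ}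
    {φ : ι → ℂ × ℂ} {l : ℂ × ℂ} (hφ : Tendsto φ F (𝓝 l)) (hl : l.1 ≠ 0) {y : ι → ℂ} {z : ℂ}
    (hy : Tendsto y F (𝓝 z)) (hz : z ∈ interior (copy B l)) :
    ∀ᶠ i in F, y i ∈ interior (copy B (φ i)) := by
  rw [mem_interior_copy_iff hl] at hz
  have h1 : Tendsto (fun i => (φ i).1) F (𝓝 l.1) := (continuous_fst.tendsto l).comp hφ
  have h2 : Tendsto (fun i => (φ i).2) F (𝓝 l.2) := (continuous_snd.tendsto l).comp hφ
  have h3 : Tendsto (fun i => (y i - (φ i).2) / (φ i).1) F (𝓝 ((z - l.2) / l.1)) :=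
    (hy.sub h2).div h1 hl
  filter_upwards [h3.eventually (isOpen_interior.mem_nhds hz),
    h1.eventually (isOpen_ne.mem_nhds hl)] with i h4 h5
  exact (mem_interior_copy_iff h5).2 h4

/-- A map from the copies of `A` inside the region `Ω` to copies of `B` that weakly preserves
incidences. -/
structure LimitRealization (A B Ω : Set ℂ) (Ψ : Par → ℂ × ℂ) : Prop where
  ne : ∀ u : Par, copy A u ⊆ Ω → (Ψ u).1 ≠ 0
  meet : ∀ u v : Par, copy A u ⊆ Ω → copy A v ⊆ Ω → (copy A u ∩ copy A v).Nonempty →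
    (copy B (Ψ u) ∩ copy B (Ψ v)).Nonempty
  disj : ∀ u v : Par, copy A u ⊆ Ω → copy A v ⊆ Ω → Disjoint (copy A u) (copy A v) →
    Disjoint (interior (copy B (Ψ u))) (interior (copy B (Ψ v)))
  col : ∀ u v w H H' : Par, copy A u ⊆ Ω → copy A v ⊆ Ω → copy A w ⊆ Ω →
    Disjoint (copy A H) (copy A H') →
    (copy A H ∩ copy A u).Nonempty → (copy A H ∩ copy A v).Nonempty →
    (copy A H ∩ copy A w).Nonempty →
    (copy A H' ∩ copy A u).Nonempty → (copy A H' ∩ copy A v).Nonempty →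
    (copy A H' ∩ copy A w).Nonempty →
    ∃ a ∈ copy B (Ψ u), ∃ b ∈ copy B (Ψ v), ∃ c ∈ copy B (Ψ w), Col a b c

theorem exists_limitRealization {A B : Set ℂ} (hA : IsBody A) (hB : IsBody B)
    (h : ∀ (n : ℕ) (G : SimpleGraph (Fin n)), Realizable A G → Realizable B G) :
    ∃ (o : ℂ) (Ψ : Par → ℂ × ℂ), LimitRealization A B (ball o 1) Ψ := by
  obtain ⟨𝒰, Φ₀, h₀⟩ := exists_genericRealization hA hB h
  obtain ⟨D, hD₀⟩ := h₀.exists_smallest hA hB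
  have hΦ := h₀.normalize D
  -- Minimality of `D` bounds normalized scales below, so limits are nondegenerate;
  -- `exists_bounded_region` and `near` bound scales and positions above.
  have hD : ∀ c : Par, ∃ K : ℝ, ∀ᶠ i in 𝒰, 1 ≤ K * ‖(Φ₀ c i).1 / (Φ₀ D i).1‖ := by
    intro c
    obtain ⟨K, hK⟩ := hD₀ c
    refine ⟨K, hK.mono fun i hi => ?_⟩
    rw [norm_div, mul_div_assoc', le_div_iff₀ (norm_pos_iff.2 (h₀.ne D i))]
    linarith
  obtain ⟨R, hR, hBR⟩ := hB.compact.isBounded.subset_closedBall_lt 0 0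
  obtain ⟨o, ho⟩ := hΦ.exists_bounded_region hA hB D
  set Φ : Par → Finset Par → ℂ × ℂ :=
    fun u i => ((Φ₀ u i).1 / (Φ₀ D i).1, ((Φ₀ u i).2 - (Φ₀ D i).2) / (Φ₀ D i).1) with hΦdef
  have hDone : ∀ i, Φ D i = (1, 0) := fun i => by
    simp [hΦdef, div_self (h₀.ne D i)]
  have hlim : ∀ u : Par, copy A u ⊆ ball o 1 → ∃ l : ℂ × ℂ, l.1 ≠ 0 ∧ Tendsto (Φ u) 𝒰 (𝓝 l) := by
    intro u hu
    obtain ⟨K, hK⟩ := ho u hu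
    obtain ⟨K', hK'⟩ := hD u
    obtain ⟨Λ, hΛ, hnear⟩ := hΦ.near hA hB D u
    obtain ⟨l, hl⟩ := exists_tendsto_of_bounded 𝒰 (Φ u) (max K (Λ + K * R)) (by
      filter_upwards [hK, hnear] with i h1 h2
      replace h1 : ‖(Φ u i).1‖ ≤ K * ‖(Φ D i).1‖ := h1
      rw [hDone] at h1 h2
      simp only [norm_one, mul_one] at h1 h2
      obtain ⟨_, ⟨b, hb, rfl⟩, h3⟩ := h2
      have h4 := hBR hb
      rw [mem_closedBall, dist_zero_right] at h3 h4
      rw [Prod.norm_def]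
      apply max_le_max h1
      calc ‖(Φ u i).2‖ = ‖((Φ u i).1 * b + (Φ u i).2) - (Φ u i).1 * b‖ := by ring_nf
        _ ≤ ‖(Φ u i).1 * b + (Φ u i).2‖ + ‖(Φ u i).1 * b‖ := norm_sub_le _ _
        _ ≤ Λ + K * R := by
          rw [norm_mul]
          have : 0 ≤ K := (norm_nonneg _).trans h1
          gcongr)
    refine ⟨l, ?_, hl⟩
    intro h0
    have h1 : Tendsto (fun i => K' * ‖(Φ u i).1‖) 𝒰 (𝓝 (K' * ‖l.1‖)) :=
      (((continuous_fst.tendsto l).comp hl).norm).const_mul K'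
    have := ge_of_tendsto h1 hK'
    rw [h0] at this
    simp at this
    linarith
  choose! Ψ hΨne hΨ using hlim
  refine ⟨o, Ψ, hΨne, ?_, ?_, ?_⟩
  · intro u v hu hv huv
    have : ∀ᶠ i in 𝒰, ∃ y, y ∈ copy B (Φ u i) ∧ y ∈ copy B (Φ v i) := hΦ.meet huv
    obtain ⟨y, hy⟩ := this.choice
    obtain ⟨z, hz, hyz⟩ := exists_tendsto_of_mem_copy hB.compact (hΨ u hu) (hy.mono fun i hi => hi.1)
    obtain ⟨z', hz', hyz'⟩ := exists_tendsto_of_mem_copy hB.compact (hΨ v hv)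
      (hy.mono fun i hi => hi.2)
    obtain rfl := tendsto_nhds_unique hyz hyz'
    exact ⟨z, hz, hz'⟩
  · intro u v hu hv huv
    rw [Set.disjoint_left]
    intro z hz hz'
    obtain ⟨i, h1, h2, h3⟩ := ((eventually_mem_interior_copy (hΨ u hu) (hΨne u hu)
      tendsto_const_nhds hz).and ((eventually_mem_interior_copy (hΨ v hv) (hΨne v hv)
      tendsto_const_nhds hz').and (hΦ.disj huv))).exists
    exact Set.disjoint_left.1 h3 (interior_subset h1) (interior_subset h2)
  -- The transversal is found before the limit is taken. The images of `H` and `H'` need not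
  -- converge, since these copies may leave the disk, but collinearity is a closed condition on the
  -- three points chosen.
  · intro u v w H H' hu hv hw hHH h1 h2 h3 h1' h2' h3'
    have : ∀ᶠ i in 𝒰, ∃ t : ℂ × ℂ × ℂ, t.1 ∈ copy B (Φ u i) ∧ t.2.1 ∈ copy B (Φ v i) ∧
        t.2.2 ∈ copy B (Φ w i) ∧ Col t.1 t.2.1 t.2.2 := by
      filter_upwards [hΦ.disj hHH, hΦ.meet h1, hΦ.meet h2, hΦ.meet h3, hΦ.meet h1', hΦ.meet h2',
        hΦ.meet h3'] with i g g1 g2 g3 g1' g2' g3'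
      obtain ⟨a, ha, b, hb, c, hc, habc⟩ := exists_col_of_separated
        (copy_convex hB.convex (Φ H i)) (copy_compact hB.compact _)
        (copy_convex hB.convex (Φ H' i)) (copy_compact hB.compact _) g
        (copy_convex hB.convex (Φ u i)) (copy_convex hB.convex (Φ v i))
        (copy_convex hB.convex (Φ w i)) g1 g2 g3 g1' g2' g3'
      exact ⟨(a, b, c), ha, hb, hc, habc⟩
    obtain ⟨t, ht⟩ := this.choice
    obtain ⟨a, ha, hta⟩ := exists_tendsto_of_mem_copy hB.compact (hΨ u hu)
      (y := fun i => (t i).1) (ht.mono fun i hi => hi.1)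
    obtain ⟨b, hb, htb⟩ := exists_tendsto_of_mem_copy hB.compact (hΨ v hv)
      (y := fun i => (t i).2.1) (ht.mono fun i hi => hi.2.1)
    obtain ⟨c, hc, htc⟩ := exists_tendsto_of_mem_copy hB.compact (hΨ w hw)
      (y := fun i => (t i).2.2) (ht.mono fun i hi => hi.2.2.1)
    refine ⟨a, ha, b, hb, c, hc, ?_⟩
    exact isClosed_col.mem_of_tendsto (hta.prodMk_nhds (htb.prodMk_nhds htc))
      (ht.mono fun i hi => hi.2.2.2)

instance : Nonempty Par := ⟨⟨(1, 0), one_ne_zero⟩⟩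

theorem IsBody.exists_copy_subset {A : Set ℂ} (hA : IsBody A) {U : Set ℂ} (hU : IsOpen U) {p : ℂ}
    (hp : p ∈ U) : ∃ u : Par, p ∈ interior (copy A u) ∧ copy A u ⊆ U := by
  obtain ⟨R, hR, el, el0, elin, elout⟩ := hA.exists_round
  obtain ⟨ε, hε, hb⟩ := nhds_basis_closedBall.mem_iff.1 (hU.mem_nhds hp)
  have hη : 0 < ε / R := by positivity
  refine ⟨⟨el p (ε / R), el0 _ _ hη⟩, ?_, ?_⟩
  · exact mem_interior_iff_mem_nhds.2
      (mem_of_superset (closedBall_mem_nhds p hη) (elin p _ hη))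
  · refine (elout p _ hη).trans ?_
    rwa [mul_div_cancel₀ _ (by positivity)]

/-! ### Good points and the induced point map. -/

/-- Points that lie in small copies of `A` with small images. -/
def GoodPt (A Ω : Set ℂ) (Ψ : Par → ℂ × ℂ) (p : ℂ) : Prop :=
  ∀ ε > 0, ∃ u : Par, p ∈ interior (copy A u) ∧ copy A u ⊆ ball p ε ∧ copy A u ⊆ Ω ∧ ‖(Ψ u).1‖ < ε

namespace LimitRealization

variable {A B Ω : Set ℂ} {Ψ : Par → ℂ × ℂ}

/-- Fix a lower bound `1 / (n + 1)` for the images of all small copies around a point. Points of `F`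
with this bound can be isolated by disjoint small copies, whose images are large, have disjoint
interiors and all meet the image of `F`; packing leaves finitely many for each `n`. -/
theorem countable_not_good (h : LimitRealization A B Ω Ψ) (hA : IsBody A) (hB : IsBody B)
    (hΩ : IsOpen Ω) {F : Par} (hF : copy A F ⊆ Ω) :
    {p ∈ copy A F | ¬ GoodPt A Ω Ψ p}.Countable := by
  classical
  set E : ℕ → Set ℂ := fun n => {p ∈ copy A F | ∀ u : Par, p ∈ interior (copy A u) →
    copy A u ⊆ ball p (1 / (n + 1)) → copy A u ⊆ Ω → 1 / ((n : ℝ) + 1) ≤ ‖(Ψ u).1‖} with hE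
  have hsub : {p ∈ copy A F | ¬ GoodPt A Ω Ψ p} ⊆ ⋃ n, E n := by
    rintro p ⟨hpF, hp⟩
    unfold GoodPt at hp
    push Not at hp
    obtain ⟨ε, hε, hp⟩ := hp
    obtain ⟨n, hn⟩ := exists_nat_one_div_lt hε
    refine mem_iUnion.2 ⟨n, hpF, fun u h1 h2 h3 => hn.le.trans (hp u h1 (h2.trans ?_) h3)⟩
    exact ball_subset_ball hn.le
  refine (countable_iUnion fun n => Set.Finite.countable ?_).mono hsub
  by_contra hinf
  obtain ⟨ρ, hρ, hb⟩ := (copy_compact hB.compact (Ψ F)).isBounded.subset_closedBall_lt 0 0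
  have hn : (0 : ℝ) < 1 / (n + 1) := by positivity
  obtain ⟨C, hC⟩ := hB.packing (1 / (n + 1) / ρ) (by positivity)
  obtain ⟨t, htE, htC⟩ := Set.Infinite.exists_subset_card_eq hinf (C + 1)
  obtain ⟨U, hU, hdisj⟩ := t.finite_toSet.t2_separation
  have hex : ∀ p ∈ t, ∃ u : Par, p ∈ interior (copy A u) ∧
      copy A u ⊆ U p ∩ (ball p (1 / (n + 1)) ∩ Ω) := by
    intro p hp
    exact hA.exists_copy_subset ((hU p).2.inter (isOpen_ball.inter hΩ))
      ⟨(hU p).1, mem_ball_self hn, hF (htE hp).1⟩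
  choose! u hpu hu using hex
  have huΩ : ∀ p ∈ t, copy A (u p) ⊆ Ω := fun p hp =>
    (hu p hp).trans (inter_subset_right.trans inter_subset_right)
  have := hC t (fun p => Ψ (u p)) 0 ρ hρ ?_ ?_ ?_
  · omega
  · intro p hp
    rw [div_mul_cancel₀ _ hρ.ne']
    exact (htE hp).2 (u p) (hpu p hp)
      ((hu p hp).trans (inter_subset_right.trans inter_subset_left)) (huΩ p hp)
  · intro p hp
    refine (h.meet (u p) F (huΩ p hp) hF ⟨p, interior_subset (hpu p hp), (htE hp).1⟩).mono ?_
    exact inter_subset_inter_right _ hb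
  · intro p hp q hq hpq
    refine h.disj _ _ (huΩ p hp) (huΩ q hq) ?_
    exact (hdisj hp hq hpq).mono ((hu p hp).trans inter_subset_left)
      ((hu q hq).trans inter_subset_left)

/-- Copies around `p` with shrinking images all meet the image of each `v` that contains `p`. A
limit of points chosen in the shrinking images is at distance zero from all those closed sets. -/
theorem exists_image (h : LimitRealization A B Ω Ψ) (hB : IsBody B) {p : ℂ}
    (hp : GoodPt A Ω Ψ p) :
    ∃ y, ∀ v : Par, copy A v ⊆ Ω → p ∈ copy A v → y ∈ copy B (Ψ v) := by
  obtain ⟨R, hR, hBR⟩ := hB.compact.isBounded.subset_closedBall_lt 0 0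
  choose u hu1 hu2 hu3 hu4 using fun n : ℕ => hp (1 / ((n : ℝ) + 1)) (by positivity)
  choose y hy using fun n => copy_nonempty hB (Ψ (u n))
  have key : ∀ v : Par, copy A v ⊆ Ω → p ∈ copy A v → ∀ n,
      infDist (y n) (copy B (Ψ v)) ≤ 1 / ((n : ℝ) + 1) * (2 * R) := by
    intro v hv hpv n
    obtain ⟨z, hz, hz'⟩ := h.meet v (u n) hv (hu3 n) ⟨p, hpv, interior_subset (hu1 n)⟩
    refine (infDist_le_dist_of_mem hz).trans ((dist_copy_le hBR (hy n) hz').trans ?_)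
    gcongr
    exact (hu4 n).le
  have hlim : Tendsto (fun n : ℕ => 1 / ((n : ℝ) + 1) * (2 * R)) atTop (𝓝 (0 * (2 * R))) :=
    tendsto_one_div_add_atTop_nhds_zero_nat.mul_const _
  rw [zero_mul] at hlim
  obtain ⟨R₀, hR₀, hb⟩ := (copy_compact hB.compact (Ψ (u 0))).isBounded.subset_closedBall_lt 0 0
  let 𝒰 : Ultrafilter ℕ := Ultrafilter.of atTop
  obtain ⟨z, hz⟩ := exists_tendsto_of_bounded 𝒰 y (R₀ + 2 * R) (Eventually.of_forall fun n => by
    obtain ⟨x, hx, hx'⟩ := h.meet (u 0) (u n) (hu3 0) (hu3 n)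
      ⟨p, interior_subset (hu1 0), interior_subset (hu1 n)⟩
    have h1 := dist_copy_le hBR (hy n) hx'
    have h2 := hb hx
    rw [mem_closedBall, dist_zero_right] at h2
    rw [dist_eq_norm] at h1
    have h3 : ‖(Ψ (u n)).1‖ ≤ 1 := (hu4 n).le.trans (by
      rw [div_le_one (by positivity)]
      have : (0 : ℝ) ≤ n := by positivity
      linarith)
    calc ‖y n‖ = ‖x + (y n - x)‖ := by ring_nf
      _ ≤ ‖x‖ + ‖y n - x‖ := norm_add_le _ _
      _ ≤ R₀ + 1 * (2 * R) := add_le_add h2 (h1.trans (by gcongr))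
      _ = _ := by ring)
  refine ⟨z, fun v hv hpv => ?_⟩
  have hcl : IsClosed (copy B (Ψ v)) := (copy_compact hB.compact _).isClosed
  rw [hcl.mem_iff_infDist_zero (copy_nonempty hB _)]
  refine le_antisymm ?_ infDist_nonneg
  have h1 : Tendsto (fun n => infDist (y n) (copy B (Ψ v))) 𝒰 (𝓝 (infDist z (copy B (Ψ v)))) :=
    ((continuous_infDist_pt _).tendsto z).comp hz
  exact le_of_tendsto_of_tendsto h1 (hlim.mono_left (Ultrafilter.of_le _))
    (Eventually.of_forall (key v hv hpv))

/-- A small copy around `p` misses `v`, and its small image contains `y`. Were `y` interior to the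
image of `v`, that image would swallow the small one, although their interiors are disjoint. -/
theorem image_notMem_interior (h : LimitRealization A B Ω Ψ) (hA : IsBody A) (hB : IsBody B) {p : ℂ}
    (hp : GoodPt A Ω Ψ p) {y : ℂ}
    (hy : ∀ v : Par, copy A v ⊆ Ω → p ∈ copy A v → y ∈ copy B (Ψ v)) {v : Par}
    (hv : copy A v ⊆ Ω) (hpv : p ∉ copy A v) : y ∉ interior (copy B (Ψ v)) := by
  intro hyv
  obtain ⟨R, hR, hBR⟩ := hB.compact.isBounded.subset_closedBall_lt 0 0
  obtain ⟨ε, hε, hb⟩ := Metric.isOpen_iff.1 isOpen_interior y hyv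
  have hcl : IsClosed (copy A v) := (copy_compact hA.compact _).isClosed
  obtain ⟨ε', hε', hb'⟩ := Metric.isOpen_iff.1 hcl.isOpen_compl p hpv
  obtain ⟨u, h1, h2, h3, h4⟩ := hp (min (ε / (2 * R)) ε') (by positivity)
  have hd : Disjoint (copy A u) (copy A v) := by
    rw [← subset_compl_iff_disjoint_right]
    exact (h2.trans (ball_subset_ball (min_le_right _ _))).trans hb'
  have hd' := h.disj u v h3 hv hd
  have hsub : copy B (Ψ u) ⊆ interior (copy B (Ψ v)) := by
    intro z hz
    apply hb
    refine lt_of_le_of_lt (dist_copy_le hBR hz (hy u h3 (interior_subset h1))) ?_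
    rw [← lt_div_iff₀ (by positivity)]
    exact h4.trans_le (min_le_left _ _)
  obtain ⟨z, hz⟩ := (isBody_copy hB (h.ne u h3)).nonempty
  exact Set.disjoint_left.1 hd' hz (hsub (interior_subset hz))

theorem translate (h : LimitRealization A B Ω Ψ) (t : ℂ) :
    LimitRealization A B {z | z + t ∈ Ω}
      (fun u => Ψ ⟨(u.1.1, u.1.2 + t), u.2⟩) := by
  have e : ∀ u : Par, copy A (u.1.1, u.1.2 + t) = (fun z => z + t) '' copy A u := by
    intro u
    simp only [copy, image_image, add_assoc]
  have hsub : ∀ u : Par, copy A u ⊆ {z | z + t ∈ Ω} → copy A (u.1.1, u.1.2 + t) ⊆ Ω := by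
    intro u hu
    rw [e, image_subset_iff]
    exact hu
  have hmeet : ∀ u v : Par, (copy A u ∩ copy A v).Nonempty →
      (copy A (u.1.1, u.1.2 + t) ∩ copy A (v.1.1, v.1.2 + t)).Nonempty := by
    intro u v huv
    rw [e, e, ← image_inter (add_left_injective t)]
    exact huv.image _
  have hdisj : ∀ u v : Par, Disjoint (copy A u) (copy A v) →
      Disjoint (copy A (u.1.1, u.1.2 + t)) (copy A (v.1.1, v.1.2 + t)) := by
    intro u v huv
    rw [e, e, disjoint_image_iff (add_left_injective t)]
    exact huv
  refine ⟨fun u hu => h.ne _ (hsub u hu), fun u v hu hv huv => ?_, fun u v hu hv huv => ?_, ?_⟩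
  · exact h.meet _ _ (hsub u hu) (hsub v hv) (hmeet u v huv)
  · exact h.disj _ _ (hsub u hu) (hsub v hv) (hdisj u v huv)
  · intro u v w H H' hu hv hw hH h1 h2 h3 h1' h2' h3'
    exact h.col _ _ _ ⟨(H.1.1, H.1.2 + t), H.2⟩ ⟨(H'.1.1, H'.1.2 + t), H'.2⟩
      (hsub u hu) (hsub v hv) (hsub w hw) (hdisj _ _ hH) (hmeet _ _ h1) (hmeet _ _ h2)
      (hmeet _ _ h3) (hmeet _ _ h1') (hmeet _ _ h2') (hmeet _ _ h3')

theorem GoodPt.translate {t p : ℂ} (hp : GoodPt A Ω Ψ (p + t)) :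
    GoodPt A {z | z + t ∈ Ω} (fun u => Ψ ⟨(u.1.1, u.1.2 + t), u.2⟩) p := by
  intro ε hε
  obtain ⟨u, h1, h2, h3, h4⟩ := hp ε hε
  have e : ∀ z, z ∈ copy A (u.1.1, u.1.2 - t) ↔ z + t ∈ copy A u := by
    intro z
    rw [mem_copy_iff u.2, mem_copy_iff (u := (u.1.1, u.1.2 - t)) u.2]
    simp only
    ring_nf
  refine ⟨⟨(u.1.1, u.1.2 - t), u.2⟩, ?_, ?_, ?_, ?_⟩
  · rw [mem_interior_copy_iff (u := (u.1.1, u.1.2 - t)) u.2]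
    rw [mem_interior_copy_iff u.2] at h1
    simp only
    convert h1 using 2
    ring
  · intro z hz
    have := h2 ((e z).1 hz)
    simpa [dist_eq_norm] using this
  · intro z hz
    exact h3 ((e z).1 hz)
  · simpa using h4

end LimitRealization

/-- The Gaussian rationals, as a subset of the complex plane. -/
def Net : Set ℂ := {z | ∃ x y : ℚ, z = ⟨x, y⟩}

theorem net_countable : Net.Countable := by
  have : Net = range (fun q : ℚ × ℚ => (⟨q.1, q.2⟩ : ℂ)) := by
    ext z
    constructor
    · rintro ⟨x, y, rfl⟩
      exact ⟨(x, y), rfl⟩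
    · rintro ⟨⟨x, y⟩, rfl⟩
      exact ⟨x, y, rfl⟩
  rw [this]
  exact countable_range _

theorem exists_net_mem {U : Set ℂ} (hU : IsOpen U) (hne : U.Nonempty) : ∃ z ∈ Net, z ∈ U := by
  obtain ⟨z, hz⟩ := hne
  obtain ⟨ε, hε, hb⟩ := Metric.isOpen_iff.1 hU z hz
  obtain ⟨x, hx⟩ := exists_rat_near z.re (ε := ε / 2) (by positivity)
  obtain ⟨y, hy⟩ := exists_rat_near z.im (ε := ε / 2) (by positivity)
  refine ⟨⟨x, y⟩, ⟨x, y, rfl⟩, hb ?_⟩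
  rw [mem_ball, dist_comm, dist_eq_norm]
  calc ‖z - ⟨x, y⟩‖ ≤ |(z - ⟨x, y⟩ : ℂ).re| + |(z - ⟨x, y⟩ : ℂ).im| := Complex.norm_le_abs_re_add_abs_im _
    _ < ε / 2 + ε / 2 := add_lt_add (by simpa using hx) (by simpa using hy)
    _ = ε := by ring

/-- A weak realization near the origin, together with the induced map on Gaussian rationals. -/
structure PointMap (A B Ω : Set ℂ) (Ψ : Par → ℂ × ℂ) (δ : ℝ) (ψ : ℂ → ℂ) : Prop where
  limit : LimitRealization A B Ω Ψ
  isOpen : IsOpen Ω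
  pos : 0 < δ
  sub : ball 0 δ ⊆ Ω
  good : ∀ p ∈ Net, ‖p‖ < δ → GoodPt A Ω Ψ p
  mem : ∀ p ∈ Net, ‖p‖ < δ → ∀ v : Par, copy A v ⊆ Ω → p ∈ copy A v → ψ p ∈ copy B (Ψ v)
  notMem : ∀ p ∈ Net, ‖p‖ < δ → ∀ v : Par, copy A v ⊆ Ω → p ∉ copy A v →
    ψ p ∉ interior (copy B (Ψ v))

theorem exists_pointMap {A B : Set ℂ} (hA : IsBody A) (hB : IsBody B)
    (h : ∀ (n : ℕ) (G : SimpleGraph (Fin n)), Realizable A G → Realizable B G) :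
    ∃ (Ω : Set ℂ) (Ψ : Par → ℂ × ℂ) (δ : ℝ) (ψ : ℂ → ℂ), PointMap A B Ω Ψ δ ψ := by
  classical
  obtain ⟨o, Ψ, hL⟩ := exists_limitRealization hA hB h
  obtain ⟨F, hoF, hF⟩ := hA.exists_copy_subset isOpen_ball (mem_ball_self (x := o) one_pos)
  have hbad := hL.countable_not_good hA hB isOpen_ball hF
  set E := {p ∈ copy A F | ¬ GoodPt A (ball o 1) Ψ p} with hE
  -- The translations moving some Gaussian rational onto a bad point of `F` form a countable set,
  -- which cannot fill a disk.
  have hcount : (⋃ q ∈ Net, (fun e => e - q) '' E).Countable :=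
    net_countable.biUnion fun q _ => hbad.image _
  obtain ⟨ε, hε, hb⟩ := Metric.isOpen_iff.1 isOpen_interior o hoF
  obtain ⟨t, ht, htE⟩ : ∃ t ∈ ball o (ε / 2), t ∉ ⋃ q ∈ Net, (fun e => e - q) '' E := by
    by_contra hcon
    push Not at hcon
    have h1 : (ball o (ε / 2)).Countable := hcount.mono hcon
    have := Set.Countable.dense_compl ℝ h1
    obtain ⟨z, hz, hz'⟩ := this.inter_open_nonempty _
      (isOpen_ball (x := o) (ε := ε / 2)) ⟨o, mem_ball_self (by positivity)⟩
    exact hz' hz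
  have hgood : ∀ p ∈ Net, ‖p‖ < ε / 2 → GoodPt A (ball o 1) Ψ (p + t) := by
    intro p hp hpε
    by_contra hg
    apply htE
    simp only [mem_iUnion]
    refine ⟨p, hp, p + t, ⟨interior_subset (hb ?_), hg⟩, by ring⟩
    rw [mem_ball, dist_eq_norm] at ht ⊢
    calc ‖p + t - o‖ = ‖p + (t - o)‖ := by ring_nf
      _ ≤ ‖p‖ + ‖t - o‖ := norm_add_le _ _
      _ < ε := by linarith
  set Ω : Set ℂ := {z | z + t ∈ ball o 1} with hΩ
  set Ψ' : Par → ℂ × ℂ := fun u => Ψ ⟨(u.1.1, u.1.2 + t), u.2⟩ with hΨ'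
  have hL' : LimitRealization A B Ω Ψ' := hL.translate t
  have hg' : ∀ p ∈ Net, ‖p‖ < ε / 2 → GoodPt A Ω Ψ' p := fun p hp hpε =>
    LimitRealization.GoodPt.translate (hgood p hp hpε)
  have hex : ∀ p, ∃ y, (p ∈ Net ∧ ‖p‖ < ε / 2) →
      ∀ v : Par, copy A v ⊆ Ω → p ∈ copy A v → y ∈ copy B (Ψ' v) := by
    intro p
    by_cases hp : p ∈ Net ∧ ‖p‖ < ε / 2
    · obtain ⟨y, hy⟩ := hL'.exists_image hB (hg' p hp.1 hp.2)
      exact ⟨y, fun _ => hy⟩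
    · exact ⟨0, fun hp' => absurd hp' hp⟩
  choose ψ hψ using hex
  refine ⟨Ω, Ψ', ε / 2, ψ, hL', isOpen_ball.preimage (by fun_prop), by positivity, ?_, hg',
    fun p hp hpε => hψ p ⟨hp, hpε⟩, fun p hp hpε v hv hpv =>
      hL'.image_notMem_interior hA hB (hg' p hp hpε) (hψ p ⟨hp, hpε⟩) hv hpv⟩
  intro z hz
  apply hF (interior_subset (hb _))
  rw [mem_ball, dist_eq_norm] at ht ⊢
  rw [mem_ball_zero_iff] at hz
  calc ‖z + t - o‖ = ‖z + (t - o)‖ := by ring_nf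
    _ ≤ ‖z‖ + ‖t - o‖ := norm_add_le _ _
    _ < ε := by linarith

/-! ### Collinearity and nondegeneracy of the point map. -/

/-- Finite subsets of an open half-plane lie in a copy of `A` inside that half-plane. -/
def FillsHalfPlanes (A : Set ℂ) : Prop :=
  ∀ P : Finset ℂ, (∀ p ∈ P, 0 < p.im) → ∃ u : Par, ↑P ⊆ copy A u ∧ ∀ z ∈ copy A u, 0 < z.im

theorem exists_of_col {p q r : ℂ} (hpq : p ≠ q) (h : Col p q r) : ∃ s : ℝ, r = p + s * (q - p) := by
  have hn : (q - p).re * (q - p).re + (q - p).im * (q - p).im ≠ 0 := by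
    rw [← Complex.normSq_apply]
    exact (Complex.normSq_pos.2 (sub_ne_zero.2 hpq.symm)).ne'
  unfold Col at h
  set d := q - p with hd
  have e1 : d.re = q.re - p.re := by simp [hd]
  have e2 : d.im = q.im - p.im := by simp [hd]
  rw [← e1, ← e2] at h
  refine ⟨((r.re - p.re) * d.re + (r.im - p.im) * d.im) / (d.re * d.re + d.im * d.im), ?_⟩
  apply Complex.ext
  · simp only [Complex.add_re, Complex.re_ofReal_mul]
    rw [← sub_eq_iff_eq_add', div_mul_eq_mul_div, eq_div_iff hn]
    linear_combination (-d.im) * h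
  · simp only [Complex.add_im, Complex.im_ofReal_mul]
    rw [← sub_eq_iff_eq_add', div_mul_eq_mul_div, eq_div_iff hn]
    linear_combination d.re * h

/-- Take the largest left endpoint `a k` of the sets `K j`. If some `K j` misses it, that set lies
entirely to its left; every `I i` meets both this set and `K k`, hence contains `a k`. -/
theorem exists_common_of_grid (C : ℕ) (K I : ℕ → Set ℝ) (hK : ∀ j ≤ C, IsCompact (K j))
    (hK' : ∀ j ≤ C, OrdConnected (K j)) (hI : ∀ i ≤ C, OrdConnected (I i))
    (hKI : ∀ j ≤ C, ∀ i ≤ C, (K j ∩ I i).Nonempty) :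
    ∃ t, (∀ j ≤ C, t ∈ K j) ∨ (∀ i ≤ C, t ∈ I i) := by
  have hmin : ∀ j, ∃ a, j ≤ C → a ∈ K j ∧ ∀ x ∈ K j, a ≤ x := by
    intro j
    by_cases hj : j ≤ C
    · obtain ⟨a, ha, ha'⟩ := (hK j hj).exists_isLeast ((hKI j hj j hj).mono inter_subset_left)
      exact ⟨a, fun _ => ⟨ha, fun x hx => ha' hx⟩⟩
    · exact ⟨0, fun h => absurd h hj⟩
  choose a ha using hmin
  obtain ⟨k, hk, hmax⟩ := Set.exists_max_image (Iic C) a (finite_Iic C) ⟨0, by simp⟩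
  refine ⟨a k, ?_⟩
  by_contra hcon
  push Not at hcon
  obtain ⟨⟨j, hj, hjk⟩, i, hi, hik⟩ := hcon
  apply hik
  obtain ⟨x, hxj, hxi⟩ := hKI j hj i hi
  obtain ⟨y, hyk, hyi⟩ := hKI k hk i hi
  refine (hI i hi).out hxi hyi ⟨?_, (ha k hk).2 y hyk⟩
  by_contra hlt
  push Not at hlt
  exact hjk ((hK' j hj).out (ha j hj).1 hxj ⟨hmax j hj, hlt.le⟩)

/-- Images of disjoint copies have disjoint interiors, so packing at the scale of the smallest one
bounds how many can share a point. -/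
theorem LimitRealization.exists_notMem {A B Ω : Set ℂ} {Ψ : Par → ℂ × ℂ}
    (h : LimitRealization A B Ω Ψ) (hB : IsBody B) :
    ∃ C : ℕ, ∀ {α : Type} (s : Finset α) (u : α → Par), C < s.card →
      (∀ i ∈ s, copy A (u i) ⊆ Ω) →
      (∀ i ∈ s, ∀ j ∈ s, i ≠ j → Disjoint (copy A (u i)) (copy A (u j))) →
      ∀ y, ∃ i ∈ s, y ∉ copy B (Ψ (u i)) := by
  obtain ⟨C, hC⟩ := hB.packing 1 one_pos
  refine ⟨C, fun s u hs hu hd y => ?_⟩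
  by_contra hcon
  push Not at hcon
  obtain ⟨k, hk, hmin⟩ := s.exists_min_image (fun i => ‖(Ψ (u i)).1‖)
    (Finset.card_pos.1 (by omega))
  have hpos : 0 < ‖(Ψ (u k)).1‖ := norm_pos_iff.2 (h.ne _ (hu k hk))
  have := hC s (fun i => Ψ (u i)) y ‖(Ψ (u k)).1‖ hpos (fun j hj => by
    rw [one_mul]; exact hmin j hj) (fun j hj => ⟨y, hcon j hj, mem_closedBall_self hpos.le⟩)
    (fun i hi j hj hij => h.disj _ _ (hu i hi) (hu j hj) (hd i hi j hj hij))
  omega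

namespace PointMap

variable {A B Ω : Set ℂ} {Ψ : Par → ℂ × ℂ} {δ : ℝ} {ψ : ℂ → ℂ}

theorem finite_fiber (h : PointMap A B Ω Ψ δ ψ) (hA : IsBody A) (hB : IsBody B) (y : ℂ) :
    {p | p ∈ Net ∧ ‖p‖ < δ ∧ ψ p = y}.Finite := by
  obtain ⟨C, hC⟩ := h.limit.exists_notMem hB
  by_contra hinf
  obtain ⟨t, ht, htC⟩ := Set.Infinite.exists_subset_card_eq hinf (C + 1)
  obtain ⟨U, hU, hdisj⟩ := t.finite_toSet.t2_separation
  have hex : ∀ p ∈ t, ∃ u : Par, p ∈ interior (copy A u) ∧ copy A u ⊆ U p ∩ Ω := fun p hp =>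
    hA.exists_copy_subset ((hU p).2.inter h.isOpen)
      ⟨(hU p).1, h.sub (mem_ball_zero_iff.2 (ht hp).2.1)⟩
  choose! u hpu hu using hex
  obtain ⟨p, hp, hpy⟩ := hC t u (by omega) (fun p hp => (hu p hp).trans inter_subset_right)
    (fun p hp q hq hpq => (hdisj hp hq hpq).mono ((hu p hp).trans inter_subset_left)
      ((hu q hq).trans inter_subset_left)) y
  apply hpy
  rw [← (ht hp).2.2]
  exact h.mem p (ht hp).1 (ht hp).2.1 _ ((hu p hp).trans inter_subset_right)
    (interior_subset (hpu p hp))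

/-- Surround the three points by copies with tiny images. Two copies of `A` on opposite sides of the
line reach all three surroundings, so the three images have collinear points near `ψ p`, `ψ q`, `ψ
r`; the limit is collinear. -/
theorem col (h : PointMap A B Ω Ψ δ ψ) (hB : IsBody B) (hfill : FillsHalfPlanes A)
    {p q r : ℂ} (hp : p ∈ Net) (hq : q ∈ Net) (hr : r ∈ Net) (hpδ : ‖p‖ < δ) (hqδ : ‖q‖ < δ)
    (hrδ : ‖r‖ < δ) (hpqr : Col p q r) : Col (ψ p) (ψ q) (ψ r) := by
  by_cases hpq : q = p
  · subst hpq; unfold Col; ring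
  set d := q - p with hd
  have hd0 : d ≠ 0 := sub_ne_zero.2 hpq
  obtain ⟨s, hs⟩ : ∃ s : ℝ, r = p + s * d := exists_of_col (Ne.symm hpq) hpqr
  obtain ⟨R, hR, hBR⟩ := hB.compact.isBounded.subset_closedBall_lt 0 0
  have hcl := isClosed_col.closure_eq
  suffices hmem : (ψ p, ψ q, ψ r) ∈ closure {t : ℂ × ℂ × ℂ | Col t.1 t.2.1 t.2.2} by
    rwa [hcl] at hmem
  rw [Metric.mem_closure_iff]
  intro ε hε
  have hε' : 0 < ε / (2 * R) := by positivity
  obtain ⟨u, hu1, -, hu2, hu3⟩ := h.good p hp hpδ _ hε'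
  obtain ⟨v, hv1, -, hv2, hv3⟩ := h.good q hq hqδ _ hε'
  obtain ⟨w, hw1, -, hw2, hw3⟩ := h.good r hr hrδ _ hε'
  have hnear : ∀ (x : ℂ) (u : Par), x ∈ interior (copy A u) →
      ∀ᶠ η : ℝ in 𝓝[>] 0, x + (η * Complex.I) * d ∈ copy A u ∧ x - (η * Complex.I) * d ∈ copy A u := by
    intro x u hx
    have h1 : Tendsto (fun η : ℝ => x + (η * Complex.I) * d) (𝓝[>] 0) (𝓝 x) := by
      have : Continuous (fun η : ℝ => x + (η * Complex.I) * d) := by fun_prop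
      have := (this.tendsto 0).mono_left (nhdsWithin_le_nhds (s := Ioi 0))
      simpa using this
    have h2 : Tendsto (fun η : ℝ => x - (η * Complex.I) * d) (𝓝[>] 0) (𝓝 x) := by
      have : Continuous (fun η : ℝ => x - (η * Complex.I) * d) := by fun_prop
      have := (this.tendsto 0).mono_left (nhdsWithin_le_nhds (s := Ioi 0))
      simpa using this
    exact (h1.eventually (mem_interior_iff_mem_nhds.1 hx)).and
      (h2.eventually (mem_interior_iff_mem_nhds.1 hx))
  have hpos : ∀ᶠ η : ℝ in 𝓝[>] 0, 0 < η := self_mem_nhdsWithin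
  obtain ⟨η, hη, ⟨hu4, hu5⟩, ⟨hv4, hv5⟩, ⟨hw4, hw5⟩⟩ := (hpos.and
    ((hnear p u hu1).and ((hnear q v hv1).and (hnear r w hw1)))).exists
  -- In the coordinate `z ↦ p + dz` the three points are `0, 1, s`. The second body is filled at `0,
  -- -1, -s` and placed by `z ↦ p - dz`, a half-turn, because reflections are not available.
  obtain ⟨H, hH, hH'⟩ := hfill {⟨0, η⟩, ⟨1, η⟩, ⟨s, η⟩} (by simp [hη])
  obtain ⟨G, hG, hG'⟩ := hfill {⟨0, η⟩, ⟨-1, η⟩, ⟨-s, η⟩} (by simp [hη])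
  simp only [Finset.coe_insert, Finset.coe_singleton, insert_subset_iff, singleton_subset_iff]
    at hH hG
  have hmk : ∀ x y : ℝ, (⟨x, y⟩ : ℂ) = x + y * Complex.I := fun x y => Complex.mk_eq_add_mul_I x y
  have hmap : ∀ (w : ℂ) (u : Par) (z x : ℂ), z ∈ copy A u → w * z + p = x →
      x ∈ copy A (w * u.1.1, w * u.1.2 + p) := by
    intro w u z x hz hx
    rw [← copy_copy A u (w, p)]
    exact ⟨z, hz, hx⟩
  obtain ⟨a, ha, b, hb, c, hc, habc⟩ := h.limit.col u v w
    ⟨(d * H.1.1, d * H.1.2 + p), mul_ne_zero hd0 H.2⟩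
    ⟨(-d * G.1.1, -d * G.1.2 + p), mul_ne_zero (neg_ne_zero.2 hd0) G.2⟩ hu2 hv2 hw2
    (by
      rw [Set.disjoint_left]
      rintro z hz hz'
      simp only at hz hz'
      rw [← copy_copy A H (d, p)] at hz
      rw [← copy_copy A G (-d, p)] at hz'
      obtain ⟨x, hx, rfl⟩ := hz
      obtain ⟨y, hy, hxy⟩ := hz'
      have hx' := hH' x hx
      have hy' := hG' y hy
      have : x = -y := by
        apply mul_left_cancel₀ hd0
        simp only at hxy
        linear_combination -hxy
      rw [this, Complex.neg_im] at hx'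
      linarith)
    ⟨_, hmap d H _ _ hH.1 (by rw [hmk]; push_cast; ring), hu4⟩
    ⟨_, hmap d H _ _ hH.2.1 (by rw [hmk, hd]; push_cast; ring), hv4⟩
    ⟨_, hmap d H _ _ hH.2.2 (by rw [hmk, hs]; ring), hw4⟩
    ⟨_, hmap (-d) G _ _ hG.1 (by rw [hmk]; push_cast; ring), hu5⟩
    ⟨_, hmap (-d) G _ _ hG.2.1 (by rw [hmk, hd]; push_cast; ring), hv5⟩
    ⟨_, hmap (-d) G _ _ hG.2.2 (by rw [hmk, hs]; push_cast; ring), hw5⟩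
  have hclose : ∀ (x : ℂ) (u : Par) (a : ℂ), x ∈ Net → ‖x‖ < δ → x ∈ interior (copy A u) →
      copy A u ⊆ Ω → ‖(Ψ u).1‖ < ε / (2 * R) → a ∈ copy B (Ψ u) → dist (ψ x) a < ε := by
    intro x u a hx hxδ hxu huΩ hus ha
    refine lt_of_le_of_lt (dist_copy_le hBR (h.mem x hx hxδ u huΩ (interior_subset hxu)) ha) ?_
    rwa [← lt_div_iff₀ (by positivity)]
  refine ⟨(a, b, c), habc, ?_⟩
  rw [Prod.dist_eq, Prod.dist_eq]
  exact max_lt (hclose p u a hp hpδ hu1 hu2 hu3 ha)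
    (max_lt (hclose q v b hq hqδ hv1 hv2 hv3 hb) (hclose r w c hr hrδ hw1 hw2 hw3 hc))

/-- The Gaussian rationals of an open set are not mapped into a line. -/
theorem not_subset_line (h : PointMap A B Ω Ψ δ ψ) (hA : IsBody A) (hB : IsBody B) {V : Set ℂ}
    (hV : IsOpen V) (hne : V.Nonempty) (hVδ : V ⊆ ball 0 δ) (z₀ v : ℂ) (hv : v ≠ 0) :
    ∃ p ∈ Net, p ∈ V ∧ ∀ t : ℝ, ψ p ≠ z₀ + t * v := by
  by_contra hcon
  push Not at hcon
  obtain ⟨C, hC⟩ := h.limit.exists_notMem hB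
  obtain ⟨R, hR, el, el0, elin, elout⟩ := hA.exists_round
  obtain ⟨c, hc⟩ := hne
  obtain ⟨s, hs, hsV⟩ := Metric.isOpen_iff.1 hV c hc
  obtain ⟨L, hL⟩ := exists_nat_gt (4 * R)
  -- The grid has step `η`, and each cell lies between the disks of radius `2η` and `2Rη`.
  -- Neighbouring cells thus share a Gaussian rational, while rows (or columns) `L > 4R` steps apart
  -- are disjoint.
  set T := C * L with hT
  set η : ℝ := s / (2 * T + 2 * R + 1) with hη
  have hη0 : 0 < η := by positivity
  set q : ℕ → ℕ → ℂ := fun a b => c + η * (a + b * Complex.I) with hq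
  set cell : ℕ → ℕ → Par := fun a b => ⟨el (q a b) (2 * η), el0 _ _ (by positivity)⟩ with hcell
  have hcellin : ∀ a b, closedBall (q a b) (2 * η) ⊆ copy A (cell a b) := fun a b =>
    elin _ _ (by positivity)
  have hcellout : ∀ a b, copy A (cell a b) ⊆ closedBall (q a b) (R * (2 * η)) := fun a b =>
    elout _ _ (by positivity)
  have hcellV : ∀ a ≤ T, ∀ b ≤ T, copy A (cell a b) ⊆ V := by
    intro a ha b hb
    refine (hcellout a b).trans (Subset.trans ?_ hsV)
    apply closedBall_subset_ball'
    have ha' : (a : ℝ) ≤ T := by exact_mod_cast ha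
    have hb' : (b : ℝ) ≤ T := by exact_mod_cast hb
    have h1 : ‖(a : ℂ) + b * Complex.I‖ ≤ 2 * T := by
      refine (norm_add_le _ _).trans ?_
      rw [norm_mul, Complex.norm_I, Complex.norm_natCast, Complex.norm_natCast]
      linarith
    rw [dist_eq_norm, hq]
    simp only [add_sub_cancel_left, norm_mul, Complex.norm_of_nonneg hη0.le]
    have e : s = η * (2 * T + 2 * R + 1) := by rw [hη]; field_simp
    rw [e]
    nlinarith
  have hcellΩ : ∀ a ≤ T, ∀ b ≤ T, copy A (cell a b) ⊆ Ω := fun a ha b hb =>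
    (hcellV a ha b hb).trans (hVδ.trans h.sub)
  set J : Par → Set ℝ := fun u => {t : ℝ | z₀ + t * v ∈ copy B (Ψ u)} with hJ
  have hJord : ∀ u, OrdConnected (J u) := by
    intro u
    have h1 : Convex ℝ (AffineMap.lineMap (k := ℝ) z₀ (z₀ + v) ⁻¹' copy B (Ψ u)) :=
      (copy_convex hB.convex (Ψ u)).affine_preimage _
    have h2 : J u = AffineMap.lineMap (k := ℝ) z₀ (z₀ + v) ⁻¹' copy B (Ψ u) := by
      ext t
      simp [hJ, AffineMap.lineMap_apply, add_comm]
    rw [h2]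
    exact h1.ordConnected
  have hJcomp : ∀ u, IsCompact (J u) := by
    intro u
    have hcpt := copy_compact hB.compact (Ψ u)
    obtain ⟨K, hK⟩ := hcpt.isBounded.exists_norm_le
    apply Metric.isCompact_of_isClosed_isBounded
    · exact hcpt.isClosed.preimage (by fun_prop)
    · rw [isBounded_iff_forall_norm_le]
      refine ⟨(K + ‖z₀‖) / ‖v‖, fun t ht => ?_⟩
      rw [le_div_iff₀ (norm_pos_iff.2 hv)]
      have := hK _ ht
      calc ‖t‖ * ‖v‖ = ‖(z₀ + t * v) - z₀‖ := by
            rw [add_sub_cancel_left, norm_mul, Complex.norm_real]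
        _ ≤ _ := norm_sub_le _ _
        _ ≤ _ := by gcongr
  have hJmeet : ∀ a ≤ T, ∀ b ≤ T, ∀ a' ≤ T, ∀ b' ≤ T, dist (q a b) (q a' b') ≤ η →
      (J (cell a b) ∩ J (cell a' b')).Nonempty := by
    intro a ha b hb a' ha' b' hb' hd
    obtain ⟨x, hxN, hx⟩ := exists_net_mem (isOpen_ball (x := q a b) (ε := η))
      ⟨q a b, mem_ball_self hη0⟩
    rw [mem_ball] at hx
    have hx1 : x ∈ copy A (cell a b) := hcellin a b (by rw [mem_closedBall]; linarith)
    have hx2 : x ∈ copy A (cell a' b') := hcellin a' b' (by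
      rw [mem_closedBall]
      have := dist_triangle x (q a b) (q a' b')
      linarith)
    have hxV := hcellV a ha b hb hx1
    have hxδ : ‖x‖ < δ := mem_ball_zero_iff.1 (hVδ hxV)
    obtain ⟨t, ht⟩ := hcon x hxN hxV
    refine ⟨t, ?_, ?_⟩
    · simp only [hJ, mem_ofPred_eq, ← ht]
      exact h.mem x hxN hxδ _ (hcellΩ a ha b hb) hx1
    · simp only [hJ, mem_ofPred_eq, ← ht]
      exact h.mem x hxN hxδ _ (hcellΩ a' ha' b' hb') hx2
  have hdistH : ∀ a b, dist (q a b) (q (a + 1) b) ≤ η := by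
    intro a b
    rw [dist_eq_norm]
    have : q a b - q (a + 1) b = -((η : ℝ) : ℂ) := by simp only [hq]; push_cast; ring
    rw [this, norm_neg, Complex.norm_of_nonneg hη0.le]
  have hdistV : ∀ a b, dist (q a b) (q a (b + 1)) ≤ η := by
    intro a b
    rw [dist_eq_norm]
    have : q a b - q a (b + 1) = -((η : ℝ) : ℂ) * Complex.I := by simp only [hq]; push_cast; ring
    rw [this, norm_mul, norm_neg, Complex.norm_of_nonneg hη0.le, Complex.norm_I, mul_one]
  have hle : ∀ i ≤ C, i * L ≤ T := fun i hi => Nat.mul_le_mul_right L hi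
  have hfar : ∀ i j : ℕ, i ≠ j → 2 * R * (2 * η) < η * |(i * L : ℝ) - j * L| := by
    intro i j hij
    have : (1 : ℝ) ≤ |(i - j : ℝ)| := by
      have : (1 : ℤ) ≤ |(i - j : ℤ)| := Int.one_le_abs (by omega)
      exact_mod_cast this
    rw [← sub_mul, abs_mul, abs_of_nonneg (by positivity : (0 : ℝ) ≤ L)]
    have h1 : 4 * R < |(i - j : ℝ)| * L := by nlinarith
    nlinarith
  have hdisjoint : ∀ a b a' b', (∃ i j : ℕ, i ≠ j ∧
      (b = i * L ∧ b' = j * L ∨ a = i * L ∧ a' = j * L)) →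
      Disjoint (copy A (cell a b)) (copy A (cell a' b')) := by
    rintro a b a' b' ⟨i, j, hij, hab⟩
    refine (closedBall_disjoint_closedBall ?_).mono (hcellout a b) (hcellout a' b')
    have e : q a b - q a' b' = η * (((a - a' : ℝ) : ℂ) + (b - b' : ℝ) * Complex.I) := by
      simp only [hq]; push_cast; ring
    have h1 := Complex.abs_re_le_norm (((a - a' : ℝ) : ℂ) + (b - b' : ℝ) * Complex.I)
    have h2 := Complex.abs_im_le_norm (((a - a' : ℝ) : ℂ) + (b - b' : ℝ) * Complex.I)
    rw [dist_eq_norm, e, norm_mul, Complex.norm_of_nonneg hη0.le]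
    have h3 := hfar i j hij
    have hre : (((a - a' : ℝ) : ℂ) + (b - b' : ℝ) * Complex.I).re = a - a' := by
      simp [-Complex.ofReal_sub]
    have him : (((a - a' : ℝ) : ℂ) + (b - b' : ℝ) * Complex.I).im = b - b' := by
      simp [-Complex.ofReal_sub]
    rw [hre] at h1
    rw [him] at h2
    rcases hab with ⟨rfl, rfl⟩ | ⟨rfl, rfl⟩
    · push_cast at h2 ⊢
      nlinarith
    · push_cast at h1 ⊢
      nlinarith
  -- If all values lie on one line, the images of neighbouring cells have overlapping intervals on
  -- it, so the trace of every row and column is an interval, and every row meets every column. Some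
  -- point then lies in images from all the columns or all the rows, that is, in images of `C + 1`
  -- disjoint cells.
  obtain ⟨t, ht⟩ := exists_common_of_grid C
    (fun j => ⋃ b ∈ Iic T, J (cell (j * L) b)) (fun i => ⋃ a ∈ Iic T, J (cell a (i * L)))
    (fun j _ => (finite_Iic T).isCompact_biUnion fun b _ => hJcomp _)
    (fun j hj => (isPreconnected_chain (fun b => J (cell (j * L) b)) T
      (fun b _ => (hJord _).isPreconnected) (fun b hb => hJmeet _ (hle j hj) _ (by omega) _
        (hle j hj) _ (by omega) (hdistV _ _))).ordConnected)
    (fun i hi => (isPreconnected_chain (fun a => J (cell a (i * L))) T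
      (fun b _ => (hJord _).isPreconnected) (fun b hb => hJmeet _ (by omega) _ (hle i hi) _
        (by omega) _ (hle i hi) (hdistH _ _))).ordConnected)
    (fun j hj i hi => by
      obtain ⟨x, hx, -⟩ := hJmeet (j * L) (hle j hj) (i * L) (hle i hi) (j * L) (hle j hj) (i * L)
        (hle i hi) (by simpa using hη0.le)
      refine ⟨x, ?_, ?_⟩
      · simp only [mem_iUnion]; exact ⟨i * L, hle i hi, hx⟩
      · simp only [mem_iUnion]; exact ⟨j * L, hle j hj, hx⟩)
  rcases ht with ht | ht
  · simp only [mem_iUnion] at ht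
    choose! b hb hb' using ht
    obtain ⟨j, hj, hj'⟩ := hC (Finset.range (C + 1)) (fun j => cell (j * L) (b j)) (by simp)
      (fun j hj => by
        have hj : j ≤ C := by simpa [Nat.lt_succ_iff] using hj
        exact hcellΩ _ (hle j hj) _ (hb j hj))
      (fun i hi j hj hij => hdisjoint _ _ _ _ ⟨i, j, hij, Or.inr ⟨rfl, rfl⟩⟩) (z₀ + t * v)
    exact hj' (hb' j (by simpa [Nat.lt_succ_iff] using hj))
  · simp only [mem_iUnion] at ht
    choose! b hb hb' using ht
    obtain ⟨j, hj, hj'⟩ := hC (Finset.range (C + 1)) (fun j => cell (b j) (j * L)) (by simp)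
      (fun j hj => by
        have hj : j ≤ C := by simpa [Nat.lt_succ_iff] using hj
        exact hcellΩ _ (hb j hj) _ (hle j hj))
      (fun i hi j hj hij => hdisjoint _ _ _ _ ⟨i, j, hij, Or.inl ⟨rfl, rfl⟩⟩) (z₀ + t * v)
    exact hj' (hb' j (by simpa [Nat.lt_succ_iff] using hj))

end PointMap

/-! ### Collinearity-preserving maps of the Gaussian rationals. -/

/-- The determinant of two vectors of the plane. -/
def det2 (z w : ℂ) : ℝ := z.re * w.im - z.im * w.re

theorem eq_add_coords {a b c y : ℂ} (hD : det2 (a - c) (b - c) ≠ 0) :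
    y = c + (det2 (y - c) (b - c) / det2 (a - c) (b - c) : ℝ) * (a - c) +
      (det2 (a - c) (y - c) / det2 (a - c) (b - c) : ℝ) * (b - c) := by
  set α := det2 (y - c) (b - c) / det2 (a - c) (b - c) with hα
  set β := det2 (a - c) (y - c) / det2 (a - c) (b - c) with hβ
  have e1 : α * det2 (a - c) (b - c) = det2 (y - c) (b - c) := div_mul_cancel₀ _ hD
  have e2 : β * det2 (a - c) (b - c) = det2 (a - c) (y - c) := div_mul_cancel₀ _ hD
  clear_value α β
  unfold det2 at e1 e2 hD
  simp only [Complex.sub_re, Complex.sub_im] at e1 e2 hD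
  apply Complex.ext
  · simp only [Complex.add_re, Complex.re_ofReal_mul, Complex.sub_re]
    apply mul_left_cancel₀ hD
    linear_combination (c.re - a.re) * e1 + (c.re - b.re) * e2
  · simp only [Complex.add_im, Complex.im_ofReal_mul, Complex.sub_im]
    apply mul_left_cancel₀ hD
    linear_combination (c.im - a.im) * e1 + (c.im - b.im) * e2

theorem col_iff_det2 {a b c : ℂ} : Col a b c ↔ det2 (b - a) (c - a) = 0 := by
  unfold Col det2
  simp only [Complex.sub_re, Complex.sub_im, sub_eq_zero]

theorem det2_self_ne {a b : ℂ} (h : a ≠ b) (η : ℝ) (hη : η ≠ 0) :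
    ¬ Col a b (a + η * Complex.I * (b - a)) := by
  have h1 : 0 < Complex.normSq (b - a) := Complex.normSq_pos.2 (sub_ne_zero.2 h.symm)
  rw [Complex.normSq_apply] at h1
  rw [col_iff_det2]
  simp only [det2, add_sub_cancel_left, Complex.mul_im, Complex.mul_re, Complex.ofReal_re,
    Complex.ofReal_im, Complex.I_re, Complex.I_im]
  have : η * ((b - a).re * (b - a).re + (b - a).im * (b - a).im) ≠ 0 := mul_ne_zero hη h1.ne'
  intro h2
  apply this
  linear_combination h2

theorem Net.add {z w : ℂ} (hz : z ∈ Net) (hw : w ∈ Net) : z + w ∈ Net := by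
  obtain ⟨x, y, rfl⟩ := hz
  obtain ⟨x', y', rfl⟩ := hw
  exact ⟨x + x', y + y', by apply Complex.ext <;> simp⟩

theorem Net.sub {z w : ℂ} (hz : z ∈ Net) (hw : w ∈ Net) : z - w ∈ Net := by
  obtain ⟨x, y, rfl⟩ := hz
  obtain ⟨x', y', rfl⟩ := hw
  exact ⟨x - x', y - y', by apply Complex.ext <;> simp⟩

theorem Net.ratMul {z : ℂ} (hz : z ∈ Net) (s : ℚ) : ((s : ℝ) : ℂ) * z ∈ Net := by
  obtain ⟨x, y, rfl⟩ := hz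
  exact ⟨s * x, s * y, by apply Complex.ext <;> simp⟩

theorem Net.det2_rat {z w : ℂ} (hz : z ∈ Net) (hw : w ∈ Net) : ∃ r : ℚ, det2 z w = r := by
  obtain ⟨x, y, rfl⟩ := hz
  obtain ⟨x', y', rfl⟩ := hw
  exact ⟨x * y' - y * x', by simp [det2]⟩

/-- If `p ≠ q` lie on the line `y₁y₂` then so do all points of the line `pq`. -/
theorem Col.trans {y₁ y₂ p q x : ℂ} (hpq : p ≠ q) (hp : Col y₁ y₂ p)
    (hq : Col y₁ y₂ q) (hx : Col p q x) : Col y₁ y₂ x := by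
  rw [col_iff_det2] at *
  unfold det2 at *
  simp only [Complex.sub_re, Complex.sub_im] at *
  have h1 : (y₂.re - y₁.re) * (q.im - p.im) = (y₂.im - y₁.im) * (q.re - p.re) := by
    linear_combination hq - hp
  by_cases hr : q.re - p.re = 0
  · have hi : q.im - p.im ≠ 0 := fun hi =>
      hpq (Complex.ext (by linarith) (by linarith))
    apply mul_left_cancel₀ hi
    linear_combination (q.im - p.im) * hp + (x.im - p.im) * h1 + (y₂.im - y₁.im) * hx
  · apply mul_left_cancel₀ hr
    linear_combination (q.re - p.re) * hp + (y₂.re - y₁.re) * hx + (x.re - p.re) * h1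

/-- A map of the Gaussian rationals of a disk that preserves collinearity and is not locally
degenerate. -/
structure ColMap (δ : ℝ) (ψ : ℂ → ℂ) : Prop where
  pos : 0 < δ
  col : ∀ p ∈ Net, ∀ q ∈ Net, ∀ r ∈ Net, ‖p‖ < δ → ‖q‖ < δ → ‖r‖ < δ → Col p q r →
    Col (ψ p) (ψ q) (ψ r)
  finite : ∀ y, {p | p ∈ Net ∧ ‖p‖ < δ ∧ ψ p = y}.Finite
  spread : ∀ V : Set ℂ, IsOpen V → V.Nonempty → V ⊆ ball 0 δ → ∀ y₁ y₂ : ℂ, y₁ ≠ y₂ →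
    ∃ p ∈ Net, p ∈ V ∧ ¬ Col y₁ y₂ (ψ p)

namespace ColMap

variable {δ : ℝ} {ψ : ℂ → ℂ}

/-- If `ψ a` lay on the line `M` through `ψ p` and `ψ q`, project a point `z` of the triangle from
`a` to `x` on the side `pq`. Then `ψ x ∈ M`, and `ψ z ∈ M` unless `ψ x = ψ a`, which happens for
finitely many `x` only. So an open set would map into `M`. -/
theorem not_col_of_not_col_aux (h : ColMap δ ψ) {p q a : ℂ} (hp : p ∈ Net) (hq : q ∈ Net)
    (ha : a ∈ Net) (hpδ : ‖p‖ < δ) (hqδ : ‖q‖ < δ) (haδ : ‖a‖ < δ) (hpqa : ¬ Col p q a)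
    (hne : ψ p ≠ ψ q) : ¬ Col (ψ p) (ψ q) (ψ a) := by
  intro hcol
  set D := det2 (p - a) (q - a) with hD
  have hD0 : D ≠ 0 := by
    intro h0
    apply hpqa
    rw [hD] at h0
    unfold det2 at h0
    simp only [Complex.sub_re, Complex.sub_im] at h0
    unfold Col
    linear_combination h0
  set α : ℂ → ℝ := fun z => det2 (z - a) (q - a) / D with hα
  set β : ℂ → ℝ := fun z => det2 (p - a) (z - a) / D with hβ
  have hαc : Continuous α := by unfold α det2; fun_prop
  have hβc : Continuous β := by unfold β det2; fun_prop
  have hrep : ∀ z, z = a + α z * (p - a) + β z * (q - a) := fun z => eq_add_coords hD0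
  -- The parameters on `pq` of the forbidden projections. The point `z` with coordinates `α, β`
  -- projects to the parameter `β / (α + β)`, which is rational for Gaussian rational `z`.
  set S : Set ℝ := {s : ℝ | p + s * (q - p) ∈ {x | x ∈ Net ∧ ‖x‖ < δ ∧ ψ x = ψ a}} with hS
  have hqp : q - p ≠ 0 := by
    intro h0
    rw [sub_eq_zero] at h0
    rw [h0] at hne
    exact hne rfl
  have hSfin : S.Finite := by
    apply (h.finite (ψ a)).preimage (f := fun s : ℝ => p + s * (q - p))
    intro s _ t _ hst
    simpa [hqp] using hst
  set V : Set ℂ := {z | 0 < α z} ∩ {z | 0 < β z} ∩ {z | α z + β z < 1} ∩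
    ⋂ s ∈ S, {z | β z ≠ s * (α z + β z)} with hV
  have hVo : IsOpen V := by
    refine ((isOpen_lt continuous_const hαc).inter (isOpen_lt continuous_const hβc)).inter
      (isOpen_lt (hαc.add hβc) continuous_const) |>.inter ?_
    exact hSfin.isOpen_biInter fun s _ =>
      isOpen_ne_fun hβc (continuous_const.mul (hαc.add hβc))
  have hconv : ∀ x y z : ℝ, 0 ≤ x → 0 ≤ y → 0 ≤ z → x + y + z = 1 →
      ‖(x : ℂ) * p + y * q + z * a‖ < δ := by
    intro x y z hx hy hz hxyz
    obtain ⟨m, hm, h1, h2, h3⟩ : ∃ m < δ, ‖p‖ ≤ m ∧ ‖q‖ ≤ m ∧ ‖a‖ ≤ m :=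
      ⟨max ‖p‖ (max ‖q‖ ‖a‖), max_lt hpδ (max_lt hqδ haδ), by simp, by simp, by simp⟩
    refine lt_of_le_of_lt (norm_add₃_le) (lt_of_le_of_lt ?_ hm)
    rw [norm_mul, norm_mul, norm_mul, Complex.norm_of_nonneg hx, Complex.norm_of_nonneg hy,
      Complex.norm_of_nonneg hz]
    calc x * ‖p‖ + y * ‖q‖ + z * ‖a‖ ≤ x * m + y * m + z * m := by gcongr
      _ = (x + y + z) * m := by ring
      _ = m := by rw [hxyz, one_mul]
  have hVδ : V ⊆ ball 0 δ := by
    rintro z ⟨⟨⟨h1, h2⟩, h3⟩, -⟩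
    simp only [mem_ofPred_eq] at h1 h2 h3
    rw [mem_ball_zero_iff]
    have := hconv (α z) (β z) (1 - α z - β z) h1.le h2.le (by linarith) (by ring)
    refine lt_of_eq_of_lt ?_ this
    congr 1
    conv_lhs => rw [hrep z]
    push_cast; ring
  have hVne : V.Nonempty := by
    obtain ⟨s, hs, hsS⟩ := (Ioo_infinite (zero_lt_one (α := ℝ))).exists_notMem_finite hSfin
    have hzα : α (a + ((1 - s) / 2 : ℝ) * (p - a) + (s / 2 : ℝ) * (q - a)) = (1 - s) / 2 := by
      rw [hα]
      simp only
      rw [div_eq_iff hD0, hD]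
      unfold det2
      simp only [Complex.add_re, Complex.re_ofReal_mul, Complex.sub_re, Complex.add_im,
        Complex.im_ofReal_mul, Complex.sub_im]
      ring
    have hzβ : β (a + ((1 - s) / 2 : ℝ) * (p - a) + (s / 2 : ℝ) * (q - a)) = s / 2 := by
      rw [hβ]
      simp only
      rw [div_eq_iff hD0, hD]
      unfold det2
      simp only [Complex.add_re, Complex.re_ofReal_mul, Complex.sub_re, Complex.add_im,
        Complex.im_ofReal_mul, Complex.sub_im]
      ring
    refine ⟨a + ((1 - s) / 2 : ℝ) * (p - a) + (s / 2 : ℝ) * (q - a), ⟨⟨?_, ?_⟩, ?_⟩, ?_⟩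
    · rw [mem_ofPred_eq, hzα]; linarith [hs.2]
    · rw [mem_ofPred_eq, hzβ]; linarith [hs.1]
    · rw [mem_ofPred_eq, hzα, hzβ]; linarith
    · simp only [mem_iInter]
      intro t ht
      rw [mem_ofPred_eq, hzα, hzβ]
      intro h1
      apply hsS
      have : s = t := by linarith
      rwa [this]
  obtain ⟨z, hz, hzV, hznot⟩ := h.spread V hVo hVne hVδ _ _ hne
  apply hznot
  have hzδ := mem_ball_zero_iff.1 (hVδ hzV)
  obtain ⟨⟨⟨h1, h2⟩, h3⟩, h4⟩ := hzV
  simp only [mem_iInter, mem_ofPred_eq] at h1 h2 h3 h4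
  have hpos : 0 < α z + β z := by linarith
  obtain ⟨s, hs⟩ : ∃ s : ℚ, β z / (α z + β z) = s := by
    obtain ⟨r₁, hr₁⟩ := Net.det2_rat (Net.sub hz ha) (Net.sub hq ha)
    obtain ⟨r₂, hr₂⟩ := Net.det2_rat (Net.sub hp ha) (Net.sub hz ha)
    obtain ⟨r₃, hr₃⟩ := Net.det2_rat (Net.sub hp ha) (Net.sub hq ha)
    refine ⟨(r₂ / r₃) / (r₁ / r₃ + r₂ / r₃), ?_⟩
    push_cast
    rw [← hr₁, ← hr₂, ← hr₃]
  have hs' : β z = s * (α z + β z) := by rw [← hs]; field_simp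
  set x := p + ((s : ℝ) : ℂ) * (q - p) with hx
  have hxN : x ∈ Net := Net.add hp (Net.ratMul (Net.sub hq hp) s)
  have hs0 : 0 ≤ (s : ℝ) := by rw [← hs]; positivity
  have hs1 : (s : ℝ) ≤ 1 := by
    rw [← hs, div_le_one hpos]; linarith
  have hxδ : ‖x‖ < δ := by
    have := hconv (1 - s) s 0 (by linarith) hs0 le_rfl (by ring)
    convert this using 2
    rw [hx]; push_cast; ring
  have hxa : ψ a ≠ ψ x := fun hax => h4 s ⟨hxN, hxδ, hax.symm⟩ hs'
  have hMx : Col (ψ p) (ψ q) (ψ x) := by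
    apply h.col p hp q hq x hxN hpδ hqδ hxδ
    rw [col_iff_det2, hx, add_sub_cancel_left]
    unfold det2
    simp only [Complex.re_ofReal_mul, Complex.im_ofReal_mul]
    ring
  refine Col.trans hxa hcol hMx (h.col a ha x hxN z hz haδ hxδ hzδ ?_)
  rw [col_iff_det2]
  have e : z - a = ((α z + β z : ℝ) : ℂ) * (x - a) := by
    conv_lhs => rw [hrep z]
    rw [hx]
    have : ((α z : ℝ) : ℂ) = ((α z + β z : ℝ) : ℂ) - ((s : ℝ) : ℂ) * ((α z + β z : ℝ) : ℂ) := by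
      rw [← Complex.ofReal_mul, ← hs', ← Complex.ofReal_sub]; congr 1; ring
    have h5 : ((β z : ℝ) : ℂ) = ((s : ℝ) : ℂ) * ((α z + β z : ℝ) : ℂ) := by
      rw [← Complex.ofReal_mul, ← hs']
    rw [this, h5]
    ring
  rw [e]
  unfold det2
  simp only [Complex.re_ofReal_mul, Complex.im_ofReal_mul]
  ring

theorem injective (h : ColMap δ ψ) {p q : ℂ} (hp : p ∈ Net) (hq : q ∈ Net)
    (hpδ : ‖p‖ < δ) (hqδ : ‖q‖ < δ) (hpq : p ≠ q) : ψ p ≠ ψ q := by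
  intro heq
  have hcl : IsClosed {z | Col p q z} := isClosed_eq (by fun_prop) (by fun_prop)
  -- Any line through `ψ p` would serve: avoiding it ensures `ψ r ≠ ψ p`. Then `p, r, q` are not
  -- collinear, while their images would be if `ψ p = ψ q`.
  obtain ⟨r, hr, hrV, hrcol⟩ := h.spread (ball 0 δ ∩ {z | Col p q z}ᶜ)
    (isOpen_ball.inter hcl.isOpen_compl) (by
      have h1 : Tendsto (fun η : ℝ => p + η * Complex.I * (q - p)) (𝓝[>] 0) (𝓝 p) := by
        have : Continuous (fun η : ℝ => p + η * Complex.I * (q - p)) := by fun_prop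
        have := (this.tendsto 0).mono_left (nhdsWithin_le_nhds (s := Ioi 0))
        simpa using this
      have hpos : ∀ᶠ η : ℝ in 𝓝[>] 0, 0 < η := self_mem_nhdsWithin
      obtain ⟨η, hη, hη'⟩ := (hpos.and (h1.eventually
        (isOpen_ball.mem_nhds (mem_ball_zero_iff.2 hpδ)))).exists
      exact ⟨_, hη', det2_self_ne hpq η hη.ne'⟩) inter_subset_left (ψ p) (ψ p + 1) (by simp)
  have hrδ := mem_ball_zero_iff.1 hrV.1
  have hne : ψ p ≠ ψ r := by
    intro h0
    apply hrcol
    rw [← h0]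
    unfold Col; ring
  refine h.not_col_of_not_col_aux hp hr hq hpδ hrδ hqδ ?_ hne ?_
  · intro hc
    apply hrV.2
    unfold Col at hc
    rw [mem_ofPred_eq]
    unfold Col
    linear_combination -hc
  · rw [← heq]
    unfold Col; ring

theorem not_col (h : ColMap δ ψ) {p q a : ℂ} (hp : p ∈ Net) (hq : q ∈ Net)
    (ha : a ∈ Net) (hpδ : ‖p‖ < δ) (hqδ : ‖q‖ < δ) (haδ : ‖a‖ < δ) (hpqa : ¬ Col p q a) :
    ¬ Col (ψ p) (ψ q) (ψ a) := by
  refine h.not_col_of_not_col_aux hp hq ha hpδ hqδ haδ hpqa (h.injective hp hq hpδ hqδ ?_)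
  rintro rfl
  apply hpqa
  unfold Col; ring

end ColMap

theorem PointMap.colMap {A B Ω : Set ℂ} {Ψ : Par → ℂ × ℂ} {δ : ℝ} {ψ : ℂ → ℂ}
    (h : PointMap A B Ω Ψ δ ψ) (hA : IsBody A) (hB : IsBody B) (hfill : FillsHalfPlanes A) :
    ColMap δ ψ where
  pos := h.pos
  col _ hp _ hq _ hr hpδ hqδ hrδ := h.col hB hfill hp hq hr hpδ hqδ hrδ
  finite := h.finite_fiber hA hB
  spread V hV hne hVδ y₁ y₂ hy := by
    obtain ⟨p, hp, hpV, hnot⟩ := h.not_subset_line hA hB hV hne hVδ y₁ (y₂ - y₁)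
      (sub_ne_zero.2 hy.symm)
    refine ⟨p, hp, hpV, fun hc => ?_⟩
    obtain ⟨s, hs⟩ := exists_of_col hy hc
    exact hnot s hs

/-! ### A local fundamental theorem of projective geometry. -/

/-- A midpoint affine function on the positive rationals is affine. -/
theorem affine_of_midpoint (g : ℚ → ℝ)
    (hg : ∀ a b : ℚ, 0 < a → 0 < b → g ((a + b) / 2) = (g a + g b) / 2) :
    ∃ α β : ℝ, ∀ x : ℚ, 0 < x → g x = α * x + β := by
  set f : ℚ → ℝ := fun x => g x - ((g 2 - g 1) * x + (2 * g 1 - g 2)) with hf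
  have hfmid : ∀ a b : ℚ, 0 < a → 0 < b → f ((a + b) / 2) = (f a + f b) / 2 := by
    intro a b ha hb
    simp only [hf, hg a b ha hb]
    push_cast
    ring
  have hf1 : f 1 = 0 := by simp only [hf]; push_cast; ring
  have hf2 : f 2 = 0 := by simp only [hf]; push_cast; ring
  have hzero : ∀ x : ℚ, 0 < x → f x = 0 := by
    intro x hx
    set m : ℕ := x.den with hm
    have hm0 : 0 < m := x.den_pos
    have hmq : (0 : ℚ) < m := by exact_mod_cast hm0
    -- Sampled at positive multiples of `1/m`, `f` is an arithmetic progression that vanishes at `1`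
    -- and `2`. The shift by one keeps the samples positive.
    set F : ℕ → ℝ := fun j => f ((j + 1 : ℕ) / m) with hF
    have hrec : ∀ j, F (j + 2) = 2 * F (j + 1) - F j := by
      intro j
      have := hfmid ((j + 1 : ℕ) / m) ((j + 3 : ℕ) / m) (by positivity) (by positivity)
      have e : (((j + 1 : ℕ) : ℚ) / m + ((j + 3 : ℕ) : ℚ) / m) / 2 = ((j + 1 + 1 : ℕ) : ℚ) / m := by
        push_cast; ring
      rw [e] at this
      simp only [hF]
      rw [this]
      ring
    have hlin : ∀ j : ℕ, F j = F 0 + j * (F 1 - F 0) ∧ F (j + 1) = F 0 + (j + 1) * (F 1 - F 0) := by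
      intro j
      induction j with
      | zero => constructor <;> simp
      | succ j ih =>
        refine ⟨by push_cast; exact ih.2, ?_⟩
        rw [hrec j, ih.1, ih.2]
        push_cast; ring
    have h1 : F (m - 1) = 0 := by
      simp only [hF]
      rw [Nat.sub_add_cancel hm0, div_self hmq.ne', hf1]
    have h2 : F (2 * m - 1) = 0 := by
      simp only [hF]
      rw [Nat.sub_add_cancel (by omega)]
      push_cast
      rw [mul_div_cancel_right₀ _ hmq.ne', hf2]
    rw [(hlin _).1] at h1 h2
    rw [Nat.cast_sub (by omega)] at h1 h2
    push_cast at h1 h2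
    have hd : F 1 - F 0 = 0 := by
      have hmr : (m : ℝ) ≠ 0 := by exact_mod_cast hm0.ne'
      apply mul_left_cancel₀ hmr
      linear_combination h2 - h1
    have h0 : F 0 = 0 := by rw [hd] at h1; linarith
    have hx' : x = ((x.num.toNat - 1 + 1 : ℕ) : ℚ) / m := by
      have hnum : 0 < x.num := Rat.num_pos.2 hx
      have : x.num.toNat - 1 + 1 = x.num.toNat := by omega
      rw [this]
      have h3 : ((x.num.toNat : ℕ) : ℚ) = (x.num : ℚ) := by
        exact_mod_cast congrArg (fun z : ℤ => (z : ℚ)) (Int.toNat_of_nonneg hnum.le)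
      rw [h3, hm, Rat.num_div_den]
    have : f x = F (x.num.toNat - 1) := by
      simp only [hF]
      rw [← hx']
    rw [this, (hlin _).1, hd, h0]
    ring
  refine ⟨g 2 - g 1, 2 * g 1 - g 2, fun x hx => ?_⟩
  have := hzero x hx
  simp only [hf] at this
  linarith

/-- Collinearity in coordinates. -/
def Col3 (x y x' y' x'' y'' : ℝ) : Prop := (x' - x) * (y'' - y) = (y' - y) * (x'' - x)

/-- A map of the rational points of the standard triangle that fixes the vertices and preserves
collinearity and non-collinearity is projective in the interior. -/
theorem projective_of_col (P Q : ℚ → ℚ → ℝ)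
    (hcol : ∀ x y x' y' x'' y'' : ℚ, 0 ≤ x → 0 ≤ y → x + y ≤ 1 → 0 ≤ x' → 0 ≤ y' → x' + y' ≤ 1 →
      0 ≤ x'' → 0 ≤ y'' → x'' + y'' ≤ 1 →
      (Col3 x y x' y' x'' y'' ↔ Col3 (P x y) (Q x y) (P x' y') (Q x' y') (P x'' y'') (Q x'' y'')))
    (hP1 : P 1 0 = 1) (hQ1 : Q 1 0 = 0) (hP2 : P 0 1 = 0)
    (hQ2 : Q 0 1 = 1) :
    ∃ α β γ κ : ℝ, ∀ x y : ℚ, 0 < x → 0 < y → x + y < 1 →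
      1 - P x y - Q x y ≠ 0 ∧
      P x y * (1 - x - y) = (α * x + β * (1 - x - y)) * (1 - P x y - Q x y) ∧
      Q x y * (1 - x - y) = (γ * y + κ * (1 - x - y)) * (1 - P x y - Q x y) := by
  have hW : ∀ x y : ℚ, 0 < x → 0 < y → x + y < 1 → 1 - P x y - Q x y ≠ 0 := by
    intro x y hx hy hxy h0
    have h1 := (hcol 1 0 0 1 x y (by norm_num) le_rfl (by norm_num) le_rfl (by norm_num)
      (by norm_num) hx.le hy.le hxy.le).2 (by
        rw [hP1, hQ1, hP2, hQ2]; unfold Col3; linear_combination h0)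
    unfold Col3 at h1
    push_cast at h1
    have h2 : ((x + y : ℚ) : ℝ) < 1 := by exact_mod_cast hxy
    push_cast at h2
    linarith
  -- The chart `u = x/(1-x-y)`, `v = y/(1-x-y)` sends the side through `(1,0)` and `(0,1)` to
  -- infinity and the open triangle to the positive quadrant; `G`, `H` are the same chart on the
  -- image. Lines through these two vertices become the coordinate lines.
  set X : ℚ → ℚ → ℚ := fun u v => u / (1 + u + v) with hX
  set Y : ℚ → ℚ → ℚ := fun u v => v / (1 + u + v) with hY
  have hpos : ∀ u v : ℚ, 0 < u → 0 < v → 0 < X u v ∧ 0 < Y u v ∧ X u v + Y u v < 1 := by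
    intro u v hu hv
    refine ⟨by positivity, by positivity, ?_⟩
    rw [hX, hY, ← add_div, div_lt_one (by positivity)]
    linarith
  set W : ℚ → ℚ → ℝ := fun u v => 1 - P (X u v) (Y u v) - Q (X u v) (Y u v) with hWdef
  have hW' : ∀ u v : ℚ, 0 < u → 0 < v → W u v ≠ 0 := fun u v hu hv =>
    hW _ _ (hpos u v hu hv).1 (hpos u v hu hv).2.1 (hpos u v hu hv).2.2
  set G : ℚ → ℚ → ℝ := fun u v => P (X u v) (Y u v) / W u v with hG
  set H : ℚ → ℚ → ℝ := fun u v => Q (X u v) (Y u v) / W u v with hH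
  have hGW : ∀ u v : ℚ, 0 < u → 0 < v → P (X u v) (Y u v) = G u v * W u v := fun u v hu hv =>
    (div_mul_cancel₀ _ (hW' u v hu hv)).symm
  have hHW : ∀ u v : ℚ, 0 < u → 0 < v → Q (X u v) (Y u v) = H u v * W u v := fun u v hu hv =>
    (div_mul_cancel₀ _ (hW' u v hu hv)).symm
  have hXr : ∀ u v : ℚ, 0 < u → 0 < v → ((X u v : ℚ) : ℝ) * (1 + u + v) = u := by
    intro u v hu hv
    have h : X u v * (1 + u + v) = u := div_mul_cancel₀ _ (by positivity)
    exact_mod_cast congrArg (fun z : ℚ => (z : ℝ)) h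
  have hYr : ∀ u v : ℚ, 0 < u → 0 < v → ((Y u v : ℚ) : ℝ) * (1 + u + v) = v := by
    intro u v hu hv
    have h : Y u v * (1 + u + v) = v := div_mul_cancel₀ _ (by positivity)
    exact_mod_cast congrArg (fun z : ℚ => (z : ℝ)) h
  have hsum : ∀ u v : ℚ, 0 < u → 0 < v → (1 + u + v : ℝ) ≠ 0 := by
    intro u v hu hv
    have h : (0 : ℚ) < 1 + u + v := by positivity
    exact_mod_cast h.ne'
  have htri : ∀ a b c d e f : ℚ, 0 < a → 0 < b → 0 < c → 0 < d → 0 < e → 0 < f →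
      Col3 a b c d e f → Col3 (G a b) (H a b) (G c d) (H c d) (G e f) (H e f) := by
    intro a b c d e f ha hb hc hd he hf h
    have h1 : Col3 (X a b) (Y a b) (X c d) (Y c d) (X e f) (Y e f) := by
      unfold Col3 at h ⊢
      have ea := hXr a b ha hb
      have eb := hYr a b ha hb
      have ec := hXr c d hc hd
      have ed := hYr c d hc hd
      have ee := hXr e f he hf
      have ef := hYr e f he hf
      have sa := hsum a b ha hb
      have sc := hsum c d hc hd
      have se := hsum e f he hf
      rw [← eq_div_iff sa] at ea eb
      rw [← eq_div_iff sc] at ec ed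
      rw [← eq_div_iff se] at ee ef
      rw [ea, eb, ec, ed, ee, ef]
      rw [← sub_eq_zero] at h ⊢
      have : ((c : ℝ) / (1 + c + d) - a / (1 + a + b)) * (f / (1 + e + f) - b / (1 + a + b)) -
        (d / (1 + c + d) - b / (1 + a + b)) * (e / (1 + e + f) - a / (1 + a + b)) =
        ((c - a) * (f - b) - (d - b) * (e - a)) / ((1 + a + b) * (1 + c + d) * (1 + e + f)) := by
        field_simp
        ring
      rw [this, h, zero_div]
    obtain ⟨pa, pb, pab⟩ := hpos a b ha hb
    obtain ⟨pc, pd, pcd⟩ := hpos c d hc hd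
    obtain ⟨pe, pf, pef⟩ := hpos e f he hf
    have h2 := (hcol _ _ _ _ _ _ pa.le pb.le pab.le pc.le pd.le pcd.le pe.le pf.le pef.le).1 h1
    have wa := hW' a b ha hb
    have wc := hW' c d hc hd
    have we := hW' e f he hf
    unfold Col3 at h2 ⊢
    have e1 : W a b = 1 - P (X a b) (Y a b) - Q (X a b) (Y a b) := rfl
    have e2 : W c d = 1 - P (X c d) (Y c d) - Q (X c d) (Y c d) := rfl
    have e3 : W e f = 1 - P (X e f) (Y e f) - Q (X e f) (Y e f) := rfl
    rw [hGW a b ha hb, hHW a b ha hb] at h2 e1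
    rw [hGW c d hc hd, hHW c d hc hd] at h2 e2
    rw [hGW e f he hf, hHW e f he hf] at h2 e3
    have d1 : W a b * (1 + G a b + H a b) = 1 := by linear_combination e1
    have d2 : W c d * (1 + G c d + H c d) = 1 := by linear_combination e2
    have d3 : W e f * (1 + G e f + H e f) = 1 := by linear_combination e3
    have s1 : 1 + G a b + H a b ≠ 0 := fun h0 => by rw [h0] at d1; simp at d1
    have s2 : 1 + G c d + H c d ≠ 0 := fun h0 => by rw [h0] at d2; simp at d2
    have s3 : 1 + G e f + H e f ≠ 0 := fun h0 => by rw [h0] at d3; simp at d3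
    have w1 : W a b = 1 / (1 + G a b + H a b) := by rw [eq_div_iff s1]; exact d1
    have w2 : W c d = 1 / (1 + G c d + H c d) := by rw [eq_div_iff s2]; exact d2
    have w3 : W e f = 1 / (1 + G e f + H e f) := by rw [eq_div_iff s3]; exact d3
    rw [w1, w2, w3, ← sub_eq_zero] at h2
    rw [← sub_eq_zero]
    generalize G a b = g1 at *
    generalize G c d = g2 at *
    generalize G e f = g3 at *
    generalize H a b = k1 at *
    generalize H c d = k2 at *
    generalize H e f = k3 at *
    have : (g2 * (1 / (1 + g2 + k2)) - g1 * (1 / (1 + g1 + k1))) *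
        (k3 * (1 / (1 + g3 + k3)) - k1 * (1 / (1 + g1 + k1))) -
        (k2 * (1 / (1 + g2 + k2)) - k1 * (1 / (1 + g1 + k1))) *
        (g3 * (1 / (1 + g3 + k3)) - g1 * (1 / (1 + g1 + k1))) =
        ((g2 - g1) * (k3 - k1) - (k2 - k1) * (g3 - g1)) /
          ((1 + g1 + k1) * (1 + g2 + k2) * (1 + g3 + k3)) := by
      field_simp
      ring
    rw [this, div_eq_zero_iff] at h2
    rcases h2 with h2 | h2
    · exact h2
    · exact absurd h2 (mul_ne_zero (mul_ne_zero s1 s2) s3)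
  have hGiff : ∀ u v u' v' : ℚ, 0 < u → 0 < v → 0 < u' → 0 < v' → (G u v = G u' v' ↔ u = u') := by
    intro u v u' v' hu hv hu' hv'
    obtain ⟨pa, pb, pab⟩ := hpos u v hu hv
    obtain ⟨pc, pd, pcd⟩ := hpos u' v' hu' hv'
    have h1 := hcol 0 1 _ _ _ _ le_rfl (by norm_num) (by norm_num) pa.le pb.le pab.le pc.le pd.le
      pcd.le
    rw [hP2, hQ2] at h1
    have w1 := hW' u v hu hv
    have w2 := hW' u' v' hu' hv'
    have h2 : G u v = G u' v' ↔ Col3 0 1 (P (X u v) (Y u v)) (Q (X u v) (Y u v))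
        (P (X u' v') (Y u' v')) (Q (X u' v') (Y u' v')) := by
      simp only [hG]
      rw [div_eq_div_iff w1 w2]
      simp only [hWdef]
      unfold Col3
      constructor <;> intro h <;> linear_combination -h
    rw [h2, ← h1]
    have ea := hXr u v hu hv
    have eb := hYr u v hu hv
    have ec := hXr u' v' hu' hv'
    have ed := hYr u' v' hu' hv'
    have sa := hsum u v hu hv
    have sc := hsum u' v' hu' hv'
    rw [← eq_div_iff sa] at ea eb
    rw [← eq_div_iff sc] at ec ed
    unfold Col3
    rw [ea, eb, ec, ed]
    push_cast
    constructor
    · intro h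
      field_simp at h
      have h3 : (u : ℝ) = u' := by linear_combination -h
      exact_mod_cast h3
    · rintro rfl
      field_simp
      ring
  have hHiff : ∀ u v u' v' : ℚ, 0 < u → 0 < v → 0 < u' → 0 < v' → (H u v = H u' v' ↔ v = v') := by
    intro u v u' v' hu hv hu' hv'
    obtain ⟨pa, pb, pab⟩ := hpos u v hu hv
    obtain ⟨pc, pd, pcd⟩ := hpos u' v' hu' hv'
    have h1 := hcol 1 0 _ _ _ _ (by norm_num) le_rfl (by norm_num) pa.le pb.le pab.le pc.le pd.le
      pcd.le
    rw [hP1, hQ1] at h1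
    have w1 := hW' u v hu hv
    have w2 := hW' u' v' hu' hv'
    have h2 : H u v = H u' v' ↔ Col3 1 0 (P (X u v) (Y u v)) (Q (X u v) (Y u v))
        (P (X u' v') (Y u' v')) (Q (X u' v') (Y u' v')) := by
      simp only [hH]
      rw [div_eq_div_iff w1 w2]
      simp only [hWdef]
      unfold Col3
      constructor <;> intro h <;> linear_combination h
    rw [h2, ← h1]
    have ea := hXr u v hu hv
    have eb := hYr u v hu hv
    have ec := hXr u' v' hu' hv'
    have ed := hYr u' v' hu' hv'
    have sa := hsum u v hu hv
    have sc := hsum u' v' hu' hv'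
    rw [← eq_div_iff sa] at ea eb
    rw [← eq_div_iff sc] at ec ed
    unfold Col3
    rw [ea, eb, ec, ed]
    push_cast
    constructor
    · intro h
      field_simp at h
      have h3 : (v : ℝ) = v' := by linear_combination h
      exact_mod_cast h3
    · rintro rfl
      field_simp
      ring
  -- Coordinate rectangles go to coordinate rectangles and diagonals to diagonals, so the centre
  -- goes to the centre. Hence `G` and `H` are midpoint affine in their own variables.
  have hmid : ∀ a b c d : ℚ, 0 < a → 0 < b → 0 < c → 0 < d → a ≠ b → c ≠ d →
      G ((a + b) / 2) ((c + d) / 2) = (G a c + G b c) / 2 ∧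
      H ((a + b) / 2) ((c + d) / 2) = (H a c + H a d) / 2 := by
    intro a b c d ha hb hc hd hab hcd
    have h1 := htri a c ((a + b) / 2) ((c + d) / 2) b d ha hc (by positivity) (by positivity) hb hd
      (by unfold Col3; push_cast; ring)
    have h2 := htri a d ((a + b) / 2) ((c + d) / 2) b c ha hd (by positivity) (by positivity) hb hc
      (by unfold Col3; push_cast; ring)
    have g1 : G a d = G a c := (hGiff a d a c ha hd ha hc).2 rfl
    have g2 : G b d = G b c := (hGiff b d b c hb hd hb hc).2 rfl
    have g3 : H b c = H a c := (hHiff b c a c hb hc ha hc).2 rfl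
    have g4 : H b d = H a d := (hHiff b d a d hb hd ha hd).2 rfl
    have n1 : G b c - G a c ≠ 0 := fun h => hab ((hGiff b c a c hb hc ha hc).1 (sub_eq_zero.1 h)).symm
    have n2 : H a d - H a c ≠ 0 := fun h => hcd ((hHiff a d a c ha hd ha hc).1 (sub_eq_zero.1 h)).symm
    unfold Col3 at h1 h2
    rw [g2, g4] at h1
    rw [g1, g3] at h2
    constructor
    · apply mul_right_cancel₀ n2
      linear_combination (h1 - h2) / 2
    · apply mul_right_cancel₀ n1
      linear_combination -(h1 + h2) / 2
  obtain ⟨α, β, hg⟩ := affine_of_midpoint (fun u => G u 1) (by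
    intro a b ha hb
    by_cases hab : a = b
    · subst hab; simp
    · have := (hmid a b 1 2 ha hb one_pos two_pos hab (by norm_num)).1
      rw [← this]
      exact (hGiff _ _ _ _ (by positivity) one_pos (by positivity) (by norm_num)).2 rfl)
  obtain ⟨γ, κ, hh⟩ := affine_of_midpoint (fun v => H 1 v) (by
    intro a b ha hb
    by_cases hab : a = b
    · subst hab; simp
    · have := (hmid 1 2 a b one_pos two_pos ha hb (by norm_num) hab).2
      rw [← this]
      exact (hHiff _ _ _ _ one_pos (by positivity) (by norm_num) (by positivity)).2 rfl)
  refine ⟨α, β, γ, κ, fun x y hx hy hxy => ⟨hW x y hx hy hxy, ?_⟩⟩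
  have hz : 0 < 1 - x - y := by linarith
  set u := x / (1 - x - y) with hu
  set v := y / (1 - x - y) with hv
  have hu0 : 0 < u := by positivity
  have hv0 : 0 < v := by positivity
  have huv : 1 + u + v = 1 / (1 - x - y) := by
    rw [hu, hv]; field_simp; ring
  have hXx : X u v = x := by
    simp only [hX]; rw [huv, hu]; field_simp
  have hYy : Y u v = y := by
    simp only [hY]; rw [huv, hv]; field_simp
  have e1 := hGW u v hu0 hv0
  have e2 := hHW u v hu0 hv0
  have e3 : W u v = 1 - P (X u v) (Y u v) - Q (X u v) (Y u v) := rfl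
  rw [hXx, hYy] at e1 e2 e3
  have g1 : G u v = α * u + β := by
    rw [← hg u hu0]
    exact (hGiff _ _ _ _ hu0 hv0 hu0 one_pos).2 rfl
  have g2 : H u v = γ * v + κ := by
    rw [← hh v hv0]
    exact (hHiff _ _ _ _ hu0 hv0 one_pos hv0).2 rfl
  have hzr : (1 - x - y : ℝ) ≠ 0 := by exact_mod_cast hz.ne'
  have hur : (u : ℝ) * (1 - x - y) = x := by
    rw [hu]; push_cast; field_simp
  have hvr : (v : ℝ) * (1 - x - y) = y := by
    rw [hv]; push_cast; field_simp
  rw [← e3]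
  constructor
  · rw [e1, g1]; linear_combination α * W u v * hur
  · rw [e2, g2]; linear_combination γ * W u v * hvr

theorem col_iff_col3 {a b c : ℂ} (hD : det2 (a - c) (b - c) ≠ 0) {x y x' y' x'' y'' : ℝ} :
    Col (c + x * (a - c) + y * (b - c)) (c + x' * (a - c) + y' * (b - c))
      (c + x'' * (a - c) + y'' * (b - c)) ↔ Col3 x y x' y' x'' y'' := by
  rw [col_iff_det2]
  have : det2 ((c + x' * (a - c) + y' * (b - c)) - (c + x * (a - c) + y * (b - c)))
      ((c + x'' * (a - c) + y'' * (b - c)) - (c + x * (a - c) + y * (b - c))) =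
      det2 (a - c) (b - c) * ((x' - x) * (y'' - y) - (y' - y) * (x'' - x)) := by
    unfold det2
    simp only [Complex.add_re, Complex.re_ofReal_mul, Complex.sub_re, Complex.add_im,
        Complex.im_ofReal_mul, Complex.sub_im]
    ring
  rw [this, mul_eq_zero, or_iff_right hD, sub_eq_zero]
  rfl

/-- A real-linear map of the plane, given by the images of `1` and `I`. -/
noncomputable def lin2 (A₁ A₂ : ℂ) (h : ℂ) : ℂ := h.re * A₁ + h.im * A₂

/-- Near a suitable point, a collinearity-preserving map is projective. -/
theorem ColMap.exists_projective {δ : ℝ} {ψ : ℂ → ℂ} (h : ColMap δ ψ) :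
    ∃ x₀ ∈ Net, ∃ ε > 0, ∃ (A₁ A₂ : ℂ) (l₁ l₂ : ℝ), det2 A₁ A₂ ≠ 0 ∧ ball x₀ ε ⊆ ball 0 δ ∧
      ∀ z, z ∈ Net → ‖z‖ < ε → 1 + z.re * l₁ + z.im * l₂ ≠ 0 ∧
        ψ (x₀ + z) = ψ x₀ + lin2 A₁ A₂ z / (1 + z.re * l₁ + z.im * l₂ : ℝ) := by
  obtain ⟨σ, hσ0, hσδ⟩ := exists_rat_btwn h.pos
  have hσ0' : (0 : ℝ) < σ := by exact_mod_cast hσ0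
  set p : ℚ → ℚ → ℂ := fun x y => (0 : ℂ) + ((x : ℝ) : ℂ) * ((σ : ℝ) - 0) +
    ((y : ℝ) : ℂ) * ((σ : ℝ) * Complex.I - 0) with hp
  have hpre : ∀ x y, (p x y).re = σ * x := by intro x y; simp [hp, mul_comm]
  have hpim : ∀ x y, (p x y).im = σ * y := by intro x y; simp [hp, mul_comm]
  have hpN : ∀ x y, p x y ∈ Net := fun x y =>
    ⟨σ * x, σ * y, by apply Complex.ext <;> simp [hpre, hpim]⟩
  have hpδ : ∀ x y : ℚ, 0 ≤ x → 0 ≤ y → x + y ≤ 1 → ‖p x y‖ < δ := by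
    intro x y hx hy hxy
    have h1 := Complex.norm_le_abs_re_add_abs_im (p x y)
    have hx' : (0 : ℝ) ≤ x := by exact_mod_cast hx
    have hy' : (0 : ℝ) ≤ y := by exact_mod_cast hy
    have hxy' : (x + y : ℝ) ≤ 1 := by exact_mod_cast hxy
    rw [hpre, hpim, abs_of_nonneg (by positivity), abs_of_nonneg (by positivity)] at h1
    nlinarith
  have hpD : det2 ((σ : ℝ) - 0 : ℂ) ((σ : ℝ) * Complex.I - 0) ≠ 0 := by
    have : det2 ((σ : ℝ) - 0 : ℂ) ((σ : ℝ) * Complex.I - 0) = σ * σ := by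
      unfold det2
      simp only [sub_zero, Complex.re_ofReal_mul, Complex.im_ofReal_mul, Complex.ofReal_re,
        Complex.ofReal_im, Complex.I_re, Complex.I_im]
      ring
    rw [this]
    positivity
  have hpcol : ∀ x y x' y' x'' y'' : ℚ,
      Col (p x y) (p x' y') (p x'' y'') ↔ Col3 x y x' y' x'' y'' := fun x y x' y' x'' y'' =>
    col_iff_col3 hpD
  set E₁ := ψ (p 1 0) with hE₁
  set E₂ := ψ (p 0 1) with hE₂
  set E₃ := ψ (p 0 0) with hE₃
  have hD : det2 (E₁ - E₃) (E₂ - E₃) ≠ 0 := by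
    have h1 := h.not_col (hpN 0 0) (hpN 1 0) (hpN 0 1) (hpδ 0 0 (by norm_num) (by norm_num)
      (by norm_num)) (hpδ 1 0 (by norm_num) (by norm_num) (by norm_num)) (hpδ 0 1 (by norm_num)
      (by norm_num) (by norm_num)) (by rw [hpcol]; simp [Col3])
    rwa [col_iff_det2] at h1
  set P : ℚ → ℚ → ℝ := fun x y => det2 (ψ (p x y) - E₃) (E₂ - E₃) / det2 (E₁ - E₃) (E₂ - E₃)
    with hP
  set Q : ℚ → ℚ → ℝ := fun x y => det2 (E₁ - E₃) (ψ (p x y) - E₃) / det2 (E₁ - E₃) (E₂ - E₃)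
    with hQ
  have hrep : ∀ x y, ψ (p x y) = E₃ + (P x y : ℝ) * (E₁ - E₃) + (Q x y : ℝ) * (E₂ - E₃) :=
    fun x y => eq_add_coords hD
  have hzero : ∀ z : ℂ, det2 z z = 0 := fun z => by unfold det2; ring
  obtain ⟨α, β, γ, κ, hproj⟩ := projective_of_col P Q (by
      intro x y x' y' x'' y'' hx hy hxy hx' hy' hxy' hx'' hy'' hxy''
      rw [← hpcol, ← col_iff_col3 hD, ← hrep, ← hrep, ← hrep]
      refine ⟨h.col _ (hpN _ _) _ (hpN _ _) _ (hpN _ _) (hpδ _ _ hx hy hxy) (hpδ _ _ hx' hy' hxy')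
        (hpδ _ _ hx'' hy'' hxy''), fun hc => ?_⟩
      by_contra hnot
      exact h.not_col (hpN _ _) (hpN _ _) (hpN _ _) (hpδ _ _ hx hy hxy) (hpδ _ _ hx' hy' hxy')
        (hpδ _ _ hx'' hy'' hxy'') hnot hc)
    (by simp only [hP]; exact div_self hD)
    (by simp only [hQ, ← hE₁]; rw [hzero, zero_div])
    (by simp only [hP, ← hE₂]; rw [hzero, zero_div])
    (by simp only [hQ]; exact div_self hD)
  -- The common denominator of the projective map: `d · (1 - P - Q) = 1 - x - y`.
  set d : ℚ → ℚ → ℝ := fun x y => α * x + β * (1 - x - y) + γ * y + κ * (1 - x - y) + (1 - x - y)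
    with hd
  have hval : ∀ x y : ℚ, 0 < x → 0 < y → x + y < 1 → d x y ≠ 0 ∧
      ψ (p x y) * d x y = d x y * E₃ + (α * x + β * (1 - x - y) : ℝ) * (E₁ - E₃) +
        (γ * y + κ * (1 - x - y) : ℝ) * (E₂ - E₃) := by
    intro x y hx hy hxy
    obtain ⟨hW, h1, h2⟩ := hproj x y hx hy hxy
    have hZ : (1 - x - y : ℝ) ≠ 0 := by
      have : (0 : ℚ) < 1 - x - y := by linarith
      exact_mod_cast this.ne'
    have h3 : d x y * (1 - P x y - Q x y) = 1 - x - y := by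
      simp only [hd]
      linear_combination -h1 - h2
    have h4 : P x y * d x y = α * x + β * (1 - x - y) := by
      apply mul_right_cancel₀ hW
      linear_combination P x y * h3 + h1
    have h5 : Q x y * d x y = γ * y + κ * (1 - x - y) := by
      apply mul_right_cancel₀ hW
      linear_combination Q x y * h3 + h2
    refine ⟨fun h0 => hZ (by rw [← h3, h0, zero_mul]), ?_⟩
    rw [hrep, ← h4, ← h5]
    push_cast
    ring
  -- Within `σ/4` of this point both triangle coordinates stay in `(0, 1/2)`, hence inside the open
  -- triangle.
  set x₀ := p (1 / 4) (1 / 4) with hx₀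
  set d₀ := d (1 / 4) (1 / 4) with hd₀
  set d₁ := α - β - κ - 1 with hd₁
  set d₂ := γ - β - κ - 1 with hd₂
  obtain ⟨hd₀0, hy₀⟩ := hval (1 / 4) (1 / 4) (by norm_num) (by norm_num) (by norm_num)
  rw [← hd₀] at hd₀0
  rw [← hx₀, ← hd₀] at hy₀
  clear_value d₀
  set A₁ : ℂ := (d₁ * E₃ + (α - β : ℝ) * (E₁ - E₃) - κ * (E₂ - E₃) - ψ x₀ * d₁) / (d₀ * σ : ℝ)
    with hA₁
  set A₂ : ℂ := (d₂ * E₃ - β * (E₁ - E₃) + (γ - κ : ℝ) * (E₂ - E₃) - ψ x₀ * d₂) / (d₀ * σ : ℝ)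
    with hA₂
  have hε : (0 : ℝ) < σ / 4 := by positivity
  have hloc : ∀ z, z ∈ Net → ‖z‖ < σ / 4 →
      1 + z.re * (d₁ / (d₀ * σ)) + z.im * (d₂ / (d₀ * σ)) ≠ 0 ∧ ‖x₀ + z‖ < δ ∧
      ψ (x₀ + z) = ψ x₀ + lin2 A₁ A₂ z /
        (1 + z.re * (d₁ / (d₀ * σ)) + z.im * (d₂ / (d₀ * σ)) : ℝ) := by
    rintro z ⟨x, y, rfl⟩ hz
    have hx := (abs_lt.1 ((Complex.abs_re_le_norm _).trans_lt hz))
    have hy := (abs_lt.1 ((Complex.abs_im_le_norm _).trans_lt hz))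
    simp only at hx hy
    have hx1 : -(σ / 4) < x := by exact_mod_cast hx.1
    have hx2 : x < σ / 4 := by exact_mod_cast hx.2
    have hy1 : -(σ / 4) < y := by exact_mod_cast hy.1
    have hy2 : y < σ / 4 := by exact_mod_cast hy.2
    have hσ0 : 0 < σ := by exact_mod_cast hσ0
    set a := x / σ with ha
    set b := y / σ with hb
    have hax : σ * a = x := by rw [ha]; field_simp
    have hby : σ * b = y := by rw [hb]; field_simp
    have ha1 : -(1 / 4) < a := by rw [ha, lt_div_iff₀ hσ0]; linarith
    have ha2 : a < 1 / 4 := by rw [ha, div_lt_iff₀ hσ0]; linarith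
    have hb1 : -(1 / 4) < b := by rw [hb, lt_div_iff₀ hσ0]; linarith
    have hb2 : b < 1 / 4 := by rw [hb, div_lt_iff₀ hσ0]; linarith
    have hpz : x₀ + ⟨x, y⟩ = p (1 / 4 + a) (1 / 4 + b) := by
      apply Complex.ext
      · rw [hpre, Complex.add_re, hx₀, hpre, ← hax]; push_cast; ring
      · rw [hpim, Complex.add_im, hx₀, hpim, ← hby]; push_cast; ring
    obtain ⟨hd0, hv⟩ := hval (1 / 4 + a) (1 / 4 + b) (by linarith) (by linarith) (by linarith)
    have hdd : d (1 / 4 + a) (1 / 4 + b) = d₀ + a * d₁ + b * d₂ := by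
      simp only [hd, hd₀, hd₁, hd₂]; push_cast; ring
    have hσr : (σ : ℝ) ≠ 0 := hσ0'.ne'
    have hden : 1 + (x : ℝ) * (d₁ / (d₀ * σ)) + y * (d₂ / (d₀ * σ)) =
        d (1 / 4 + a) (1 / 4 + b) / d₀ := by
      rw [hdd, ← hax, ← hby]
      push_cast
      field_simp
    refine ⟨?_, ?_, ?_⟩
    · simp only; rw [hden]; exact div_ne_zero hd0 hd₀0
    · rw [hpz]; exact hpδ _ _ (by linarith) (by linarith) (by linarith)
    · simp only
      rw [hden, hpz]
      have hd0' : ((d (1 / 4 + a) (1 / 4 + b) : ℝ) : ℂ) ≠ 0 := by exact_mod_cast hd0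
      have hd₀' : (d₀ : ℂ) ≠ 0 := by exact_mod_cast hd₀0
      apply mul_right_cancel₀ hd0'
      have hlin : lin2 A₁ A₂ ⟨x, y⟩ * d₀ = a * (d₁ * E₃ + (α - β : ℝ) * (E₁ - E₃) -
          κ * (E₂ - E₃) - ψ x₀ * d₁) + b * (d₂ * E₃ - β * (E₁ - E₃) + (γ - κ : ℝ) * (E₂ - E₃) -
          ψ x₀ * d₂) := by
        have hσc : (σ : ℂ) ≠ 0 := by exact_mod_cast hσr
        simp only [lin2, hA₁, hA₂]
        rw [← hax, ← hby]
        push_cast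
        field_simp
      have e : (ψ x₀ + lin2 A₁ A₂ ⟨x, y⟩ / (d (1 / 4 + a) (1 / 4 + b) / d₀ : ℝ)) *
          (d (1 / 4 + a) (1 / 4 + b) : ℝ) = ψ x₀ * (d (1 / 4 + a) (1 / 4 + b) : ℝ) +
          lin2 A₁ A₂ ⟨x, y⟩ * d₀ := by
        rw [add_mul, Complex.ofReal_div, div_div_eq_mul_div, div_mul_cancel₀ _ hd0']
      rw [e, hv, hlin, hdd]
      have hy₀' := hy₀
      push_cast at hy₀' ⊢
      linear_combination -hy₀'
  have hball : ball x₀ (σ / 4) ⊆ ball 0 δ := by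
    intro z hz
    rw [mem_ball_zero_iff]
    have h1 : ‖x₀‖ ≤ σ / 2 := by
      have h1 := Complex.norm_le_abs_re_add_abs_im x₀
      rw [hx₀, hpre, hpim, abs_of_nonneg (by push_cast; positivity)] at h1
      push_cast at h1
      linarith
    have h2 : ‖z - x₀‖ < σ / 4 := mem_ball_iff_norm.1 hz
    have h3 := norm_le_norm_add_norm_sub' z x₀
    linarith
  refine ⟨x₀, hpN _ _, σ / 4, hε, A₁, A₂, d₁ / (d₀ * σ), d₂ / (d₀ * σ), ?_, hball,
    fun z hz hzε => ⟨(hloc z hz hzε).1, (hloc z hz hzε).2.2⟩⟩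
  -- Nondegeneracy of the linear part: were `A₁, A₂` dependent, the noncollinear points `x₀`, `x₀ +
  -- η`, `x₀ + ηi` would have collinear images.
  obtain ⟨η, hη0, hη1⟩ := exists_rat_btwn hε
  have hη0' : (0 : ℝ) < η := by exact_mod_cast hη0
  set z₁ : ℂ := ⟨(η : ℚ), (0 : ℚ)⟩ with hz₁
  set z₂ : ℂ := ⟨(0 : ℚ), (η : ℚ)⟩ with hz₂
  have hz₁N : z₁ ∈ Net := ⟨η, 0, rfl⟩
  have hz₂N : z₂ ∈ Net := ⟨0, η, rfl⟩
  have hz₁n : ‖z₁‖ < σ / 4 := by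
    refine (Complex.norm_le_abs_re_add_abs_im _).trans_lt ?_
    simpa [hz₁, abs_of_pos hη0'] using hη1
  have hz₂n : ‖z₂‖ < σ / 4 := by
    refine (Complex.norm_le_abs_re_add_abs_im _).trans_lt ?_
    simpa [hz₂, abs_of_pos hη0'] using hη1
  obtain ⟨-, m₁, f₁⟩ := hloc z₁ hz₁N hz₁n
  obtain ⟨-, m₂, f₂⟩ := hloc z₂ hz₂N hz₂n
  have hnc := h.not_col (hpN (1 / 4) (1 / 4)) (Net.add (hpN (1 / 4) (1 / 4)) hz₁N)
    (Net.add (hpN (1 / 4) (1 / 4)) hz₂N) (hpδ _ _ (by norm_num) (by norm_num) (by norm_num)) m₁ m₂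
    (by
      rw [col_iff_det2, ← hx₀, add_sub_cancel_left, add_sub_cancel_left]
      simp [det2, hz₁, hz₂, hη0'.ne'])
  rw [col_iff_det2, ← hx₀, f₁, f₂, add_sub_cancel_left, add_sub_cancel_left] at hnc
  intro h0
  apply hnc
  have hl₁ : ∀ t : ℝ, lin2 A₁ A₂ z₁ / (t : ℂ) = (η / t : ℝ) * A₁ := by
    intro t; simp only [lin2, hz₁]; push_cast; ring
  have hl₂ : ∀ t : ℝ, lin2 A₁ A₂ z₂ / (t : ℂ) = (η / t : ℝ) * A₂ := by
    intro t; simp only [lin2, hz₂]; push_cast; ring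
  rw [hl₁, hl₂]
  generalize 1 + z₁.re * (d₁ / (d₀ * σ)) + z₁.im * (d₂ / (d₀ * σ)) = t₁
  generalize 1 + z₂.re * (d₁ / (d₀ * σ)) + z₂.im * (d₂ / (d₀ * σ)) = t₂
  unfold det2 at h0 ⊢
  simp only [Complex.re_ofReal_mul, Complex.im_ofReal_mul]
  linear_combination (η / t₁) * (η / t₂) * h0

/-! ### Blow-up of the projective map to a linear map. -/

theorem exists_shrink {B : Set ℂ} (hB : Convex ℝ B) {φ : ℂ × ℂ} (hφ : φ.1 ≠ 0) {y : ℂ}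
    (hy : y ∈ copy B φ) {S : ℝ} (hS : 0 < S) :
    ∃ φ' : ℂ × ℂ, φ'.1 ≠ 0 ∧ ‖φ'.1‖ ≤ S ∧ copy B φ' ⊆ copy B φ ∧ y ∈ copy B φ' ∧
      (‖φ.1‖ ≤ S → φ' = φ) ∧ (S < ‖φ.1‖ → ‖φ'.1‖ = S) := by
  by_cases h : ‖φ.1‖ ≤ S
  · exact ⟨φ, hφ, h, Subset.rfl, hy, fun _ => rfl, fun h' => absurd h h'.not_ge⟩
  push Not at h
  have hpos : 0 < ‖φ.1‖ := norm_pos_iff.2 hφ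
  set t := S / ‖φ.1‖ with ht
  have ht0 : 0 < t := by positivity
  have ht1 : t ≤ 1 := by rw [ht, div_le_one hpos]; exact h.le
  obtain ⟨c, hc, rfl⟩ := hy
  have hn : ‖(t : ℂ) * φ.1‖ = S := by
    rw [norm_mul, Complex.norm_of_nonneg ht0.le, ht, div_mul_cancel₀ _ hpos.ne']
  refine ⟨(t * φ.1, φ.1 * c + φ.2 - t * φ.1 * c), ?_, hn.le, ?_, ⟨c, hc, by simp⟩,
    fun h' => absurd h h'.not_gt, fun _ => hn⟩
  · exact mul_ne_zero (by exact_mod_cast ht0.ne') hφ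
  · rintro _ ⟨x, hx, rfl⟩
    refine ⟨t • x + (1 - t) • c, hB hx hc ht0.le (by linarith) (by ring), ?_⟩
    simp only [Complex.real_smul]
    push_cast
    ring

theorem subset_of_net_inter_subset {U K : Set ℂ} (hU : IsOpen U) (hK : IsClosed K)
    (h : ∀ z ∈ Net, z ∈ U → z ∈ K) : U ⊆ K := by
  intro z hz
  by_contra hzK
  obtain ⟨q, hq, hqU, hqK⟩ := exists_net_mem (hU.inter hK.isOpen_compl) ⟨z, hz, hzK⟩
  exact hqK (h q hq hqU)

theorem IsBody.closure_interior {K : Set ℂ} (hK : IsBody K) : closure (interior K) = K := by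
  rw [hK.convex.closure_interior_eq_closure_of_nonempty_interior hK.nonempty,
    hK.compact.isClosed.closure_eq]

/-- If the points of `T '' A` and of its complement are asymptotically separated by copies of `B`,
then `T '' A` is a copy of `B`. -/
theorem exists_image_eq_copy {ι : Type*} (𝒰 : Ultrafilter ι) {A B : Set ℂ} (hA : IsBody A)
    (hB : IsBody B) (T : ℂ ≃ₜ ℂ) (φ : ι → ℂ × ℂ) (hφ : ∀ᶠ i in 𝒰, (φ i).1 ≠ 0) (y : ℂ → ι → ℂ)
    (hy : ∀ h ∈ Net, Tendsto (y h) 𝒰 (𝓝 (T h)))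
    (hin : ∀ h ∈ Net, h ∈ A → ∀ᶠ i in 𝒰, y h i ∈ copy B (φ i))
    (hout : ∀ h ∈ Net, h ∉ A → ∀ᶠ i in 𝒰, y h i ∉ interior (copy B (φ i))) :
    ∃ v : Par, T '' A = copy B v := by
  obtain ⟨a, ρ, R, hρ, hR, hBρ, hBR⟩ := hB.bounds
  obtain ⟨M, hM, hAM⟩ := (hA.compact.image T.continuous).isBounded.subset_closedBall_lt 0 0
  obtain ⟨q, hqN, hqA⟩ := exists_net_mem isOpen_interior hA.nonempty
  replace hqA := interior_subset hqA
  -- The copies `φ i` are not known to be bounded, so they are first cut down to scale at most `S`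
  -- around a point. If cutting were needed for almost all `i`, the limit would have scale `S`, its
  -- interior would lie in `T '' A`, and a segment of length `Sρ = 2M + 1` would fit into the disk
  -- of radius `M`.
  set S := (2 * M + 1) / ρ with hS
  have hS0 : 0 < S := by positivity
  have hex : ∀ i, ∃ φ' : ℂ × ℂ, (φ i).1 ≠ 0 → y q i ∈ copy B (φ i) →
      φ'.1 ≠ 0 ∧ ‖φ'.1‖ ≤ S ∧ copy B φ' ⊆ copy B (φ i) ∧ y q i ∈ copy B φ' ∧
      (‖(φ i).1‖ ≤ S → φ' = φ i) ∧ (S < ‖(φ i).1‖ → ‖φ'.1‖ = S) := by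
    intro i
    by_cases h : (φ i).1 ≠ 0 ∧ y q i ∈ copy B (φ i)
    · obtain ⟨φ', h'⟩ := exists_shrink hB.convex h.1 h.2 hS0
      exact ⟨φ', fun _ _ => h'⟩
    · exact ⟨0, fun h1 h2 => absurd ⟨h1, h2⟩ h⟩
  choose φ' hφ' using hex
  have hev := (hφ.and (hin q hqN hqA)).mono fun i h => hφ' i h.1 h.2
  obtain ⟨l, hl⟩ := exists_tendsto_of_bounded 𝒰 φ'
      (max S (‖T q‖ + 1 + S * (‖a‖ + R))) (by
    have h1 : ∀ᶠ i in 𝒰, ‖y q i‖ < ‖T q‖ + 1 :=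
      (hy q hqN).norm.eventually_lt_const (by linarith)
    filter_upwards [h1, hev] with i h1 h2
    obtain ⟨-, h3, -, ⟨c, hc, h4⟩, -⟩ := h2
    rw [Prod.norm_def]
    refine max_le_max h3 ?_
    have h5 : ‖c‖ ≤ ‖a‖ + R := by
      have := hBR hc
      rw [mem_closedBall, dist_eq_norm] at this
      linarith [norm_le_norm_add_norm_sub' c a]
    have h6 : (φ' i).2 = y q i - (φ' i).1 * c := by rw [← h4]; ring
    rw [h6]
    refine (norm_sub_le _ _).trans ?_
    rw [norm_mul]
    have : ‖(φ' i).1‖ * ‖c‖ ≤ S * (‖a‖ + R) := by gcongr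
    linarith)
  have houtl : l.1 ≠ 0 → interior (copy B l) ⊆ T '' A := by
    intro hl0
    have : T ⁻¹' interior (copy B l) ⊆ A := by
      refine subset_of_net_inter_subset (isOpen_interior.preimage T.continuous)
        hA.compact.isClosed fun z hz hzl => ?_
      by_contra hzA
      obtain ⟨i, h1, h2, h3⟩ := ((eventually_mem_interior_copy hl hl0 (hy z hz) hzl).and
        ((hout z hz hzA).and hev)).exists
      exact h2 (interior_mono h3.2.2.1 h1)
    intro z hz
    exact ⟨T.symm z, this (by simpa using hz), by simp⟩
  have hle : ∀ᶠ i in 𝒰, ‖(φ i).1‖ ≤ S := by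
    by_contra hgt
    rw [← Ultrafilter.eventually_not] at hgt
    have h1 : ‖l.1‖ = S := by
      have h2 : Tendsto (fun i => ‖(φ' i).1‖) 𝒰 (𝓝 ‖l.1‖) :=
        ((continuous_fst.tendsto l).comp hl).norm
      refine tendsto_nhds_unique h2 (tendsto_const_nhds.congr' ?_)
      filter_upwards [hgt, hev] with i h3 h4
      exact (h4.2.2.2.2.2 (not_le.1 h3)).symm
    have hl0 : l.1 ≠ 0 := norm_pos_iff.1 (h1 ▸ hS0)
    have hmem : ∀ s : ℝ, |s| < ρ → ‖l.1 * (a + s) + l.2‖ ≤ M := by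
      intro s hs
      have h3 : l.1 * (a + s) + l.2 ∈ interior (copy B l) := by
        rw [mem_interior_copy_iff hl0, add_sub_cancel_right, mul_div_cancel_left₀ _ hl0]
        refine interior_mono hBρ ?_
        refine ball_subset_interior_closedBall ?_
        simpa [mem_ball_iff_norm] using hs
      simpa using hAM (houtl hl0 h3)
    have h4 := hmem (ρ / 2) (by rw [abs_of_pos (by positivity)]; linarith)
    have h5 := hmem (-(ρ / 2)) (by rw [abs_neg, abs_of_pos (by positivity)]; linarith)
    have h6 := (norm_sub_le _ _).trans (add_le_add h4 h5)
    have h7 : l.1 * (a + (ρ / 2 : ℝ)) + l.2 - (l.1 * (a + (-(ρ / 2) : ℝ)) + l.2) = l.1 * (ρ : ℝ) := by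
      push_cast; ring
    rw [h7, norm_mul, h1, Complex.norm_of_nonneg hρ.le, hS, div_mul_cancel₀ _ hρ.ne'] at h6
    linarith
  have hlB : Tendsto φ 𝒰 (𝓝 l) := by
    refine hl.congr' ?_
    filter_upwards [hle, hev] with i h1 h2
    exact h2.2.2.2.2.1 h1
  have hsub : T '' A ⊆ copy B l := by
    have hcl : IsClosed (T ⁻¹' copy B l) :=
      (copy_compact hB.compact l).isClosed.preimage T.continuous
    have : interior A ⊆ T ⁻¹' copy B l := by
      refine subset_of_net_inter_subset isOpen_interior hcl fun z hz hzA => ?_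
      obtain ⟨z', hz', h1⟩ := exists_tendsto_of_mem_copy hB.compact hlB
        (hin z hz (interior_subset hzA))
      rw [mem_preimage, tendsto_nhds_unique (hy z hz) h1]
      exact hz'
    rw [image_subset_iff, ← hA.closure_interior]
    exact closure_minimal this hcl
  have hl0 : l.1 ≠ 0 := by
    intro h0
    have hss : (copy B l).Subsingleton := by
      rintro _ ⟨b, -, rfl⟩ _ ⟨c, -, rfl⟩
      simp [h0]
    have h1 : (interior A).Subsingleton := fun x hx z hz =>
      T.injective (hss (hsub ⟨x, interior_subset hx, rfl⟩) (hsub ⟨z, interior_subset hz, rfl⟩))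
    obtain ⟨x, hx⟩ := hA.nonempty
    have h2 : interior A = {x} := h1.eq_singleton_of_mem hx
    exact not_isOpen_singleton x (h2 ▸ isOpen_interior)
  refine ⟨⟨l, hl0⟩, hsub.antisymm ?_⟩
  rw [← (isBody_copy hB hl0).closure_interior]
  exact closure_minimal (houtl hl0) (hA.compact.image T.continuous).isClosed

/-- The real-linear map `z ↦ α z + β z̄`. -/
noncomputable def rlin (α β z : ℂ) : ℂ := α * z + β * (starRingEnd ℂ) z

theorem rlin_comp (α β α' β' z : ℂ) : rlin α' β' (rlin α β z) =
    rlin (α' * α + β' * (starRingEnd ℂ) β) (α' * β + β' * (starRingEnd ℂ) α) z := by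
  simp only [rlin, map_add, map_mul, Complex.conj_conj]
  ring

theorem continuous_rlin (α β : ℂ) : Continuous (rlin α β) := by
  unfold rlin
  exact (continuous_const.mul continuous_id).add (continuous_const.mul Complex.continuous_conj)

theorem exists_homeomorph_rlin {α β : ℂ} (h : ‖α‖ ≠ ‖β‖) : ∃ T : ℂ ≃ₜ ℂ, ∀ z, T z = rlin α β z := by
  have h1 : α * (starRingEnd ℂ) α - β * (starRingEnd ℂ) β ≠ 0 := by
    rw [Complex.mul_conj, Complex.mul_conj, sub_ne_zero]
    intro h2
    apply h
    have h3 : Complex.normSq α = Complex.normSq β := by exact_mod_cast h2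
    rw [Complex.normSq_eq_norm_sq, Complex.normSq_eq_norm_sq] at h3
    exact (sq_eq_sq₀ (norm_nonneg _) (norm_nonneg _)).1 h3
  set D := α * (starRingEnd ℂ) α - β * (starRingEnd ℂ) β with hD
  have hDc : (starRingEnd ℂ) D = D := by simp [hD, mul_comm]
  have hone : ∀ z, rlin 1 0 z = z := fun z => by simp [rlin]
  refine ⟨⟨⟨rlin α β, rlin ((starRingEnd ℂ) α / D) (-β / D), fun z => ?_, fun z => ?_⟩,
    continuous_rlin _ _, continuous_rlin _ _⟩, fun z => rfl⟩
  · have e1 : (starRingEnd ℂ) α / D * α + -β / D * (starRingEnd ℂ) β = 1 := by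
      rw [div_mul_eq_mul_div, div_mul_eq_mul_div, ← add_div, div_eq_one_iff_eq h1, hD]
      ring
    have e2 : (starRingEnd ℂ) α / D * β + -β / D * (starRingEnd ℂ) α = 0 := by ring
    rw [rlin_comp, e1, e2, hone]
  · have e1 : α * ((starRingEnd ℂ) α / D) + β * (starRingEnd ℂ) (-β / D) = 1 := by
      rw [map_div₀, hDc, map_neg, ← mul_div_assoc, ← mul_div_assoc, ← add_div,
        div_eq_one_iff_eq h1, hD]
      ring
    have e2 : α * (-β / D) + β * (starRingEnd ℂ) ((starRingEnd ℂ) α / D) = 0 := by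
      rw [map_div₀, hDc, Complex.conj_conj]
      ring
    rw [rlin_comp, e1, e2, hone]

theorem exists_lin2_eq_rlin {A₁ A₂ : ℂ} (h : det2 A₁ A₂ ≠ 0) :
    ∃ α β : ℂ, ‖α‖ ≠ ‖β‖ ∧ ∀ z, lin2 A₁ A₂ z = rlin α β z := by
  refine ⟨(A₁ - Complex.I * A₂) / 2, (A₁ + Complex.I * A₂) / 2, fun h0 => h ?_, fun z => ?_⟩
  · have h1 := congrArg (fun x => x ^ 2) h0
    simp only [← Complex.normSq_eq_norm_sq, Complex.normSq_apply] at h1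
    unfold det2
    simp at h1
    linarith
  · simp only [lin2, rlin]
    have h1 : (starRingEnd ℂ) z = z.re - z.im * Complex.I := by
      apply Complex.ext <;> simp
    rw [h1]
    conv_rhs => enter [1, 2]; rw [← Complex.re_add_im z]
    linear_combination ((z.im : ℂ) * A₂) * Complex.I_sq

/-- A local map between realizations yields a linear map taking all rotated copies of `A` to copies
of `B`. -/
theorem PointMap.exists_rlin {A B Ω : Set ℂ} {Ψ : Par → ℂ × ℂ} {δ : ℝ} {ψ : ℂ → ℂ}
    (h : PointMap A B Ω Ψ δ ψ) (hA : IsBody A) (hB : IsBody B) (hfill : FillsHalfPlanes A) :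
    ∃ α β : ℂ, ‖α‖ ≠ ‖β‖ ∧ ∀ u : ℂ, ‖u‖ = 1 → ∃ v : Par, rlin α β '' copy A (u, 0) = copy B v := by
  obtain ⟨x₀, hx₀, ε, hε, A₁, A₂, l₁, l₂, hdet, hball, hproj⟩ :=
    (h.colMap hA hB hfill).exists_projective
  obtain ⟨α, β, hαβ, hlin⟩ := exists_lin2_eq_rlin hdet
  refine ⟨α, β, hαβ, fun u hu => ?_⟩
  have hu0 : u ≠ 0 := norm_pos_iff.1 (by rw [hu]; exact one_pos)
  obtain ⟨T, hT⟩ := exists_homeomorph_rlin hαβ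
  have hTf : (T : ℂ → ℂ) = rlin α β := funext hT
  rw [← hTf]
  obtain ⟨M, hM, hAM⟩ := hA.compact.isBounded.subset_closedBall_lt 0 0
  set 𝒰 : Ultrafilter ℕ := Ultrafilter.of atTop with h𝒰
  have h𝒰le : (𝒰 : Filter ℕ) ≤ atTop := Ultrafilter.of_le _
  have hpos : ∀ᶠ n : ℕ in 𝒰, 0 < (n : ℝ) :=
    h𝒰le ((eventually_gt_atTop 0).mono fun n hn => by exact_mod_cast hn)
  have hsmall : ∀ c : ℝ, ∀ᶠ n : ℕ in 𝒰, c < ε * n := fun c =>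
    h𝒰le ((tendsto_natCast_atTop_atTop.const_mul_atTop hε).eventually_gt_atTop c)
  have hcexists : ∀ n : ℕ, ∃ v : Par, 0 < (n : ℝ) → v.1 = (u / n, x₀) := by
    intro n
    by_cases hn : 0 < (n : ℝ)
    · exact ⟨⟨(u / n, x₀), div_ne_zero hu0 (by exact_mod_cast hn.ne')⟩, fun _ => rfl⟩
    · exact ⟨⟨(1, 0), one_ne_zero⟩, fun h => absurd h hn⟩
  choose v hv using hcexists
  have hvΩ : ∀ᶠ n : ℕ in 𝒰, copy A (v n) ⊆ Ω := by
    filter_upwards [hpos, hsmall M] with n hn hMn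
    refine Subset.trans ?_ (hball.trans h.sub)
    rw [hv n hn]
    rintro _ ⟨z, hz, rfl⟩
    have h1 := hAM hz
    rw [mem_closedBall_zero_iff] at h1
    rw [mem_ball_iff_norm, add_sub_cancel_right, norm_mul, norm_div, hu, Complex.norm_natCast,
      div_mul_eq_mul_div, one_mul, div_lt_iff₀ hn]
    linarith
  have hmem : ∀ᶠ n : ℕ in 𝒰, ∀ z : ℂ, x₀ + z / n ∈ copy A (v n) ↔ z ∈ copy A (u, 0) := by
    filter_upwards [hpos] with n hn z
    have hn' : (n : ℂ) ≠ 0 := by exact_mod_cast hn.ne'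
    rw [hv n hn, mem_copy_iff (div_ne_zero hu0 hn'), mem_copy_iff hu0]
    simp only [add_sub_cancel_left, sub_zero]
    rw [div_div_div_cancel_right₀ hn']
  -- Source and target are magnified by `n` about `x₀` and `ψ x₀`. The projective denominator tends
  -- to `1`, leaving the linear part.
  set φ : ℕ → ℂ × ℂ := fun n => (n * (Ψ (v n)).1, n * ((Ψ (v n)).2 - ψ x₀)) with hφ
  have hmemφ : ∀ᶠ n : ℕ in 𝒰, (φ n).1 ≠ 0 ∧ ∀ z : ℂ,
      (n * (z - ψ x₀) ∈ copy B (φ n) ↔ z ∈ copy B (Ψ (v n))) ∧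
      (n * (z - ψ x₀) ∈ interior (copy B (φ n)) ↔ z ∈ interior (copy B (Ψ (v n)))) := by
    filter_upwards [hpos, hvΩ] with n hn hvn
    have hn' : (n : ℂ) ≠ 0 := by exact_mod_cast hn.ne'
    have h0 : (Ψ (v n)).1 ≠ 0 := h.limit.ne _ hvn
    have h1 : (φ n).1 ≠ 0 := mul_ne_zero hn' h0
    refine ⟨h1, fun z => ?_⟩
    rw [mem_copy_iff h1, mem_copy_iff h0, mem_interior_copy_iff h1, mem_interior_copy_iff h0]
    have e : (n * (z - ψ x₀) - (φ n).2) / (φ n).1 = (z - (Ψ (v n)).2) / (Ψ (v n)).1 := by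
      rw [div_eq_div_iff h1 h0, hφ]
      ring
    rw [e]
    exact ⟨Iff.rfl, Iff.rfl⟩
  have hnet : ∀ z ∈ Net, ∀ᶠ n : ℕ in 𝒰, x₀ + z / n ∈ Net ∧ ‖x₀ + z / n‖ < δ ∧
      n * (ψ (x₀ + z / n) - ψ x₀) = rlin α β z / (1 + (z.re * l₁ + z.im * l₂) / n : ℝ) := by
    intro z hz
    filter_upwards [hpos, hsmall ‖z‖] with n hn hzn
    have hn' : (n : ℂ) ≠ 0 := by exact_mod_cast hn.ne'
    have e : z / n = ((((n : ℚ)⁻¹ : ℚ) : ℝ) : ℂ) * z := by push_cast; ring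
    have hN : z / n ∈ Net := by rw [e]; exact Net.ratMul hz _
    have hlt : ‖z / n‖ < ε := by
      rw [norm_div, Complex.norm_natCast, div_lt_iff₀ hn]; exact hzn
    refine ⟨Net.add hx₀ hN, ?_, ?_⟩
    · have := hball (show x₀ + z / n ∈ ball x₀ ε by
        rwa [mem_ball_iff_norm, add_sub_cancel_left])
      rwa [mem_ball_zero_iff] at this
    · obtain ⟨-, h2⟩ := hproj _ hN hlt
      have hre : (z / n).re = z.re / n := Complex.div_natCast_re z n
      have him : (z / n).im = z.im / n := Complex.div_natCast_im z n
      have e2 : 1 + (z / n).re * l₁ + (z / n).im * l₂ = 1 + (z.re * l₁ + z.im * l₂) / n := by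
        rw [hre, him]; ring
      rw [h2, add_sub_cancel_left, e2, ← hlin]
      have e3 : lin2 A₁ A₂ z = n * lin2 A₁ A₂ (z / n) := by
        simp only [lin2]
        rw [hre, him]
        push_cast
        field_simp
      rw [e3, mul_div_assoc]
  refine exists_image_eq_copy 𝒰 (isBody_copy hA hu0) hB T φ (hmemφ.mono fun n h => h.1)
    (fun z n => n * (ψ (x₀ + z / n) - ψ x₀)) (fun z hz => ?_) (fun z hz hzA => ?_)
    (fun z hz hzA => ?_)
  · have h1 : Tendsto (fun n : ℕ => (1 + (z.re * l₁ + z.im * l₂) / n : ℝ)) 𝒰 (𝓝 (1 + 0)) :=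
      (tendsto_const_nhds.add (tendsto_const_div_atTop_nhds_zero_nat _)).mono_left h𝒰le
    rw [add_zero] at h1
    have h2 : Tendsto (fun n : ℕ => ((1 + (z.re * l₁ + z.im * l₂) / n : ℝ) : ℂ)) 𝒰 (𝓝 1) := by
      have := (Complex.continuous_ofReal.tendsto 1).comp h1
      simpa only [Function.comp_def, Complex.ofReal_one] using this
    have h3 := (tendsto_const_nhds (x := rlin α β z)).div h2 one_ne_zero
    rw [div_one] at h3
    rw [hTf]
    exact h3.congr' ((hnet z hz).mono fun n hn => hn.2.2.symm)
  · filter_upwards [hnet z hz, hmem, hmemφ, hvΩ] with n h1 h2 h3 h4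
    exact ((h3.2 _).1).2 (h.mem _ h1.1 h1.2.1 _ h4 ((h2 z).2 hzA))
  · filter_upwards [hnet z hz, hmem, hmemφ, hvΩ] with n h1 h2 h3 h4
    rw [(h3.2 _).2]
    exact h.notMem _ h1.1 h1.2.1 _ h4 (mt (h2 z).1 hzA)

/-! ### Linear maps between families of copies. -/

/-- `z ↦ α z + β z̄` maps copies of `A` to copies of `B`. -/
def MapsCopies (A B : Set ℂ) (α β : ℂ) : Prop :=
  ∀ u : Par, ∃ v : Par, rlin α β '' copy A u = copy B v

theorem rlin_image_copy (α β : ℂ) (X : Set ℂ) (r : ℝ) (b : ℂ) :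
    rlin α β '' copy X (r, b) = copy (rlin α β '' X) (r, rlin α β b) := by
  simp only [copy, image_image]
  congr 1
  ext z
  simp only [rlin, map_add, map_mul, Complex.conj_ofReal]
  ring

/-- A real-linear map respects positive scaling and translation, so only rotations need to be
checked. -/
theorem mapsCopies_of_norm_one {A B : Set ℂ} {α β : ℂ}
    (h : ∀ u : ℂ, ‖u‖ = 1 → ∃ v : Par, rlin α β '' copy A (u, 0) = copy B v) :
    MapsCopies A B α β := by
  rintro ⟨⟨w, b⟩, hw⟩
  have hn : ‖w‖ ≠ 0 := norm_ne_zero_iff.2 hw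
  obtain ⟨⟨v, hv0⟩, hv⟩ := h (w / ‖w‖) (by
    rw [norm_div, Complex.norm_real, norm_norm, div_self hn])
  have hn' : (‖w‖ : ℂ) ≠ 0 := by exact_mod_cast hn
  refine ⟨⟨(‖w‖ * v.1, ‖w‖ * v.2 + rlin α β b), mul_ne_zero hn' hv0⟩, ?_⟩
  have e : copy A (w, b) = copy (copy A (w / ‖w‖, 0)) ((‖w‖ : ℝ), b) := by
    rw [copy_copy]
    simp only [mul_zero, zero_add]
    rw [mul_div_cancel₀ _ hn']
  simp only at hv ⊢
  rw [e, rlin_image_copy, hv, copy_copy]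

theorem MapsCopies.comp {A B C : Set ℂ} {α β α' β' : ℂ} (h' : MapsCopies B C α' β')
    (h : MapsCopies A B α β) :
    MapsCopies A C (α' * α + β' * (starRingEnd ℂ) β) (α' * β + β' * (starRingEnd ℂ) α) := by
  intro u
  obtain ⟨v, hv⟩ := h u
  obtain ⟨w, hw⟩ := h' v
  refine ⟨w, ?_⟩
  rw [← hw, ← hv, image_image]
  simp only [rlin_comp]

theorem mapsCopies_mul (A : Set ℂ) {e : ℂ} (he : e ≠ 0) : MapsCopies A A e 0 := by
  rintro ⟨⟨w, b⟩, hw⟩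
  refine ⟨⟨(e * w, e * b), mul_ne_zero he hw⟩, ?_⟩
  simp only [copy, image_image]
  congr 1
  ext z
  simp only [rlin]
  ring

theorem MapsCopies.mul_left {A B : Set ℂ} {α β : ℂ} (h : MapsCopies A B α β) {e : ℂ} (he : e ≠ 0) :
    MapsCopies A B (e * α) (e * β) := by
  simpa using (mapsCopies_mul B he).comp h

theorem MapsCopies.mul_right {A B : Set ℂ} {α β : ℂ} (h : MapsCopies A B α β) {e : ℂ}
    (he : e ≠ 0) : MapsCopies A B (α * e) (β * (starRingEnd ℂ) e) := by
  simpa using h.comp (mapsCopies_mul A he)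

/-- For real `a, b` the map stretches the real axis by `a + b` and the imaginary axis by `a - b`.
Its image of `A` is a copy of scale `‖w‖`; comparing extents gives `|a + b| ρ ≤ ‖w‖ R` and `‖w‖ ρ ≤
|a - b| R`. The resulting distortion bound depends on `A` alone. -/
theorem MapsCopies.abs_add_le {A : Set ℂ} {p : ℂ} {ρ R : ℝ} (hρ : 0 < ρ)
    (hAρ : closedBall p ρ ⊆ A) (hAR : A ⊆ closedBall p R) {a b : ℝ} (h : MapsCopies A A a b) :
    |a + b| * ρ ^ 2 ≤ |a - b| * R ^ 2 := by
  obtain ⟨⟨⟨w, c⟩, hw⟩, hv⟩ := h ⟨(1, 0), one_ne_zero⟩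
  simp only [copy_one] at hv hw
  have hn : 0 < ‖w‖ := norm_pos_iff.2 hw
  have hR : 0 ≤ R := nonneg_of_mem_closedBall (hAR (hAρ (mem_closedBall_self hρ.le)))
  have hmem : ∀ z : ℂ, ‖z‖ = 1 → p + ρ * z ∈ A := by
    intro z hz
    apply hAρ
    rw [mem_closedBall_iff_norm, add_sub_cancel_left, norm_mul, hz, mul_one,
      Complex.norm_of_nonneg hρ.le]
  have h1 : |a + b| * ρ ≤ ‖w‖ * R := by
    have h2 := dist_copy_le hAR (hv ▸ mem_image_of_mem (rlin a b) (hmem 1 norm_one))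
      (hv ▸ mem_image_of_mem (rlin a b) (hmem (-1) (by rw [norm_neg, norm_one])))
    have e : rlin a b (p + ρ * 1) - rlin a b (p + ρ * -1) = (((a + b) * (2 * ρ) : ℝ) : ℂ) := by
      simp only [rlin, map_add, map_mul, Complex.conj_ofReal, map_neg, map_one]
      push_cast
      ring
    rw [dist_eq_norm, e, Complex.norm_real, Real.norm_eq_abs, abs_mul,
      abs_of_pos (by positivity : 0 < 2 * ρ)] at h2
    simp only at h2
    linarith
  have h2 : ‖w‖ * ρ ≤ |a - b| * R := by
    set s : ℂ := Complex.I * ‖w‖ / w with hs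
    have hs1 : ‖s‖ = 1 := by
      rw [hs, norm_div, norm_mul, Complex.norm_I, Complex.norm_real, norm_norm, one_mul,
        div_self hn.ne']
    have hmem' : ∀ z : ℂ, ‖z‖ = 1 → ∃ x ∈ A, rlin a b x = w * (p + ρ * z) + c := by
      intro z hz
      have h3 : w * (p + ρ * z) + c ∈ copy A (w, c) := ⟨_, hmem z hz, rfl⟩
      rwa [← hv] at h3
    obtain ⟨x, hx, ex⟩ := hmem' s hs1
    obtain ⟨y, hy, ey⟩ := hmem' (-s) (by rw [norm_neg, hs1])
    have e : rlin a b x - rlin a b y = ((2 * ρ * ‖w‖ : ℝ) : ℂ) * Complex.I := by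
      rw [ex, ey, hs]
      push_cast
      field_simp
      ring
    have h3 := congrArg Complex.im e
    simp only [rlin, Complex.sub_im, Complex.add_im, Complex.im_ofReal_mul, Complex.conj_im,
      Complex.I_im, mul_one] at h3
    have h4 : (a - b) * (x.im - y.im) = 2 * ρ * ‖w‖ := by linear_combination h3
    have h5 : |x.im - y.im| ≤ 2 * R := by
      rw [← Complex.sub_im]
      refine (Complex.abs_im_le_norm _).trans ?_
      rw [← dist_eq_norm]
      have := dist_triangle_right x y p
      linarith [mem_closedBall.1 (hAR hx), mem_closedBall.1 (hAR hy)]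
    have h6 : |a - b| * |x.im - y.im| = 2 * ρ * ‖w‖ := by
      rw [← abs_mul, h4, abs_of_pos (by positivity)]
    have := mul_le_mul_of_nonneg_left h5 (abs_nonneg (a - b))
    linarith
  calc |a + b| * ρ ^ 2 = |a + b| * ρ * ρ := by ring
    _ ≤ ‖w‖ * R * ρ := by gcongr
    _ = ‖w‖ * ρ * R := by ring
    _ ≤ |a - b| * R * R := by gcongr
    _ = |a - b| * R ^ 2 := by ring

theorem MapsCopies.exists_pow {A : Set ℂ} {a b : ℝ} (h : MapsCopies A A a b) (n : ℕ) :
    ∃ c d : ℝ, c + d = (a + b) ^ n ∧ c - d = (a - b) ^ n ∧ MapsCopies A A c d := by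
  induction n with
  | zero => exact ⟨1, 0, by simp, by simp, by simpa using mapsCopies_mul A one_ne_zero⟩
  | succ n ih =>
    obtain ⟨c, d, h1, h2, h3⟩ := ih
    refine ⟨a * c + b * d, a * d + b * c, ?_, ?_, ?_⟩
    · rw [pow_succ, ← h1]; ring
    · rw [pow_succ, ← h2]; ring
    · simpa using h.comp h3

/-- If both coefficients were positive, then `|a - b| < a + b`, and the powers of the map would
exceed the uniform distortion bound. -/
theorem MapsCopies.mul_eq_zero_of_nonneg {A : Set ℂ} (hA : IsBody A) {a b : ℝ} (ha : 0 ≤ a)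
    (hb : 0 ≤ b) (h : MapsCopies A A a b) : a * b = 0 := by
  by_contra hab
  have ha' : 0 < a := ha.lt_of_ne (fun h0 => hab (by rw [← h0, zero_mul]))
  have hb' : 0 < b := hb.lt_of_ne (fun h0 => hab (by rw [← h0, mul_zero]))
  obtain ⟨p, ρ, R, hρ, hR, hAρ, hAR⟩ := hA.bounds
  have hpow : ∀ n : ℕ, (a + b) ^ n * ρ ^ 2 ≤ |a - b| ^ n * R ^ 2 := by
    intro n
    obtain ⟨c, d, h1, h2, h3⟩ := h.exists_pow n
    have := h3.abs_add_le hρ hAρ hAR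
    rwa [h1, h2, abs_pow, abs_pow, abs_of_pos (by positivity)] at this
  have hlt : |a - b| < a + b := by rw [abs_lt]; constructor <;> linarith
  have h0 : |a - b| ≠ 0 := by
    intro h0
    have := hpow 1
    rw [h0] at this
    have h1 : 0 < (a + b) ^ 1 * ρ ^ 2 := by positivity
    linarith
  have hpos : 0 < |a - b| := lt_of_le_of_ne (abs_nonneg _) h0.symm
  obtain ⟨n, hn⟩ := pow_unbounded_of_one_lt (R ^ 2 / ρ ^ 2) ((one_lt_div hpos).2 hlt)
  have h1 := hpow n
  rw [div_pow, div_lt_div_iff₀ (by positivity) (by positivity)] at hn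
  linarith

theorem exists_norm_one_mul (a : ℂ) : ∃ s : ℂ, ‖s‖ = 1 ∧ a = ‖a‖ * s := by
  by_cases h : a = 0
  · exact ⟨1, norm_one, by simp [h]⟩
  · have hn : ‖a‖ ≠ 0 := norm_ne_zero_iff.2 h
    have hn' : (‖a‖ : ℂ) ≠ 0 := by exact_mod_cast hn
    refine ⟨a / ‖a‖, ?_, ?_⟩
    · rw [norm_div, Complex.norm_real, norm_norm, div_self hn]
    · rw [mul_div_cancel₀ _ hn']

/-- A linear map preserving the family of copies of a body is a similarity. -/
theorem MapsCopies.mul_eq_zero {A : Set ℂ} (hA : IsBody A) {a b : ℂ} (h : MapsCopies A A a b) :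
    a * b = 0 := by
  obtain ⟨s, hs, has⟩ := exists_norm_one_mul a
  obtain ⟨t, ht, hbt⟩ := exists_norm_one_mul b
  have hconj : ∀ z : ℂ, ‖z‖ = 1 → z * (starRingEnd ℂ) z = 1 := by
    intro z hz
    rw [Complex.mul_conj, Complex.normSq_eq_norm_sq, hz]
    simp
  -- Rotating by `e` before and by `t̄e` after, where `e² = s̄t`, turns the coefficients into `‖a‖`
  -- and `‖b‖`.
  obtain ⟨e, he⟩ := IsAlgClosed.exists_pow_nat_eq ((starRingEnd ℂ) s * t) two_pos
  have he1 : ‖e‖ = 1 := by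
    have h1 := congrArg norm he
    rw [norm_pow, norm_mul, RCLike.norm_conj, hs, ht, one_mul] at h1
    exact (pow_eq_one_iff_of_nonneg (norm_nonneg _) two_ne_zero).1 h1
  have hne : ∀ z : ℂ, ‖z‖ = 1 → z ≠ 0 := by
    rintro z hz rfl
    simp at hz
  have h1 := (h.mul_right (hne e he1)).mul_left (e := (starRingEnd ℂ) t * e)
    (mul_ne_zero (hne _ (by rw [RCLike.norm_conj, ht])) (hne e he1))
  have e1 : (starRingEnd ℂ) t * e * (a * e) = (‖a‖ : ℂ) := by
    conv_lhs => rw [has]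
    linear_combination ‖a‖ * (starRingEnd ℂ) t * s * he +
      ‖a‖ * (s * (starRingEnd ℂ) s) * hconj t ht + (‖a‖ : ℂ) * hconj s hs
  have e2 : (starRingEnd ℂ) t * e * (b * (starRingEnd ℂ) e) = (‖b‖ : ℂ) := by
    conv_lhs => rw [hbt]
    linear_combination ‖b‖ * (e * (starRingEnd ℂ) e) * hconj t ht + (‖b‖ : ℂ) * hconj e he1
  rw [e1, e2] at h1
  have h2 := h1.mul_eq_zero_of_nonneg hA (norm_nonneg _) (norm_nonneg _)
  rwa [← norm_mul, norm_eq_zero] at h2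

/-- If linear maps take copies of `A` to copies of `B` and conversely then the first one is a
similarity. -/
theorem MapsCopies.mul_eq_zero_of_inverse {A B : Set ℂ} (hA : IsBody A) {α β α' β' : ℂ}
    (h : MapsCopies A B α β) (h' : MapsCopies B A α' β') (hne : ‖α'‖ ≠ ‖β'‖) : α * β = 0 := by
  -- The two maps need not be inverse to each other, but any rotation `e` may be inserted between
  -- them. The product expands to `e²x + y + ē²z`, and `e = 1, i, √i` force all three terms to
  -- vanish.
  have key : ∀ e : ℂ, ‖e‖ = 1 → (α' * (e * α) + β' * ((starRingEnd ℂ) e * (starRingEnd ℂ) β)) *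
      (α' * (e * β) + β' * ((starRingEnd ℂ) e * (starRingEnd ℂ) α)) = 0 := by
    intro e he
    have he0 : e ≠ 0 := by
      rintro rfl
      simp at he
    have := (h'.comp (h.mul_left he0)).mul_eq_zero hA
    simpa only [map_mul] using this
  have k1 := key 1 norm_one
  have k2 := key Complex.I Complex.norm_I
  obtain ⟨s, hs⟩ := IsAlgClosed.exists_pow_nat_eq Complex.I two_pos
  have hs1 : ‖s‖ = 1 := by
    have h1 := congrArg norm hs
    rw [norm_pow, Complex.norm_I] at h1
    exact (pow_eq_one_iff_of_nonneg (norm_nonneg _) two_ne_zero).1 h1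
  have hs2 : s * (starRingEnd ℂ) s = 1 := by
    rw [Complex.mul_conj, Complex.normSq_eq_norm_sq, hs1]
    simp
  have hs3 : (starRingEnd ℂ) s ^ 2 = -Complex.I := by
    rw [← map_pow, hs, Complex.conj_I]
  have k3 := key s hs1
  simp only [map_one, Complex.conj_I] at k1 k2
  set x := α' ^ 2 * (α * β) with hx
  set y := α' * β' * (α * (starRingEnd ℂ) α + β * (starRingEnd ℂ) β) with hy
  set z := β' ^ 2 * ((starRingEnd ℂ) α * (starRingEnd ℂ) β) with hz
  have m1 : x + y + z = 0 := by linear_combination k1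
  have m2 : -x + y - z = 0 := by
    linear_combination k2 + (-x + y - z) * Complex.I_sq
  have m3 : Complex.I * x + y - Complex.I * z = 0 := by
    linear_combination k3 - x * hs - y * hs2 - z * hs3
  have hy0 : y = 0 := by linear_combination (m1 + m2) / 2
  have hxz : x = z := by
    apply mul_left_cancel₀ Complex.I_ne_zero
    linear_combination m3 - hy0
  have hx0 : x = 0 := by linear_combination (m1 - hy0 + hxz) / 2
  have hz0 : z = 0 := by rw [← hxz, hx0]
  by_cases hα' : α' = 0
  · have hβ' : β' ≠ 0 := by
      rintro rfl
      exact hne (by rw [hα'])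
    have h1 := (mul_eq_zero_iff_left (pow_ne_zero 2 hβ')).1 hz0
    rw [← map_mul, map_eq_zero] at h1
    exact h1
  · exact (mul_eq_zero_iff_left (pow_ne_zero 2 hα')).1 hx0

/-- The reflection of the complex plane in the imaginary axis. -/
def mirror (A : Set ℂ) : Set ℂ := (fun z => -(starRingEnd ℂ) z) '' A

theorem copy_inverse {K L : Set ℂ} {u v : ℂ × ℂ} (hu : u.1 ≠ 0) (hv : v.1 ≠ 0)
    (h : copy K u = copy L v) : ∃ w : Par, L = copy K w := by
  refine ⟨⟨(v.1⁻¹ * u.1, v.1⁻¹ * u.2 + -(v.1⁻¹ * v.2)), mul_ne_zero (inv_ne_zero hv) hu⟩, ?_⟩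
  rw [← copy_copy K u (v.1⁻¹, -(v.1⁻¹ * v.2)), h, copy_copy]
  simp only [inv_mul_cancel₀ hv, add_neg_cancel, copy_one]

theorem MapsCopies.exists_eq_copy {A B : Set ℂ} (hA : IsBody A) {α β α' β' : ℂ}
    (h : MapsCopies A B α β) (h' : MapsCopies B A α' β') (hne : ‖α‖ ≠ ‖β‖) (hne' : ‖α'‖ ≠ ‖β'‖) :
    (∃ w : Par, B = copy A w) ∨ ∃ w : Par, B = copy (mirror A) w := by
  obtain ⟨⟨v, hv0⟩, hv⟩ := h ⟨(1, 0), one_ne_zero⟩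
  simp only [copy_one] at hv
  rcases _root_.mul_eq_zero.1 (h.mul_eq_zero_of_inverse hA h' hne') with h0 | h0
  · right
    have hβ : β ≠ 0 := by
      rintro rfl
      exact hne (by rw [h0])
    refine copy_inverse (u := (-β, 0)) (neg_ne_zero.2 hβ) hv0 ?_
    rw [← hv, h0]
    simp only [copy, mirror, image_image]
    congr 1
    ext z
    simp [rlin]
  · left
    have hα : α ≠ 0 := by
      rintro rfl
      exact hne (by rw [h0])
    refine copy_inverse (u := (α, 0)) hα hv0 ?_
    rw [← hv, h0]
    simp only [copy]
    congr 1
    ext z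
    simp [rlin]

/-- The hard direction, in the complex plane. -/
theorem exists_eq_copy_of_realizable {A B : Set ℂ} (hA : IsBody A) (hB : IsBody B)
    (hfA : FillsHalfPlanes A) (hfB : FillsHalfPlanes B)
    (h : ∀ (n : ℕ) (G : SimpleGraph (Fin n)), Realizable A G ↔ Realizable B G) :
    (∃ w : Par, B = copy A w) ∨ ∃ w : Par, B = copy (mirror A) w := by
  obtain ⟨_, _, _, _, h₁⟩ := exists_pointMap hA hB fun n G => (h n G).1
  obtain ⟨_, _, _, _, h₂⟩ := exists_pointMap hB hA fun n G => (h n G).2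
  obtain ⟨α, β, hne, hm⟩ := h₁.exists_rlin hA hB hfA
  obtain ⟨α', β', hne', hm'⟩ := h₂.exists_rlin hB hA hfB
  exact (mapsCopies_of_norm_one hm).exists_eq_copy hA (mapsCopies_of_norm_one hm') hne hne'

/-! ### Supporting functionals and half-planes at a smooth boundary point. -/

section Support

variable {E : Type*} [NormedAddCommGroup E] [NormedSpace ℝ E]

theorem lt_of_mem_interior {A : Set E} {f : E →L[ℝ] ℝ} (hf : f ≠ 0) {c : ℝ}
    (h : ∀ z ∈ A, c ≤ f z) {z : E} (hz : z ∈ interior A) : c < f z := by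
  have h1 : f '' interior A ⊆ Ici c := by
    rintro _ ⟨y, hy, rfl⟩
    exact h y (interior_subset hy)
  have h2 := interior_maximal h1 (f.isOpenMap_of_ne_zero hf _ isOpen_interior)
  rw [interior_Ici] at h2
  exact h2 ⟨z, hz, rfl⟩

/-- Any two supporting functionals of `A` at `a` have the same kernel. -/
def UniqueSupport (A : Set E) (a : E) : Prop :=
  ∀ f g : E →L[ℝ] ℝ, f ≠ 0 → g ≠ 0 → (∀ z ∈ A, f a ≤ f z) → (∀ z ∈ A, g a ≤ g z) →
    ∀ v, f v = 0 → g v = 0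

/-- The tangent cone at a smooth boundary point is a half-space. -/
theorem UniqueSupport.exists_add_smul_mem {A : Set E} (hA : Convex ℝ A)
    (hne : (interior A).Nonempty) {a : E} (hu : UniqueSupport A a) {f : E →L[ℝ] ℝ} (hf : f ≠ 0)
    (hfA : ∀ z ∈ A, f a ≤ f z) {v : E} (hv : 0 < f v) : ∃ t : ℝ, 0 < t ∧ a + t • v ∈ A := by
  by_contra! hcon
  -- If the ray misses `A`, separating it from the interior gives a second support `-g` at `a` with
  -- `g v ≥ 0`. Uniqueness makes `-g` a positive multiple of `f`, so `-g v > 0`.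
  obtain ⟨g, c, hg1, hg2⟩ := geometric_hahn_banach_open (s := interior A)
    (t := (fun t : ℝ => a + t • v) '' Ioi 0) hA.interior isOpen_interior
    (by
      have h1 : Convex ℝ ((fun t : ℝ => t • v) '' Ioi 0) :=
        (convex_Ioi 0).linear_image (LinearMap.toSpanSingleton ℝ E v)
      have := h1.translate a
      rwa [image_image] at this)
    (by
      rw [Set.disjoint_left]
      rintro _ hz ⟨t, ht, rfl⟩
      exact hcon t ht (interior_subset hz))
  have hray : ∀ t : ℝ, 0 < t → c ≤ g a + t * g v := by
    intro t ht
    have := hg2 _ ⟨t, ht, rfl⟩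
    simpa using this
  have hca : c ≤ g a := by
    have h1 : Tendsto (fun t : ℝ => g a + t * g v) (𝓝[>] 0) (𝓝 (g a)) := by
      have : Continuous (fun t : ℝ => g a + t * g v) := by fun_prop
      have := (this.tendsto 0).mono_left (nhdsWithin_le_nhds (s := Ioi 0))
      simpa using this
    have hpos : ∀ᶠ t : ℝ in 𝓝[>] 0, 0 < t := self_mem_nhdsWithin
    exact ge_of_tendsto h1 (hpos.mono hray)
  obtain ⟨z₀, hz₀⟩ := hne
  have hgA : ∀ z ∈ A, g z ≤ c := by
    have h1 : closure (interior A) ⊆ {z | g z ≤ c} :=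
      closure_minimal (fun z hz => (hg1 z hz).le) (isClosed_le g.continuous continuous_const)
    rw [hA.closure_interior_eq_closure_of_nonempty_interior ⟨z₀, hz₀⟩] at h1
    exact fun z hz => h1 (subset_closure hz)
  have hgv : 0 ≤ g v := by
    by_contra! hneg
    have h1 := hray ((g a - c + 1) / -g v) (div_pos (by linarith) (by linarith))
    have h2 : (g a - c + 1) / -g v * g v = -(g a - c + 1) := by
      rw [div_neg, neg_mul, div_mul_cancel₀ _ hneg.ne]
    linarith
  have hg0 : g ≠ 0 := by
    rintro rfl
    have h1 := hg1 z₀ hz₀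
    have h2 := hray 1 one_pos
    simp only [zero_apply] at h1 h2
    linarith
  have hgsupp : ∀ z ∈ A, (-g) a ≤ (-g) z := fun z hz => by
    simp only [neg_apply]
    linarith [hgA z hz]
  have hf0 := sub_pos.2 (lt_of_mem_interior hf hfA hz₀)
  have hg0' := sub_pos.2 (lt_of_mem_interior (neg_ne_zero.2 hg0) hgsupp hz₀)
  have h1 := hu f (-g) hf (neg_ne_zero.2 hg0) hfA hgsupp (v - (f v / (f z₀ - f a)) • (z₀ - a)) (by
    rw [map_sub, map_smul, map_sub, smul_eq_mul, div_mul_cancel₀ _ hf0.ne', sub_self])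
  rw [map_sub, map_smul, map_sub, smul_eq_mul, sub_eq_zero] at h1
  have h2 : 0 < f v / (f z₀ - f a) * ((-g) z₀ - (-g) a) := mul_pos (div_pos hv hf0) hg0'
  rw [← h1] at h2
  simp only [neg_apply] at h2
  linarith

/-- A convex body has a supporting functional at some boundary point. -/
theorem exists_frontier_support {A : Set E} (hA : IsCompact A) {f : E →L[ℝ] ℝ} (hf : f ≠ 0)
    (hne : A.Nonempty) : ∃ a ∈ frontier A, ∀ z ∈ A, f a ≤ f z := by
  obtain ⟨a, ha, hmin⟩ := hA.exists_isMinOn hne f.continuous.continuousOn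
  have hmin' : ∀ z ∈ A, f a ≤ f z := fun z hz => hmin hz
  exact ⟨a, ⟨subset_closure ha, fun hi => (lt_of_mem_interior hf hmin' hi).ne rfl⟩, hmin'⟩

end Support

/-- The tangent cone at a smooth point is a half-plane, so magnifying `A` about `a` eventually
captures any finite subset of the open half-plane. -/
theorem fillsHalfPlanes_of_uniqueSupport {A : Set ℂ} (hA : Convex ℝ A)
    (hne : (interior A).Nonempty) {a : ℂ} (ha : a ∈ A) (hu : UniqueSupport A a) {f : ℂ →L[ℝ] ℝ}
    (hf : f ≠ 0) (hfA : ∀ z ∈ A, f a ≤ f z) : FillsHalfPlanes A := by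
  intro P hP
  set n : ℂ := ⟨f 1, f Complex.I⟩ with hn
  have hfn : ∀ z : ℂ, f z = (Complex.I * (starRingEnd ℂ) n * z).im := by
    intro z
    have e : z = z.re • (1 : ℂ) + z.im • Complex.I := by
      simp only [Complex.real_smul, mul_one]
      exact (Complex.re_add_im z).symm
    conv_lhs => rw [e]
    rw [map_add, map_smul, map_smul]
    simp [hn]
    ring
  set ω := Complex.I * (starRingEnd ℂ) n with hω
  have hω0 : ω ≠ 0 := by
    intro h0
    apply hf
    refine ContinuousLinearMap.ext fun z => ?_
    rw [hfn, h0]; simp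
  -- The supporting line is placed at height `m`, strictly between the real axis and `P`, so that
  -- the closed body stays in the open half-plane.
  obtain ⟨m, hm, hmP⟩ : ∃ m : ℝ, 0 < m ∧ ∀ p ∈ P, m < p.im := by
    rcases P.eq_empty_or_nonempty with rfl | hPne
    · exact ⟨1, one_pos, by simp⟩
    · obtain ⟨p, hp, hmin⟩ := P.exists_min_image Complex.im hPne
      exact ⟨p.im / 2, by linarith [hP p hp], fun q hq => by linarith [hmin q hq, hP p hp]⟩
  have hex : ∀ p ∈ P, ∃ t : ℝ, 0 < t ∧ a + t • ((p - m * Complex.I) / ω) ∈ A := by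
    intro p hp
    apply hu.exists_add_smul_mem hA hne hf hfA
    rw [hfn, mul_div_cancel₀ _ hω0]
    have := hmP p hp
    simpa using this
  choose! t ht0 htA using hex
  obtain ⟨s, hs, hsP⟩ : ∃ s : ℝ, 0 < s ∧ ∀ p ∈ P, s ≤ t p := by
    rcases P.eq_empty_or_nonempty with rfl | hPne
    · exact ⟨1, one_pos, by simp⟩
    · obtain ⟨p, hp, hmin⟩ := P.exists_min_image t hPne
      exact ⟨t p, ht0 p hp, hmin⟩
  have hs' : (s : ℂ) ≠ 0 := by exact_mod_cast hs.ne'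
  refine ⟨⟨(ω / s, m * Complex.I - ω / s * a), div_ne_zero hω0 hs'⟩, ?_, ?_⟩
  · intro p hp
    have hp : p ∈ P := hp
    refine ⟨a + s • ((p - m * Complex.I) / ω), ?_, ?_⟩
    · have h1 := hA ha (htA p hp) (a := 1 - s / t p) (b := s / t p)
        (by rw [sub_nonneg, div_le_one (ht0 p hp)]; exact hsP p hp)
        (div_nonneg hs.le (ht0 p hp).le) (by ring)
      convert h1 using 1
      rw [smul_add, ← add_assoc, ← add_smul, smul_smul, div_mul_cancel₀ _ (ht0 p hp).ne']
      simp
    · simp only [Complex.real_smul]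
      field_simp
      ring
  · rintro _ ⟨z, hz, rfl⟩
    have h1 : (ω / s * z + (m * Complex.I - ω / s * a)).im = m + (f z - f a) / s := by
      have e : ω / s * z + (m * Complex.I - ω / s * a) =
          m * Complex.I + ((1 / s : ℝ) : ℂ) * (ω * z - ω * a) := by
        push_cast; ring
      rw [e, hfn, hfn, Complex.add_im, Complex.im_ofReal_mul, Complex.im_ofReal_mul, Complex.sub_im]
      simp
      ring
    simp only
    rw [h1]
    have := div_nonneg (sub_nonneg.2 (hfA z hz)) hs.le
    linarith

/-! ### Invariance of realizability under similarity and reflection. -/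

theorem realizable_copy {A : Set ℂ} (w : Par) {n : ℕ} {G : SimpleGraph (Fin n)}
    (h : Realizable (copy A w) G) : Realizable A G := by
  obtain ⟨u, hu⟩ := h
  refine ⟨fun i => ⟨((u i).1.1 * w.1.1, (u i).1.1 * w.1.2 + (u i).1.2), mul_ne_zero (u i).2 w.2⟩,
    fun i j hij => ?_⟩
  rw [← hu i j hij, copy_copy, copy_copy]

theorem realizable_copy_iff {A : Set ℂ} (w : Par) {n : ℕ} {G : SimpleGraph (Fin n)} :
    Realizable (copy A w) G ↔ Realizable A G := by
  refine ⟨realizable_copy w, fun h => ?_⟩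
  obtain ⟨v, hv⟩ := copy_inverse (K := copy A w) (L := A) (u := (1, 0)) (v := w) one_ne_zero w.2
    (copy_one _)
  rw [hv] at h
  exact realizable_copy v h

theorem mirror_mirror (A : Set ℂ) : mirror (mirror A) = A := by
  simp [mirror, image_image]

theorem realizable_mirror {A : Set ℂ} {n : ℕ} {G : SimpleGraph (Fin n)}
    (h : Realizable (mirror A) G) : Realizable A G := by
  obtain ⟨u, hu⟩ := h
  refine ⟨fun i => ⟨((starRingEnd ℂ) (u i).1.1, -(starRingEnd ℂ) (u i).1.2),
    (map_ne_zero _).2 (u i).2⟩, fun i j hij => ?_⟩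
  have hinj : Function.Injective fun z : ℂ => -(starRingEnd ℂ) z := fun x y hxy =>
    (starRingEnd ℂ).injective (neg_injective hxy)
  have e : ∀ k, copy (mirror A) (u k) =
      mirror (copy A ((starRingEnd ℂ) (u k).1.1, -(starRingEnd ℂ) (u k).1.2)) := by
    intro k
    simp only [copy, mirror, image_image]
    congr 1
    ext z
    simp [add_comm]
  rw [← hu i j hij, e, e]
  simp only [mirror]
  rw [← image_inter hinj, image_nonempty]

theorem realizable_mirror_iff {A : Set ℂ} {n : ℕ} {G : SimpleGraph (Fin n)} :
    Realizable (mirror A) G ↔ Realizable A G :=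
  ⟨realizable_mirror, fun h => realizable_mirror (by rwa [mirror_mirror])⟩

/-! ### Transfer between the Euclidean plane and ℂ. -/

theorem uniqueSupport_of_isSmoothConvexDisk {A : Set Plane} (hA : IsSmoothConvexDisk A) {a : Plane}
    (ha : a ∈ frontier A) : UniqueSupport A a := by
  intro f g hf hg hfA hgA v hv
  have haA : a ∈ A := hA.1.2.1.isClosed.frontier_subset ha
  have key : ∀ f : Plane →L[ℝ] ℝ, f ≠ 0 → (∀ z ∈ A, f a ≤ f z) →
      IsTangentLine (AffineSubspace.mk' a (LinearMap.ker (f : Plane →ₗ[ℝ] ℝ))) A ∧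
        a ∈ AffineSubspace.mk' a (LinearMap.ker (f : Plane →ₗ[ℝ] ℝ)) := by
    intro f hf hfA
    have hmem := AffineSubspace.self_mem_mk' a (LinearMap.ker (f : Plane →ₗ[ℝ] ℝ))
    refine ⟨⟨?_, ⟨a, hmem, haA⟩, ?_⟩, hmem⟩
    · rw [AffineSubspace.direction_mk']
      have h1 := LinearMap.finrank_range_add_finrank_ker (f : Plane →ₗ[ℝ] ℝ)
      have hf' : (f : Plane →ₗ[ℝ] ℝ) ≠ 0 := fun h0 => hf (by
        ext z; exact LinearMap.congr_fun h0 z)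
      rw [LinearMap.range_eq_top.2 (LinearMap.surjective hf'), finrank_top,
        finrank_euclideanSpace_fin, Module.finrank_self] at h1
      omega
    · rw [Set.disjoint_left]
      intro z hz hzA
      have h1 : z -ᵥ a ∈ LinearMap.ker (f : Plane →ₗ[ℝ] ℝ) := AffineSubspace.mem_mk'.1 hz
      rw [LinearMap.mem_ker] at h1
      have h2 : f (z - a) = 0 := h1
      rw [map_sub] at h2
      linarith [lt_of_mem_interior hf hfA hzA]
  have heq := (hA.2 a ha).unique (key f hf hfA) (key g hg hgA)
  have hdir := congrArg AffineSubspace.direction heq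
  rw [AffineSubspace.direction_mk', AffineSubspace.direction_mk'] at hdir
  have h1 : v ∈ LinearMap.ker (f : Plane →ₗ[ℝ] ℝ) := hv
  rw [hdir] at h1
  exact h1

/-- The complex coordinate of the plane. -/
noncomputable def planeEquiv : ℂ ≃ₗᵢ[ℝ] Plane := Complex.orthonormalBasisOneI.repr

theorem planeEquiv_apply (z : ℂ) : planeEquiv z = !₂[z.re, z.im] := rfl

theorem planeRotation_planeEquiv (θ : ℝ) (z : ℂ) :
    planeRotation θ (planeEquiv z) = planeEquiv (Complex.exp (θ * Complex.I) * z) := by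
  rw [planeEquiv_apply, planeEquiv_apply, Complex.exp_mul_I, ← Complex.ofReal_cos,
    ← Complex.ofReal_sin]
  ext i
  fin_cases i <;>
    simp [planeRotation, Matrix.toLpLin_apply, -Complex.ofReal_cos, -Complex.ofReal_sin] <;> ring

/-- The plane set `A` in the complex coordinate. -/
noncomputable def toComplex (A : Set Plane) : Set ℂ := planeEquiv ⁻¹' A

theorem planeEquiv_image_toComplex (A : Set Plane) : planeEquiv '' toComplex A = A :=
  image_preimage_eq _ planeEquiv.surjective

theorem toComplex_image (X : Set ℂ) : toComplex (planeEquiv '' X) = X :=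
  preimage_image_eq _ planeEquiv.injective

theorem mem_similarities_iff {A A' : Set Plane} :
    A' ∈ similarities A ↔ ∃ u : Par, A' = planeEquiv '' copy (toComplex A) u := by
  have key : ∀ (r θ : ℝ) (z : Plane), (fun a => r • planeRotation θ a + z) '' A =
      planeEquiv '' copy (toComplex A)
        (r * Complex.exp (θ * Complex.I), planeEquiv.symm z) := by
    intro r θ z
    conv_lhs => rw [← planeEquiv_image_toComplex A]
    simp only [copy, image_image, map_add, LinearIsometryEquiv.apply_symm_apply]
    congr 1
    ext1 a
    rw [planeRotation_planeEquiv, ← map_smul, Complex.real_smul, mul_assoc]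
  constructor
  · rintro ⟨r, θ, z, hr, rfl⟩
    refine ⟨⟨(r * Complex.exp (θ * Complex.I), planeEquiv.symm z), ?_⟩, key r θ z⟩
    exact mul_ne_zero (by exact_mod_cast hr.ne') (Complex.exp_ne_zero _)
  · rintro ⟨⟨⟨w, b⟩, hw⟩, rfl⟩
    refine ⟨‖w‖, w.arg, planeEquiv b, norm_pos_iff.2 hw, ?_⟩
    rw [key, Complex.norm_mul_exp_arg_mul_I, LinearIsometryEquiv.symm_apply_apply]

theorem mem_similarities_iff_toComplex {A A' : Set Plane} :
    A' ∈ similarities A ↔ ∃ u : Par, toComplex A' = copy (toComplex A) u := by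
  rw [mem_similarities_iff]
  refine exists_congr fun u => ⟨?_, fun h => ?_⟩
  · rintro rfl
    exact toComplex_image _
  · rw [← h, planeEquiv_image_toComplex]

theorem toComplex_reflection (A : Set Plane) : toComplex (reflection A) = mirror (toComplex A) := by
  rw [← planeEquiv_image_toComplex A, toComplex_image, reflection, image_image]
  have : (fun z : ℂ => (!₂[-(planeEquiv z 0), planeEquiv z 1] : Plane)) =
      fun z => planeEquiv (-(starRingEnd ℂ) z) := by
    ext z i
    rw [planeEquiv_apply, planeEquiv_apply]
    fin_cases i <;> simp
  rw [this, ← image_image planeEquiv, toComplex_image]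
  rfl

theorem mem_simGraphs_iff {A : Set Plane} {n : ℕ} {G : SimpleGraph (Fin n)} :
    (⟨n, G⟩ : Σ n : ℕ, SimpleGraph (Fin n)) ∈ simGraphs A ↔ Realizable (toComplex A) G := by
  constructor
  · rintro ⟨R, hR, hadj⟩
    choose u hu using fun i => mem_similarities_iff.1 (hR i)
    refine ⟨u, fun i j hij => ?_⟩
    rw [← hadj i j hij, hu i, hu j, ← image_inter planeEquiv.injective, image_nonempty]
  · rintro ⟨u, hu⟩
    refine ⟨fun i => planeEquiv '' copy (toComplex A) (u i),
      fun i => mem_similarities_iff.2 ⟨u i, rfl⟩, fun i j hij => ?_⟩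
    rw [← hu i j hij, ← image_inter planeEquiv.injective, image_nonempty]

theorem simGraphs_eq_iff {A B : Set Plane} : simGraphs A = simGraphs B ↔
    ∀ (n : ℕ) (G : SimpleGraph (Fin n)), Realizable (toComplex A) G ↔ Realizable (toComplex B) G := by
  simp only [← mem_simGraphs_iff]
  rw [Set.ext_iff, Sigma.forall]

theorem isBody_toComplex {A : Set Plane} (hA : IsConvexDisk A) : IsBody (toComplex A) where
  convex := hA.1.linear_preimage (planeEquiv.toLinearEquiv : ℂ →ₗ[ℝ] Plane)
  compact := planeEquiv.toHomeomorph.isCompact_preimage.2 hA.2.1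
  nonempty := by
    have h1 : planeEquiv ⁻¹' interior A = interior (toComplex A) :=
      planeEquiv.toHomeomorph.preimage_interior A
    rw [← h1]
    exact hA.2.2.preimage planeEquiv.surjective

theorem UniqueSupport.toComplex {A : Set Plane} {a : ℂ} (h : UniqueSupport A (planeEquiv a)) :
    UniqueSupport (toComplex A) a := by
  intro f g hf hg hfA hgA v hv
  have hne : ∀ f : ℂ →L[ℝ] ℝ, f ≠ 0 →
      f.comp (planeEquiv.symm.toContinuousLinearEquiv : Plane →L[ℝ] ℂ) ≠ 0 := by
    intro f hf h0
    apply hf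
    refine ContinuousLinearMap.ext fun z => ?_
    have := DFunLike.congr_fun h0 (planeEquiv z)
    simpa using this
  have hA : ∀ f : ℂ →L[ℝ] ℝ, (∀ z ∈ _root_.toComplex A, f a ≤ f z) → ∀ z ∈ A,
      f.comp (planeEquiv.symm.toContinuousLinearEquiv : Plane →L[ℝ] ℂ) (planeEquiv a) ≤
      f.comp (planeEquiv.symm.toContinuousLinearEquiv : Plane →L[ℝ] ℂ) z := by
    intro f hf z hz
    have := hf (planeEquiv.symm z) (by simpa [_root_.toComplex] using hz)
    simpa using this
  have := h _ _ (hne f hf) (hne g hg) (hA f hfA) (hA g hgA) (planeEquiv v) (by simpa using hv)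
  simpa using this

theorem fillsHalfPlanes_toComplex {A : Set Plane} (hA : IsSmoothConvexDisk A) :
    FillsHalfPlanes (toComplex A) := by
  have hbody := isBody_toComplex hA.1
  have hre : Complex.reCLM ≠ 0 := fun h0 => by
    have := DFunLike.congr_fun h0 (1 : ℂ)
    simp at this
  obtain ⟨a, ha, hsupp⟩ := exists_frontier_support hbody.compact hre hbody.ne
  have h1 : planeEquiv ⁻¹' frontier A = frontier (toComplex A) :=
    planeEquiv.toHomeomorph.preimage_frontier A
  rw [← h1] at ha
  exact fillsHalfPlanes_of_uniqueSupport hbody.convex hbody.nonempty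
    (hA.1.2.1.isClosed.frontier_subset ha)
    (uniqueSupport_of_isSmoothConvexDisk hA ha).toComplex hre hsupp

theorem theorem2 (A B : Set Plane) (hA : IsSmoothConvexDisk A) (hB : IsSmoothConvexDisk B) :
    simGraphs A = simGraphs B ↔ B ∈ similarities A ∨ B ∈ similarities (reflection A) := by
  rw [simGraphs_eq_iff, mem_similarities_iff_toComplex, mem_similarities_iff_toComplex,
    toComplex_reflection]
  refine ⟨exists_eq_copy_of_realizable (isBody_toComplex hA.1) (isBody_toComplex hB.1)
    (fillsHalfPlanes_toComplex hA) (fillsHalfPlanes_toComplex hB), ?_⟩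
  rintro (⟨u, hu⟩ | ⟨u, hu⟩) n G
  · rw [hu, realizable_copy_iff]
  · rw [hu, realizable_copy_iff, realizable_mirror_iff]
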